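/- Let $\mathbb S^1=\mathbb R/\mathbb Z$, and call a point of $\mathbb S^1$ dyadic if it is the image of a dyadic rational. Thompson's group $T$ is the group of orientation-preserving piecewise linear homeomorphisms of $\mathbb S^1$ with finitely many breakpoints, all at dyadic points, with slopes in $2^{\mathbb Z}$, and which preserve the set of dyadic points. Thompson's group $F$ is the stabilizer of the point $0$ in $T$. Let $\mathcal C=\{0,1\}^{\mathbb N}$ be the binary Cantor set with the product topology and, for a finite binary word $w$, let $C_w\subset\mathcal C$ be the cylinder of sequences with prefix $w$. Thompson's group $V$ is the group of homeomorphisms $g$ of $\mathcal C$ for which there are two cylinder partitions $\{C_{w_1},\dots,C_{w_n}\}$ and $\{C_{z_1},\dots,C_{z_n}\}$ of $\mathcal C$ with $g(w_ix)=z_ix$ for every $i$ and every $x\in\mathcal C$. An action of a group $G$ by homeomorphisms on a topological space $X$ is minimal if every orbit is dense; it is topologically free if the fixed-point set of every $g\neq 1$ has empty interior; it is non-trivial if some element of $G$ moves some point of $X$. It factors onto an action of $G$ on $Y$ if there is a factor map $X\to Y$, i.e. a continuous surjective $G$-equivariant map. For $y \in Y$, let $G^0_y$ be the subgroup of those $g\in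 G$ that fix pointwise a neighbourhood of $y$. Compact spaces are assumed Hausdorff. (i) Every faithful minimal action of $F$ on a compact space is topologically free. (ii) Every non-trivial minimal action of $T$ on a compact space $X$ which is not topologically free factors onto the standard action of $T$ on $\mathbb S^1$. (iii) Every non-trivial minimal action of $V$ on a compact space $X$ which is not topologically free factors onto the standard action of $V$ on $\mathcal C$. Moreover, in (ii) (respectively (iii)) the factor map $\varphi\colon X\to\mathbb S^1$ (respectively $\varphi\colon X\to\mathcal C$) is unique, and for every $x\in X$ the point $\varphi(x)$ is the unique point $z$ of $\mathbb S^1$ (respectively of $\mathcal C$) such that every element of $T^0_z$ (respectively $V^0_z$) fixes $x$. -/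

import Mathlib

open Topology

namespace Thompson

section Actions

/-- The tautological action of the homeomorphism group of `Y` on `Y`. Subgroups of `Y ≃ₜ Y`
act on `Y` by restriction of this action. -/
instance homeoMulAction (Y : Type*) [TopologicalSpace Y] : MulAction (Y ≃ₜ Y) Y where
  smul f y := f y
  one_smul _ := rfl
  mul_smul _ _ _ := rfl

/-- The action is topologically free: the set of fixed points of every non-trivial element has
empty interior. -/
def IsTopologicallyFree (G : Type*) (X : Type*) [Group G] [TopologicalSpace X]
    [MulAction G X] : Prop :=
  ∀ g : G, g ≠ 1 → interior {x : X | g • x = x} = ∅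

/-- The action is non-trivial: some element moves some point. -/
def IsNontrivialAction (G : Type*) (X : Type*) [Group G] [MulAction G X] : Prop :=
  ∃ (g : G) (x : X), g • x ≠ x

/-- A factor map: a continuous surjective equivariant map. -/
structure IsFactorMap (G : Type*) {X Y : Type*} [Group G] [TopologicalSpace X]
    [TopologicalSpace Y] [MulAction G X] [MulAction G Y] (φ : X → Y) : Prop where
  continuous : Continuous φ
  surjective : Function.Surjective φ
  equivariant : ∀ (g : G) (x : X), φ (g • x) = g • φ x

/-- The subgroup `G⁰_y` of the elements of `G` that fix pointwise a neighbourhood of `y`. -/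
def nbhdStabilizer (G : Type*) {Y : Type*} [Group G] [TopologicalSpace Y] [MulAction G Y]
    (y : Y) : Subgroup G where
  carrier := {g | ∀ᶠ y' in 𝓝 y, g • y' = y'}
  one_mem' := by simp
  mul_mem' := by
    intro a b ha hb
    filter_upwards [ha, hb] with y' h1 h2
    rw [mul_smul, h2, h1]
  inv_mem' := by
    intro a ha
    filter_upwards [ha] with y' h1
    rw [inv_smul_eq_iff, h1]

end Actions

section Circle

/-- The image in the circle `ℝ/ℤ` of the dyadic rationals. -/
def dyadicPoints : Set UnitAddCircle :=
  {x | ∃ (a : ℤ) (n : ℕ), x = (((a : ℝ) / 2 ^ n : ℝ) : UnitAddCircle)}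

/-- Near `x`, the map `f` of the circle is affine with slope a power of `2`
(in particular it preserves the orientation near `x`). -/
def IsAffineDyadicAt (f : UnitAddCircle → UnitAddCircle) (x : UnitAddCircle) : Prop :=
  ∃ k : ℤ, ∀ᶠ t : ℝ in 𝓝 0,
    f (x + (t : UnitAddCircle)) = f x + (((2 : ℝ) ^ k * t : ℝ) : UnitAddCircle)

/-- A homeomorphism of the circle that is piecewise linear, with slopes in `2^ℤ`, with finitely
many breakpoints all of which are dyadic, and that preserves the set of dyadic points. -/
structure IsThompsonT (f : UnitAddCircle ≃ₜ UnitAddCircle) : Prop where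
  piecewise : ∃ B : Set UnitAddCircle, B.Finite ∧ B ⊆ dyadicPoints ∧
    ∀ x ∉ B, IsAffineDyadicAt f x
  dyadic : ∀ x, f x ∈ dyadicPoints ↔ x ∈ dyadicPoints

theorem IsThompsonT.mul {f g : UnitAddCircle ≃ₜ UnitAddCircle} (hf : IsThompsonT f)
    (hg : IsThompsonT g) : IsThompsonT (f * g) := by
  obtain ⟨B, hB, hBd, hBa⟩ := hf.piecewise
  obtain ⟨C, hC, hCd, hCa⟩ := hg.piecewise
  refine ⟨⟨C ∪ g ⁻¹' B, hC.union (hB.preimage g.injective.injOn), ?_, ?_⟩, ?_⟩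
  · rintro x (hx | hx)
    · exact hCd hx
    · exact (hg.dyadic x).1 (hBd hx)
  · intro x hx
    simp only [Set.mem_union, Set.mem_preimage, not_or] at hx
    obtain ⟨k, hk⟩ := hCa x hx.1
    obtain ⟨l, hl⟩ := hBa (g x) hx.2
    refine ⟨l + k, ?_⟩
    have ht : Filter.Tendsto (fun t : ℝ => (2 : ℝ) ^ k * t) (𝓝 0) (𝓝 0) := by
      have : Continuous (fun t : ℝ => (2 : ℝ) ^ k * t) := by fun_prop
      simpa using this.tendsto 0
    filter_upwards [hk, ht.eventually hl] with t h1 h2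
    simp only [Homeomorph.mul_apply]
    rw [h1, h2, zpow_add₀ (by norm_num), mul_assoc]
  · intro x
    simp only [Homeomorph.mul_apply]
    rw [hf.dyadic, hg.dyadic]

theorem IsThompsonT.inv {f : UnitAddCircle ≃ₜ UnitAddCircle} (hf : IsThompsonT f) :
    IsThompsonT f⁻¹ := by
  obtain ⟨B, hB, hBd, hBa⟩ := hf.piecewise
  refine ⟨⟨f '' B, hB.image f, ?_, ?_⟩, ?_⟩
  · rintro _ ⟨x, hx, rfl⟩
    exact (hf.dyadic x).2 (hBd hx)
  · intro y hy
    obtain ⟨x, rfl⟩ := f.surjective y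
    have hx : x ∉ B := fun h => hy ⟨x, h, rfl⟩
    obtain ⟨k, hk⟩ := hBa x hx
    refine ⟨-k, ?_⟩
    have ht : Filter.Tendsto (fun t : ℝ => (2 : ℝ) ^ (-k) * t) (𝓝 0) (𝓝 0) := by
      have : Continuous (fun t : ℝ => (2 : ℝ) ^ (-k) * t) := by fun_prop
      simpa using this.tendsto 0
    filter_upwards [ht.eventually hk] with t h1
    have h2 : (2 : ℝ) ^ k * ((2 : ℝ) ^ (-k) * t) = t := by
      rw [← mul_assoc, ← zpow_add₀ (by norm_num)]
      simp
    rw [h2] at h1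
    rw [← h1]
    simp
  · intro y
    obtain ⟨x, rfl⟩ := f.surjective y
    simp [hf.dyadic]

/-- Thompson's group `T`, acting on the circle `ℝ/ℤ`. -/
def thompsonT : Subgroup (UnitAddCircle ≃ₜ UnitAddCircle) where
  carrier := {f | IsThompsonT f}
  one_mem' := ⟨⟨∅, Set.finite_empty, Set.empty_subset _, fun _ _ => ⟨0, by simp⟩⟩, by simp⟩
  mul_mem' := IsThompsonT.mul
  inv_mem' := IsThompsonT.inv

/-- Thompson's group `F`: the stabilizer in `T` of the point `0` of the circle. -/
def thompsonF : Subgroup (UnitAddCircle ≃ₜ UnitAddCircle) :=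
  thompsonT ⊓ MulAction.stabilizer (UnitAddCircle ≃ₜ UnitAddCircle) (0 : UnitAddCircle)

end Circle

section Cantor

/-- The binary Cantor set, with the product topology. -/
abbrev Cantor : Type := ℕ → Bool

/-- The infinite sequence `w x` obtained by writing the finite word `w` before `x`. -/
def prepend : List Bool → Cantor → Cantor
  | [], x => x
  | b :: w, x => fun n => Nat.casesOn n b (prepend w x)

/-- The cylinder of the sequences that have `w` as an initial prefix. -/
def cylinder (w : List Bool) : Set Cantor := Set.range (prepend w)

/-- The cylinders of the words `w 0, …, w (n - 1)` form a partition of the Cantor set. -/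
def IsCylinderPartition {n : ℕ} (w : Fin n → List Bool) : Prop :=
  ∀ x : Cantor, ∃! i, x ∈ cylinder (w i)

/-- A homeomorphism of the Cantor set that replaces prefixes according to two cylinder
partitions. -/
def IsThompsonV (g : Cantor ≃ₜ Cantor) : Prop :=
  ∃ (n : ℕ) (w z : Fin n → List Bool), IsCylinderPartition w ∧ IsCylinderPartition z ∧
    ∀ i x, g (prepend (w i) x) = prepend (z i) x

theorem prepend_append (u v : List Bool) (x : Cantor) :
    prepend (u ++ v) x = prepend u (prepend v x) := by
  induction u with
  | nil => rfl
  | cons b u ih => simp [prepend, ih]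

theorem prepend_cons_inj {b c : Bool} {u v : List Bool} {x y : Cantor}
    (h : prepend (b :: u) x = prepend (c :: v) y) : b = c ∧ prepend u x = prepend v y :=
  ⟨congrFun h 0, funext fun n => congrFun h (n + 1)⟩

theorem exists_prefix {u v : List Bool} {x y : Cantor} (h : prepend u x = prepend v y)
    (hl : u.length ≤ v.length) : ∃ r, v = u ++ r := by
  induction u generalizing v with
  | nil => exact ⟨v, rfl⟩
  | cons b u ih =>
    cases v with
    | nil => simp at hl
    | cons c v =>
      obtain ⟨rfl, h2⟩ := prepend_cons_inj h
      obtain ⟨r, rfl⟩ := ih h2 (by simpa using hl)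
      exact ⟨r, rfl⟩

theorem exists_prepend (N : ℕ) (x : Cantor) :
    ∃ (w : List Bool) (y : Cantor), w.length = N ∧ prepend w y = x := by
  induction N generalizing x with
  | zero => exact ⟨[], x, rfl, rfl⟩
  | succ N ih =>
    obtain ⟨w, y, hw, hy⟩ := ih (fun n => x (n + 1))
    refine ⟨x 0 :: w, y, by simp [hw], ?_⟩
    funext n
    cases n with
    | zero => rfl
    | succ n => exact congrFun hy n

/-- A homeomorphism belongs to `V` if and only if it replaces the prefixes of some fixed
length. -/
theorem isThompsonV_iff (g : Cantor ≃ₜ Cantor) : IsThompsonV g ↔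
    ∃ N : ℕ, ∀ w : List Bool, w.length = N → ∃ z, ∀ y, g (prepend w y) = prepend z y := by
  constructor
  · rintro ⟨n, w, z, hw, -, h⟩
    refine ⟨Finset.univ.sup fun i => (w i).length, fun u hu => ?_⟩
    obtain ⟨i, ⟨y, hy⟩, -⟩ := hw (prepend u fun _ => false)
    have hi : (w i).length ≤ u.length := by
      rw [hu]
      exact Finset.le_sup (f := fun i => (w i).length) (Finset.mem_univ i)
    obtain ⟨r, rfl⟩ := exists_prefix hy hi
    exact ⟨z i ++ r, fun y => by rw [prepend_append, prepend_append, h]⟩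
  · rintro ⟨N, h⟩
    let e : {l : List Bool // l.length = N} ≃ Fin _ := Fintype.equivFin (List.Vector Bool N)
    choose z hz using h
    have hpart : ∀ x : Cantor, ∃! i, x ∈ cylinder (e.symm i).1 := by
      intro x
      obtain ⟨w, y, hw, rfl⟩ := exists_prepend N x
      refine ⟨e ⟨w, hw⟩, ⟨y, by simp⟩, ?_⟩
      rintro i ⟨y', hy'⟩
      obtain ⟨r, hr⟩ := exists_prefix hy' (by rw [hw, (e.symm i).2])
      have hlen := congrArg List.length hr
      rw [List.length_append, hw, (e.symm i).2] at hlen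
      have hr0 : r = [] := List.length_eq_zero_iff.1 (by omega)
      rw [← Equiv.symm_apply_eq]
      apply Subtype.ext
      simp [hr, hr0]
    refine ⟨_, fun i => (e.symm i).1, fun i => z (e.symm i).1 (e.symm i).2, hpart, ?_,
      fun i x => hz _ _ _⟩
    intro x
    have key : ∀ i, x ∈ cylinder (z (e.symm i).1 (e.symm i).2) ↔
        g.symm x ∈ cylinder (e.symm i).1 := by
      intro i
      constructor
      · rintro ⟨y, rfl⟩
        exact ⟨y, by rw [← hz _ (e.symm i).2, Homeomorph.symm_apply_apply]⟩
      · rintro ⟨y, hy⟩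
        exact ⟨y, by rw [← hz _ (e.symm i).2, hy, Homeomorph.apply_symm_apply]⟩
    simpa only [key] using hpart (g.symm x)

theorem IsThompsonV.mul {f g : Cantor ≃ₜ Cantor} (hf : IsThompsonV f) (hg : IsThompsonV g) :
    IsThompsonV (f * g) := by
  rw [isThompsonV_iff] at hf hg ⊢
  obtain ⟨M, hM⟩ := hf
  obtain ⟨N, hN⟩ := hg
  refine ⟨N + M, fun w hw => ?_⟩
  obtain ⟨z, hz⟩ := hN (w.take N) (by simp [hw])
  obtain ⟨z', hz'⟩ := hM ((z ++ w.drop N).take M) (by simp [hw])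
  refine ⟨z' ++ (z ++ w.drop N).drop M, fun y => ?_⟩
  rw [Homeomorph.mul_apply, prepend_append, ← hz', ← prepend_append, List.take_append_drop,
    prepend_append, ← hz, ← prepend_append, List.take_append_drop]

theorem IsThompsonV.inv {g : Cantor ≃ₜ Cantor} (hg : IsThompsonV g) : IsThompsonV g⁻¹ := by
  obtain ⟨n, w, z, hw, hz, h⟩ := hg
  refine ⟨n, z, w, hz, hw, fun i x => ?_⟩
  rw [← h i x, Homeomorph.inv_apply, Homeomorph.symm_apply_apply]

/-- Thompson's group `V`, acting on the binary Cantor set. -/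
def thompsonV : Subgroup (Cantor ≃ₜ Cantor) where
  carrier := {g | IsThompsonV g}
  one_mem' := (isThompsonV_iff 1).2 ⟨0, fun w _ => ⟨w, fun _ => rfl⟩⟩
  mul_mem' := IsThompsonV.mul
  inv_mem' := IsThompsonV.inv

end Cantor

end Thompson

/-!
Write `G⁰_z` for the germ stabilizer `nbhdStabilizer G z`. The theorem rests on the fact that the
stabilizers of a minimal action which is not topologically free are large.

If a minimal action of `G` on a compact space `X` is not topologically free, compactness gives a
finite set `P` of non-trivial elements that meets every point stabilizer
(`exists_finset_confining`). Suppose that `G` also acts faithfully on a Hausdorff space `Y` in such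
a way that arbitrarily small open sets support infinite non-abelian simple subgroups `D`. Then some
point of `X` is fixed by one of these subgroups (`exists_le_stabilizer_of_confined`). Indeed, take
`P` of minimal cardinality and `D` supported in an open set which every `p ∈ P` fixes pointwise or
displaces. For a suitable point `x` the subgroup `D` is the union of the sets
`{l | l⁻¹ p l ∈ G_x}` with `p ∈ P` displacing. By Neumann's lemma on coset coverings one of these
sets is large (`exists_large_of_cover`). Since `D` and `p⁻¹ D p` commute, products of two elements
`l⁻¹ p l` exhibit a non-trivial normal subgroup of `D` whose conjugate by `p` lies in `G_x`;
simplicity of `D` then gives `p⁻¹ D p ≤ G_x` (`conj_le_of_large`).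

For `V` acting on the Cantor set, the groups `D` are copies in small cylinders of the germ
stabilizer of `000…`, and for `F` and `T` acting on the circle they are the groups `compactPL a b`
of dyadic piecewise linear maps with compact support in `(a, b)`. Both kinds of groups are simple
by Higman's criterion `isSimpleGroup_of_perfect`, as soon as they are perfect. In the first case
this holds because `V` is generated by swaps of cylinders, and a swap of two cylinders that avoid
`000…` is a commutator. In the second case, the generator `A` of `F` satisfies
`A² = (A ⊕ 1) A (1 ⊕ A)`, where `f ⊕ g` acts as `f` and `g` on the two halves of the interval. As
all copies of `A` in `(a, b)` are conjugate, the class `α` of `A` in the abelianization satisfies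
`2 α = 3 α`, hence vanishes. This suffices because `A` and the operation `⊕` generate `F`.

Expanding the support of `D` and passing to a limit in the compact space `X`, one obtains a point
fixed by a whole germ stabilizer `G⁰_z`, with `z = 000…` for `V` and `z = 0` on the circle. For `F`,
the subgroup `F⁰_0` is normal, so that by minimality it acts trivially on `X`, against
faithfulness. For `T` and `V`, the relation `G⁰_z ≤ G_x` between points of `X` and `Y` is closed and
invariant, so that every `x` is related to some `z`. This `z` is unique because `G⁰_z` and `G⁰_z'`
generate `G` when `z ≠ z'`. Hence the relation is the graph of a continuous equivariant map, and it
is the only factor map because `z` is the only fixed point of `G⁰_z` in `Y`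
(`existsUnique_factorMap`).
-/

namespace Thompson

/-! ### Coverings of a simple group -/

theorem eq_top_of_finiteIndex {L : Type*} [Group L] [IsSimpleGroup L] [Infinite L]
    (K : Subgroup L) [K.FiniteIndex] : K = ⊤ := by
  rcases IsSimpleGroup.eq_bot_or_eq_top_of_normal K.normalCore inferInstance with h | h
  · have : (⊥ : Subgroup L).FiniteIndex := h ▸ inferInstance
    have := (Subgroup.finite_iff_finite_and_finiteIndex (H := (⊥ : Subgroup L))).2
      ⟨inferInstance, this⟩
    exact absurd this (not_finite_iff_infinite.2 inferInstance)
  · exact top_le_iff.1 (h ▸ K.normalCore_le)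

open scoped Pointwise in
/-- Neumann's lemma for sets that are not assumed to be cosets: if finitely many sets cover a
group without proper subgroups of finite index, the quotients of one of them generate it. -/
theorem exists_closure_inv_mul_eq_top {L : Type*} [Group L] [IsSimpleGroup L] [Infinite L]
    {ι : Type*} [Finite ι] (S : ι → Set L) (h : ∀ l, ∃ i, l ∈ S i) :
    ∃ i, Subgroup.closure {g | ∃ l ∈ S i, ∃ m ∈ S i, g = l⁻¹ * m} = ⊤ := by
  classical
  have := Fintype.ofFinite ι
  set K : ι → Subgroup L := fun i =>
    Subgroup.closure {g | ∃ l ∈ S i, ∃ m ∈ S i, g = l⁻¹ * m} with hK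
  have hc : ∀ i, ∃ c : L, S i ⊆ c • (K i : Set L) := by
    intro i
    rcases (S i).eq_empty_or_nonempty with h0 | ⟨c, hc⟩
    · exact ⟨1, by simp [h0]⟩
    · refine ⟨c, fun m hm => ?_⟩
      rw [mem_leftCoset_iff]
      exact Subgroup.subset_closure ⟨c, hc, m, hm, rfl⟩
  choose c hc using hc
  obtain ⟨i, -, hi⟩ := Subgroup.exists_finiteIndex_of_leftCoset_cover
    (s := Finset.univ) (H := K) (g := c) (by
      refine Set.eq_univ_of_forall fun l => ?_
      obtain ⟨i, hi⟩ := h l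
      exact Set.mem_iUnion₂.2 ⟨i, Finset.mem_univ i, hc i hi⟩)
  exact ⟨i, eq_top_of_finiteIndex _⟩

theorem closure_eq_top_of_conj {L : Type*} [Group L] {A : Set L} {K : Subgroup L} (t : L)
    (hA : Subgroup.closure A = ⊤) (h : ∀ a ∈ A, t⁻¹ * a * t ∈ K) : K = ⊤ := by
  have h1 : Subgroup.closure A ≤ K.comap (MulAut.conj t⁻¹).toMonoidHom :=
    (Subgroup.closure_le _).2 fun a ha => by simpa using h a ha
  rw [hA] at h1
  rw [eq_top_iff]
  intro k _
  have := h1 (Subgroup.mem_top (t * k * t⁻¹))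
  simpa [mul_assoc] using this

theorem closure_mul_inv_eq_top {L : Type*} [Group L] {S : Set L}
    (h : Subgroup.closure {g | ∃ l ∈ S, ∃ m ∈ S, g = l⁻¹ * m} = ⊤) :
    Subgroup.closure {g | ∃ l ∈ S, ∃ m ∈ S, g = l * m⁻¹} = ⊤ := by
  rcases S.eq_empty_or_nonempty with h0 | ⟨c, hc⟩
  · simpa [h0] using h
  · refine closure_eq_top_of_conj c⁻¹ h ?_
    rintro _ ⟨l, hl, m, hm, rfl⟩
    have h1 : c * l⁻¹ ∈ Subgroup.closure {g | ∃ l ∈ S, ∃ m ∈ S, g = l * m⁻¹} :=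
      Subgroup.subset_closure ⟨c, hc, l, hl, rfl⟩
    have h2 : m * c⁻¹ ∈ Subgroup.closure {g | ∃ l ∈ S, ∃ m ∈ S, g = l * m⁻¹} :=
      Subgroup.subset_closure ⟨m, hm, c, hc, rfl⟩
    have := Subgroup.mul_mem _ h1 h2
    simpa [mul_assoc] using this

/-- If finitely many sets cover an infinite non-abelian simple group, then one of them, `S p`,
is large in two ways: its quotients generate the group, and for some `g` two elements `l, l'` of
`S p ∩ (S p) g⁻¹` conjugate `g` differently. -/
theorem exists_large_of_cover {L : Type*} [Group L] [IsSimpleGroup L] [Infinite L]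
    (hab : ∃ a b : L, a * b ≠ b * a) {J : Type*} [Finite J] (S : J → Set L)
    (h : ∀ l, ∃ p, l ∈ S p) :
    ∃ p, Subgroup.closure {g | ∃ l ∈ S p, ∃ m ∈ S p, g = l⁻¹ * m} = ⊤ ∧
      ∃ l l' g, l ∈ S p ∧ l * g ∈ S p ∧ l' ∈ S p ∧ l' * g ∈ S p ∧
        l * g * l⁻¹ ≠ l' * g * l'⁻¹ := by
  classical
  have := Fintype.ofFinite J
  by_contra! hcon
  have hcenter : ∀ g : L, (∀ a, a * g = g * a) → g = 1 := by
    intro g hg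
    rcases IsSimpleGroup.eq_bot_or_eq_top_of_normal (Subgroup.center L) inferInstance with h | h
    · exact Subgroup.mem_bot.1 (h ▸ Subgroup.mem_center_iff.2 hg)
    · obtain ⟨a, b, hab⟩ := hab
      exact absurd (Subgroup.mem_center_iff.1 (h ▸ Subgroup.mem_top b) a) hab
  let n := Fintype.card J
  obtain ⟨t⟩ : Nonempty (Fin (n + 1) ↪ L) :=
    ⟨(Fin.valEmbedding).trans (Infinite.natEmbedding L)⟩
  let good : J → Prop := fun p =>
    Subgroup.closure {g | ∃ l ∈ S p, ∃ m ∈ S p, g = l⁻¹ * m} = ⊤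
  -- For a set `S p` whose quotients do not generate, its translates are used; for the others,
  -- the intersections of two different translates.
  let S' : J × Fin (n + 1) × Fin (n + 1) → Set L := fun q =>
    {m | m * t q.2.1 ∈ S q.1 ∧ (good q.1 → q.2.1 ≠ q.2.2 ∧ m * t q.2.2 ∈ S q.1)}
  obtain ⟨⟨p, a, b⟩, hq⟩ := exists_closure_inv_mul_eq_top S' (by
    intro m
    choose f hf using fun a => h (m * t a)
    by_cases hg : ∃ a, ¬ good (f a)
    · obtain ⟨a, ha⟩ := hg
      exact ⟨(f a, a, a), hf a, fun h => absurd h ha⟩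
    · obtain ⟨a, b, hne, hfab⟩ := Fintype.exists_ne_map_eq_of_card_lt f (by simp [n])
      exact ⟨(f a, a, b), hf a, fun _ => ⟨hne, hfab ▸ hf b⟩⟩)
  by_cases hp : good p
  · have hne : a ≠ b := by
      by_contra hne
      have : S' (p, a, b) = ∅ := by
        ext m
        simp only [S', Set.mem_ofPred_eq, Set.mem_empty_iff_false, iff_false]
        rintro ⟨-, h2⟩
        exact (h2 hp).1 hne
      rw [this] at hq
      simp at hq
    have hC := closure_eq_top_of_conj (K := Subgroup.centralizer {(t a)⁻¹ * t b}) (t a) hq (by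
      rintro _ ⟨m', hm', m, hm, rfl⟩
      rw [Subgroup.mem_centralizer_singleton_iff]
      have := hcon p hp (m * t a) (m' * t a) ((t a)⁻¹ * t b) hm.1
        (by simpa [mul_assoc] using (hm.2 hp).2) hm'.1 (by simpa [mul_assoc] using (hm'.2 hp).2)
      have h2 := congrArg (fun z => (m' * t a)⁻¹ * z * (m * t a)) this
      simp only [mul_assoc, mul_inv_rev, inv_mul_cancel_left, inv_mul_cancel, mul_one] at h2
      simp only [mul_assoc]
      exact h2)
    have := hcenter ((t a)⁻¹ * t b) fun c => by
      have := (Subgroup.mem_centralizer_singleton_iff).1 (hC ▸ Subgroup.mem_top c)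
      exact this
    exact hne (t.injective (inv_mul_eq_one.1 this))
  · exact hp (closure_eq_top_of_conj (t a) hq (by
      rintro _ ⟨m', hm', m, hm, rfl⟩
      exact Subgroup.subset_closure ⟨m' * t a, hm'.1, m * t a, hm.1, by simp [mul_assoc]⟩))

/-! ### Confined stabilizers -/

/-- In a minimal action on a compact space that is not topologically free, finitely many
non-trivial elements suffice to meet all point stabilizers. -/
theorem exists_finset_confining {G X : Type*} [Group G] [TopologicalSpace X] [CompactSpace X]
    [MulAction G X] [ContinuousConstSMul G X] [MulAction.IsMinimal G X]
    (h : ¬ IsTopologicallyFree G X) :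
    Nonempty X ∧ ∃ P : Finset G, 1 ∉ P ∧ ∀ x : X, ∃ p ∈ P, p • x = x := by
  classical
  simp only [IsTopologicallyFree, not_forall] at h
  obtain ⟨g, hg, hne⟩ := h
  have hne := Set.nonempty_iff_ne_empty.2 hne
  obtain ⟨I, hI⟩ := isCompact_univ.exists_finite_cover_smul G
    (isOpen_interior (s := {x : X | g • x = x})) hne
  refine ⟨⟨hne.some⟩, I.image fun k => k * g * k⁻¹, ?_, fun x => ?_⟩
  · simp only [Finset.mem_image, not_exists, not_and]
    intro k _ hk
    exact hg (by simpa [mul_assoc] using congrArg (fun z => k⁻¹ * z * k) hk)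
  · obtain ⟨k, hk, y, hy, rfl⟩ := Set.mem_iUnion₂.1 (hI (Set.mem_univ x))
    refine ⟨_, Finset.mem_image_of_mem _ hk, ?_⟩
    have hy : y ∈ {x : X | g • x = x} := interior_subset hy
    rw [Set.mem_ofPred_eq] at hy
    simp only [mul_smul, inv_smul_smul, hy]

/-- Every non-empty open set contains a non-empty open set that each of finitely many given
elements either fixes pointwise or displaces. -/
theorem exists_open_fixed_or_displaced {G Y : Type*} [Group G] [TopologicalSpace Y] [T2Space Y]
    [MulAction G Y] [ContinuousConstSMul G Y] (P : Finset G) (O : Set Y) (hO : IsOpen O)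
    (hne : O.Nonempty) :
    ∃ O' ⊆ O, IsOpen O' ∧ O'.Nonempty ∧
      ∀ p ∈ P, (∀ y ∈ O', p • y = y) ∨ ∀ y ∈ O', p • y ∉ O' := by
  classical
  induction P using Finset.induction_on with
  | empty => exact ⟨O, subset_rfl, hO, hne, by simp⟩
  | insert p P _ ih =>
    obtain ⟨O', hsub, hO', hne', h⟩ := ih
    by_cases hp : ∀ y ∈ O', p • y = y
    · refine ⟨O', hsub, hO', hne', fun q hq => ?_⟩
      rcases Finset.mem_insert.1 hq with rfl | hq
      · exact Or.inl hp
      · exact h q hq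
    · push Not at hp
      obtain ⟨y, hy, hpy⟩ := hp
      obtain ⟨A, B, hA, hB, hyA, hyB, hAB⟩ := t2_separation hpy
      refine ⟨O' ∩ B ∩ (p • ·) ⁻¹' A, fun z hz => hsub hz.1.1,
        (hO'.inter hB).inter (hA.preimage (continuous_const_smul p)), ⟨y, ⟨hy, hyB⟩, hyA⟩,
        fun q hq => ?_⟩
      rcases Finset.mem_insert.1 hq with rfl | hq
      · exact Or.inr fun z hz hz' => Set.disjoint_left.1 hAB hz.2 hz'.1.2
      · rcases h q hq with h | h
        · exact Or.inl fun z hz => h z hz.1.1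
        · exact Or.inr fun z hz hz' => h z hz.1.1 hz'.1.1

theorem commute_of_disjoint_support {G Y : Type*} [Group G] [MulAction G Y] [FaithfulSMul G Y]
    {a b : G} {A B : Set Y} (hAB : Disjoint A B) (ha : ∀ y ∉ A, a • y = y)
    (hb : ∀ y ∉ B, b • y = y) : a * b = b * a := by
  have key : ∀ (c d : G) (C E : Set Y), Disjoint C E → (∀ y ∉ C, c • y = y) →
      (∀ y ∉ E, d • y = y) → ∀ y ∈ C, c • d • y = d • c • y := by
    intro c d C E hCE hc hd y hy
    rw [hd y (Set.disjoint_left.1 hCE hy)]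
    by_cases h : c • y ∈ C
    · rw [hd _ (Set.disjoint_left.1 hCE h)]
    · have h1 := hc _ h
      have h2 : c • y = y := smul_left_cancel c h1
      rw [h2, hd y (Set.disjoint_left.1 hCE hy)]
  refine FaithfulSMul.eq_of_smul_eq_smul (α := Y) fun y => ?_
  rw [mul_smul, mul_smul]
  by_cases hy : y ∈ A
  · exact key a b A B hAB ha hb y hy
  · by_cases hy' : y ∈ B
    · exact (key b a B A hAB.symm hb ha y hy').symm
    · rw [hb y hy', ha y hy, hb y hy']

/-- The algebraic core of the confinement theorem: `p` displaces the support of the simple group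
`D`, and the elements `l⁻¹ p l` of `H` with `l ∈ D` are abundant. Then `H` contains a conjugate
of `D`. -/
theorem conj_le_of_large {G : Type*} [Group G] (H D : Subgroup G) [IsSimpleGroup D] (p : G)
    (hcomm : ∀ a ∈ D, ∀ b ∈ D, a * (p⁻¹ * b * p) = p⁻¹ * b * p * a) (S : Set D)
    (hS : ∀ l ∈ S, (l : G)⁻¹ * p * l ∈ H)
    (hgen : Subgroup.closure {g | ∃ l ∈ S, ∃ m ∈ S, g = l⁻¹ * m} = ⊤)
    (hl : ∃ l l' g, l ∈ S ∧ l * g ∈ S ∧ l' ∈ S ∧ l' * g ∈ S ∧ l * g * l⁻¹ ≠ l' * g * l'⁻¹) :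
    ∀ s ∈ D, p⁻¹ * s * p ∈ H := by
  -- the product of two of the given elements of `H` splits into commuting factors
  have hprod : ∀ l ∈ S, ∀ m ∈ S, (l⁻¹ * m : G) * (p⁻¹ * (l * m⁻¹ : G) * p) ∈ H := by
    intro l hl m hm
    have h1 := H.mul_mem (H.inv_mem (hS l hl)) (hS m hm)
    have h2 := hcomm (l⁻¹ : D).1 (l⁻¹ : D).2 (l * m⁻¹).1 (l * m⁻¹).2
    have h3 := hcomm m.1 m.2 (l * m⁻¹).1 (l * m⁻¹).2
    have : (l⁻¹ * m : G) * (p⁻¹ * (l * m⁻¹ : G) * p) = ((l : G)⁻¹ * p * l)⁻¹ * (m⁻¹ * p * m) := by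
      push_cast at h3 ⊢
      rw [mul_assoc, h3]
      group
    rwa [this]
  let N : Subgroup D := (H.comap (MulAut.conj p⁻¹).toMonoidHom).comap D.subtype
  have hN : ∀ s : D, s ∈ N ↔ p⁻¹ * (s : G) * p ∈ H := fun s => by
    simp [N, Subgroup.mem_subgroupOf]
  have hnorm : N.Normal := by
    rw [← Subgroup.normalizer_eq_top_iff, eq_top_iff, ← closure_mul_inv_eq_top hgen,
      Subgroup.closure_le]
    have hsub : ∀ l ∈ S, ∀ m ∈ S, ∀ s ∈ N, (l * m⁻¹) * s * (l * m⁻¹)⁻¹ ∈ N := by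
      intro l hl m hm s hs
      rw [hN] at hs ⊢
      have h1 := H.mul_mem (H.mul_mem (hprod l hl m hm) hs) (H.inv_mem (hprod l hl m hm))
      have h2 := hcomm (l⁻¹ * m).1 (l⁻¹ * m).2 ((l * m⁻¹) * s * (l * m⁻¹)⁻¹).1
        ((l * m⁻¹) * s * (l * m⁻¹)⁻¹).2
      have h3 : p⁻¹ * (((l * m⁻¹) * s * (l * m⁻¹)⁻¹ : D) : G) * p =
          (l⁻¹ * m : G) * (p⁻¹ * (l * m⁻¹ : G) * p) * (p⁻¹ * s * p) *
            ((l⁻¹ * m : G) * (p⁻¹ * (l * m⁻¹ : G) * p))⁻¹ := by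
        have h4 : p⁻¹ * (((l * m⁻¹) * s * (l * m⁻¹)⁻¹ : D) : G) * p =
          (l⁻¹ * m : G) * (p⁻¹ * (((l * m⁻¹) * s * (l * m⁻¹)⁻¹ : D) : G) * p) *
            (l⁻¹ * m : G)⁻¹ := by
          push_cast at h2 ⊢
          rw [h2]
          group
        rw [h4]
        push_cast
        group
      rwa [h3]
    rintro _ ⟨l, hl, m, hm, rfl⟩
    rw [SetLike.mem_coe, Subgroup.mem_normalizer_iff]
    intro s
    refine ⟨hsub l hl m hm s, fun hs => ?_⟩
    have := hsub m hm l hl _ hs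
    simpa [mul_assoc] using this
  have hne : N ≠ ⊥ := by
    obtain ⟨l, l', g, h1, h2, h3, h4, hne⟩ := hl
    intro hbot
    have ha := hprod l h1 _ h2
    have hb := hprod l' h3 _ h4
    have h5 : l' * g * l'⁻¹ * (l * g * l⁻¹)⁻¹ ∈ N := by
      rw [hN]
      have := H.mul_mem (H.inv_mem hb) ha
      have h6 : p⁻¹ * ((l' * g * l'⁻¹ * (l * g * l⁻¹)⁻¹ : D) : G) * p =
          ((l'⁻¹ * (l' * g : D) : G) * (p⁻¹ * (l' * ((l' * g : D) : G)⁻¹ : G) * p))⁻¹ *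
            ((l⁻¹ * (l * g : D) : G) * (p⁻¹ * (l * ((l * g : D) : G)⁻¹ : G) * p)) := by
        push_cast
        group
      rwa [h6]
    rw [hbot, Subgroup.mem_bot, mul_inv_eq_one] at h5
    exact hne h5.symm
  have htop := (IsSimpleGroup.eq_bot_or_eq_top_of_normal N hnorm).resolve_left hne
  intro s hs
  exact (hN ⟨s, hs⟩).1 (htop ▸ Subgroup.mem_top _)

/-- The confinement theorem. The group `G` acts faithfully on a Hausdorff space `Y`, and
arbitrarily small open sets of `Y` contain the supports `U i` of infinite non-abelian simple
subgroups `D i`. If finitely many non-trivial elements of `G` meet all stabilizers of an action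
of `G` on `X`, then some `D i` fixes a point of `X`. -/
theorem exists_le_stabilizer_of_confined {G X Y ι : Type*} [Group G] [MulAction G X] [Nonempty X]
    [TopologicalSpace Y] [T2Space Y] [MulAction G Y] [FaithfulSMul G Y] [ContinuousConstSMul G Y]
    (U : ι → Set Y) (D : ι → Subgroup G)
    (hbase : ∀ O : Set Y, IsOpen O → O.Nonempty → ∃ i, U i ⊆ O)
    (hsupp : ∀ i, ∀ g ∈ D i, ∀ y ∉ U i, g • y = y)
    (hsimple : ∀ i, IsSimpleGroup (D i)) (hinf : ∀ i, Infinite (D i))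
    (hab : ∀ i, ∃ a b : D i, a * b ≠ b * a)
    (hP : ∃ P : Finset G, 1 ∉ P ∧ ∀ x : X, ∃ p ∈ P, p • x = x) :
    ∃ (x : X) (i : ι), D i ≤ MulAction.stabilizer G x := by
  classical
  -- a confining set of minimal cardinality
  obtain ⟨n, hn⟩ : ∃ n, n = sInf {n | ∃ P : Finset G, P.card = n ∧ 1 ∉ P ∧
      ∀ x : X, ∃ p ∈ P, p • x = x} := ⟨_, rfl⟩
  have hmem : n ∈ {n | ∃ P : Finset G, P.card = n ∧ 1 ∉ P ∧ ∀ x : X, ∃ p ∈ P, p • x = x} := by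
    rw [hn]
    obtain ⟨P, hP⟩ := hP
    exact Nat.sInf_mem ⟨_, P, rfl, hP⟩
  obtain ⟨P, hcard, h1, hP⟩ := hmem
  obtain ⟨p₁, hp₁, -⟩ := hP (Classical.arbitrary X)
  obtain ⟨y, hy⟩ : ∃ y : Y, p₁ • y ≠ y := by
    by_contra! hcon
    refine h1 ?_
    have : p₁ = 1 := FaithfulSMul.eq_of_smul_eq_smul (α := Y) fun y => by rw [hcon, one_smul]
    rwa [← this]
  have hopen : IsOpen {y : Y | p₁ • y ≠ y} :=
    isOpen_ne_fun (continuous_const_smul p₁) continuous_id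
  obtain ⟨O, hOsub, hO, hOne, hdisp⟩ := exists_open_fixed_or_displaced P _ hopen ⟨y, hy⟩
  obtain ⟨i, hi⟩ := hbase O hO hOne
  have := hsimple i
  have := hinf i
  -- minimality gives a point whose stabilizer only meets `P` in elements that displace `U i`
  obtain ⟨x, hx⟩ : ∃ x : X, ∀ p ∈ P, (∀ y ∈ O, p • y = y) → p • x ≠ x := by
    by_contra! hcon
    have hlt : (P.filter fun p => ∀ y ∈ O, p • y = y).card < n := by
      rw [← hcard]
      refine Finset.card_lt_card (Finset.filter_ssubset.2 ⟨p₁, hp₁, fun h => ?_⟩)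
      obtain ⟨y, hy⟩ := hOne
      exact hOsub hy (h y hy)
    have := Nat.sInf_le (s := {n | ∃ P : Finset G, P.card = n ∧ 1 ∉ P ∧
      ∀ x : X, ∃ p ∈ P, p • x = x}) ⟨P.filter fun p => ∀ y ∈ O, p • y = y, rfl,
        fun h => h1 (Finset.mem_filter.1 h).1, fun x => by
          obtain ⟨p, hp, hpO, hpx⟩ := hcon x
          exact ⟨p, Finset.mem_filter.2 ⟨hp, hpO⟩, hpx⟩⟩
    omega
  let J := {p : G // p ∈ P ∧ ∀ y ∈ O, p • y ∉ O}
  have : Finite J := Finite.of_injective (fun p : J => (⟨p.1, p.2.1⟩ : P))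
    fun a b h => Subtype.ext (congrArg (fun q : P => q.1) h)
  let S : J → Set (D i) := fun p => {l | (l : G)⁻¹ * p.1 * l ∈ MulAction.stabilizer G x}
  obtain ⟨p, hgen, hl⟩ := exists_large_of_cover (hab i) S (by
    intro l
    obtain ⟨p, hp, hpx⟩ := hP ((l : G) • x)
    have hpS : (l : G)⁻¹ * p * l ∈ MulAction.stabilizer G x := by
      rw [MulAction.mem_stabilizer_iff, mul_smul, mul_smul, hpx, inv_smul_smul]
    rcases hdisp p hp with hfix | hd
    · -- an element fixing `U i` pointwise commutes with `D i`
      refine absurd ?_ (hx p hp hfix)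
      have hc : (l : G) * p = p * l := commute_of_disjoint_support (Y := Y)
        (A := U i) (B := (U i)ᶜ) disjoint_compl_right (hsupp i l l.2) (fun y hy => by
          rw [Set.notMem_compl_iff] at hy
          exact hfix y (hi hy))
      rw [mul_assoc, ← hc, inv_mul_cancel_left] at hpS
      exact hpS
    · exact ⟨⟨p, hp, hd⟩, hpS⟩)
  refine ⟨p.1 • x, i, fun s hs => ?_⟩
  have hU : Disjoint (U i) {y | p.1 • y ∈ U i} :=
    Set.disjoint_left.2 fun y hy hy' => p.2.2 y (hi hy) (hi hy')
  have := conj_le_of_large (MulAction.stabilizer G x) (D i) p.1 (fun a ha b hb =>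
    commute_of_disjoint_support hU (hsupp i a ha) (fun y hy => by
      rw [mul_smul, mul_smul, hsupp i b hb _ hy, inv_smul_smul])) (S p) (fun l hl => hl)
    hgen hl s hs
  rw [MulAction.mem_stabilizer_iff, mul_smul, mul_smul, inv_smul_eq_iff] at this
  exact this

/-! ### A simplicity criterion -/

/-- Higman's criterion: a non-trivial perfect group is simple as soon as, for each `n ≠ 1`, any
two elements `a, b` have simultaneous conjugates such that the first one commutes with the
conjugate by `n` of the second one. -/
theorem isSimpleGroup_of_perfect {D : Type*} [Group D] [Nontrivial D]
    (hperf : commutator D = ⊤)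
    (h : ∀ n : D, n ≠ 1 → ∀ a b : D, ∃ k : D, Commute (k * a * k⁻¹) (n * (k * b * k⁻¹) * n⁻¹)) :
    IsSimpleGroup D := by
  refine ⟨fun N hN => or_iff_not_imp_left.2 fun hbot => ?_⟩
  obtain ⟨⟨n, hn⟩, hn1⟩ := Subgroup.ne_bot_iff_exists_ne_one.1 hbot
  have hn1 : n ≠ 1 := fun h => hn1 (Subtype.ext h)
  rw [eq_top_iff, ← hperf, commutator_def, Subgroup.commutator_le]
  intro a _ b _
  obtain ⟨k, h1⟩ := h n hn1 a b
  set a' := k * a * k⁻¹ with ha'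
  set b' := k * b * k⁻¹ with hb'
  set c := n * b' * n⁻¹ with hc
  have hmem : b' * c⁻¹ ∈ N := by
    have : b' * c⁻¹ = (b' * n * b'⁻¹) * n⁻¹ := by rw [hc]; group
    rw [this]
    exact N.mul_mem (hN.conj_mem n hn b') (N.inv_mem hn)
  have hmem2 : a' * (b' * c⁻¹) * a'⁻¹ * (b' * c⁻¹)⁻¹ ∈ N :=
    N.mul_mem (hN.conj_mem _ hmem a') (N.inv_mem hmem)
  have heq : a' * (b' * c⁻¹) * a'⁻¹ * (b' * c⁻¹)⁻¹ = k * (a * b * a⁻¹ * b⁻¹) * k⁻¹ := by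
    have h3 : c⁻¹ * a'⁻¹ = a'⁻¹ * c⁻¹ := (h1.inv_inv).eq.symm
    calc a' * (b' * c⁻¹) * a'⁻¹ * (b' * c⁻¹)⁻¹
        = a' * b' * (c⁻¹ * a'⁻¹) * (c * b'⁻¹) := by group
      _ = a' * b' * a'⁻¹ * b'⁻¹ := by rw [h3]; group
      _ = k * (a * b * a⁻¹ * b⁻¹) * k⁻¹ := by rw [ha', hb']; group
  rw [heq] at hmem2
  have := hN.conj_mem _ hmem2 k⁻¹
  simpa [mul_assoc, commutatorElement_def] using this

/-! ### The factor map -/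

section Factor

variable {G X Y : Type*} [Group G] [TopologicalSpace Y] [MulAction G X] [MulAction G Y]

theorem conj_mem_nbhdStabilizer [ContinuousConstSMul G Y] {y : Y} {g : G}
    (hg : g ∈ nbhdStabilizer G y) (k : G) : k * g * k⁻¹ ∈ nbhdStabilizer G (k • y) := by
  have hc : Filter.Tendsto (fun y' : Y => k⁻¹ • y') (𝓝 (k • y)) (𝓝 y) := by
    simpa using (continuous_const_smul k⁻¹).tendsto (k • y)
  have hg : ∀ᶠ y' in 𝓝 y, g • y' = y' := hg
  show ∀ᶠ y' in 𝓝 (k • y), (k * g * k⁻¹) • y' = y'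
  filter_upwards [hc.eventually hg] with y' h
  rw [mul_smul, mul_smul, h, smul_inv_smul]

/-- The relation `G⁰_z ≤ G_x` between points of `X` and `Y` is invariant. -/
theorem nbhdStabilizer_le_smul [ContinuousConstSMul G Y] {x : X} {z : Y} (g : G)
    (h : nbhdStabilizer G z ≤ MulAction.stabilizer G x) :
    nbhdStabilizer G (g • z) ≤ MulAction.stabilizer G (g • x) := by
  intro k hk
  have h1 := conj_mem_nbhdStabilizer hk g⁻¹
  rw [inv_smul_smul] at h1
  have h2 := MulAction.mem_stabilizer_iff.1 (h h1)
  rw [MulAction.mem_stabilizer_iff]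
  rw [inv_inv, mul_smul, mul_smul, inv_smul_eq_iff] at h2
  exact h2

variable [TopologicalSpace X]

/-- The relation `G⁰_z ≤ G_x` between points of `X` and `Y` is closed. -/
theorem isClosed_nbhdStabilizer_le [T2Space X] [ContinuousConstSMul G X] :
    IsClosed {q : X × Y | nbhdStabilizer G q.2 ≤ MulAction.stabilizer G q.1} := by
  rw [← isOpen_compl_iff, isOpen_iff_mem_nhds]
  rintro ⟨x, z⟩ hxz
  simp only [Set.mem_compl_iff, Set.mem_ofPred_eq, SetLike.not_le_iff_exists] at hxz
  obtain ⟨g, hg, hgx⟩ := hxz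
  have h1 : ∀ᶠ z' in 𝓝 z, g ∈ nbhdStabilizer G z' := by
    have hg : ∀ᶠ y' in 𝓝 z, g • y' = y' := hg
    exact hg.eventually_nhds
  have h2 : ∀ᶠ x' in 𝓝 x, g • x' ≠ x' :=
    (isOpen_ne_fun (continuous_const_smul g) continuous_id).mem_nhds hgx
  filter_upwards [(h2.prod_inl_nhds z).and (h1.prod_inr_nhds x)] with q hq hle
  exact hq.1 (hle hq.2)

open scoped Pointwise in
/-- If some germ stabilizer `G⁰_z` fixes a point of the minimal compact `G`-space `X`, and the
action on `Y` is rich enough, then `x ↦ z` whenever `G⁰_z ≤ G_x` is the unique factor map. -/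
theorem existsUnique_factorMap [CompactSpace X] [T2Space X] [ContinuousConstSMul G X]
    [MulAction.IsMinimal G X] [CompactSpace Y] [T2Space Y] [ContinuousConstSMul G Y]
    [MulAction.IsMinimal G Y] (hnontriv : IsNontrivialAction G X)
    (hgen : ∀ z z' : Y, z ≠ z' → nbhdStabilizer G z ⊔ nbhdStabilizer G z' = ⊤)
    (hmove : ∀ z y : Y, y ≠ z → ∃ g ∈ nbhdStabilizer G z, g • y ≠ y)
    (hex : ∃ (x : X) (z : Y), nbhdStabilizer G z ≤ MulAction.stabilizer G x) :
    ∃ φ : X → Y, IsFactorMap G φ ∧ (∀ ψ : X → Y, IsFactorMap G ψ → ψ = φ) ∧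
      ∀ (x : X) (z : Y), nbhdStabilizer G z ≤ MulAction.stabilizer G x ↔ z = φ x := by
  set E : Set (X × Y) := {q | nbhdStabilizer G q.2 ≤ MulAction.stabilizer G q.1} with hE
  have hEc : IsClosed E := isClosed_nbhdStabilizer_le
  have hall : ∀ x : X, ∃ z : Y, (x, z) ∈ E := by
    have hcl : IsClosed (Prod.fst '' E) := (hEc.isCompact.image continuous_fst).isClosed
    have hinv : ∀ g : G, g • (Prod.fst '' E) ⊆ Prod.fst '' E := by
      rintro g _ ⟨_, ⟨⟨x, z⟩, h, rfl⟩, rfl⟩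
      exact ⟨(g • x, g • z), nbhdStabilizer_le_smul g h, rfl⟩
    rcases eq_empty_or_univ_of_smul_invariant_closed G hcl hinv with h | h
    · obtain ⟨x, z, hxz⟩ := hex
      exact absurd (h ▸ ⟨(x, z), hxz, rfl⟩ : x ∈ (∅ : Set X)) (Set.notMem_empty x)
    · intro x
      obtain ⟨⟨x, z⟩, hxz, rfl⟩ := (h ▸ Set.mem_univ x : x ∈ Prod.fst '' E)
      exact ⟨z, hxz⟩
  have huniq : ∀ (x : X) (z z' : Y), (x, z) ∈ E → (x, z') ∈ E → z = z' := by
    intro x z z' h h'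
    by_contra hne
    have htop : MulAction.stabilizer G x = ⊤ := by
      rw [eq_top_iff, ← hgen z z' hne]
      exact sup_le h h'
    -- a global fixed point is dense, so that `X` is a point
    have horb : MulAction.orbit G x = {x} := by
      ext x'
      constructor
      · rintro ⟨g, rfl⟩
        exact MulAction.mem_stabilizer_iff.1 (htop ▸ Subgroup.mem_top g)
      · rintro rfl
        exact MulAction.mem_orbit_self _
    have hd := MulAction.dense_orbit G x
    rw [horb] at hd
    have hX : ∀ x' : X, x' = x := fun x' => by
      have := hd x'
      rwa [closure_singleton] at this
    obtain ⟨g, x', hgx⟩ := hnontriv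
    exact hgx ((hX _).trans (hX _).symm)
  choose φ hφ using hall
  have hiff : ∀ (x : X) (z : Y), (x, z) ∈ E ↔ z = φ x := fun x z =>
    ⟨fun h => huniq x z _ h (hφ x), fun h => h ▸ hφ x⟩
  have hcont : Continuous φ := by
    rw [continuous_iff_isClosed]
    intro C hC
    have : φ ⁻¹' C = Prod.fst '' (E ∩ Prod.snd ⁻¹' C) := by
      ext x
      constructor
      · exact fun hx => ⟨(x, φ x), ⟨hφ x, hx⟩, rfl⟩
      · rintro ⟨⟨x, z⟩, ⟨h, hz⟩, rfl⟩
        rwa [Set.mem_preimage, ← (hiff x z).1 h]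
    rw [this]
    exact ((hEc.inter (hC.preimage continuous_snd)).isCompact.image continuous_fst).isClosed
  have hequi : ∀ (g : G) (x : X), φ (g • x) = g • φ x := fun g x =>
    ((hiff _ _).1 (nbhdStabilizer_le_smul g (hφ x))).symm
  have hsurj : Function.Surjective φ := by
    have hcl : IsClosed (Set.range φ) := (isCompact_range hcont).isClosed
    have hinv : ∀ g : G, g • Set.range φ ⊆ Set.range φ := by
      rintro g _ ⟨_, ⟨x, rfl⟩, rfl⟩
      exact ⟨g • x, hequi g x⟩
    rcases eq_empty_or_univ_of_smul_invariant_closed G hcl hinv with h | h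
    · obtain ⟨x, -⟩ := hex
      exact absurd (h ▸ ⟨x, rfl⟩ : φ x ∈ (∅ : Set Y)) (Set.notMem_empty _)
    · exact Set.range_eq_univ.1 h
  refine ⟨φ, ⟨hcont, hsurj, hequi⟩, fun ψ hψ => funext fun x => ?_, hiff⟩
  -- `G⁰_{φ x}` fixes `x`, hence `ψ x`; but its only fixed point is `φ x`
  by_contra hne
  obtain ⟨g, hg, hgy⟩ := hmove _ _ hne
  refine hgy ?_
  rw [← hψ.equivariant, MulAction.mem_stabilizer_iff.1 (hφ x hg)]

end Factor

/-! ### Cylinders and elements of `V` -/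

instance continuousConstSMul_homeo {Y : Type*} [TopologicalSpace Y] (H : Subgroup (Y ≃ₜ Y)) :
    ContinuousConstSMul H Y :=
  ⟨fun g => g.1.continuous⟩

instance faithfulSMul_homeo {Y : Type*} [TopologicalSpace Y] (H : Subgroup (Y ≃ₜ Y)) :
    FaithfulSMul H Y :=
  ⟨fun h => Subtype.ext (Homeomorph.ext h)⟩

theorem prepend_injective (w : List Bool) : Function.Injective (prepend w) := by
  induction w with
  | nil => exact fun _ _ h => h
  | cons b w ih => exact fun x y h => ih (prepend_cons_inj h).2

theorem continuous_prepend (w : List Bool) : Continuous (prepend w) := by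
  induction w with
  | nil => exact continuous_id
  | cons b w ih =>
    refine continuous_pi fun n => ?_
    cases n with
    | zero => exact continuous_const
    | succ n => exact (continuous_apply n).comp ih

theorem prepend_mem_cylinder (w : List Bool) (y : Cantor) : prepend w y ∈ cylinder w := ⟨y, rfl⟩

theorem cylinder_append_subset (u r : List Bool) : cylinder (u ++ r) ⊆ cylinder u := by
  rintro _ ⟨y, rfl⟩
  exact ⟨prepend r y, (prepend_append u r y).symm⟩

theorem eq_append_or_disjoint (u w : List Bool) (h : u.length ≤ w.length) :
    (∃ r, w = u ++ r) ∨ Disjoint (cylinder u) (cylinder w) := by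
  by_cases hd : Disjoint (cylinder u) (cylinder w)
  · exact Or.inr hd
  · obtain ⟨_, ⟨x, rfl⟩, y, hy⟩ := Set.not_disjoint_iff.1 hd
    exact Or.inl (exists_prefix hy.symm h)

theorem eq_or_disjoint_cylinder (u w : List Bool) (h : u.length = w.length) :
    w = u ∨ Disjoint (cylinder u) (cylinder w) := by
  rcases eq_append_or_disjoint u w h.le with ⟨r, rfl⟩ | hd
  · have : r = [] := List.length_eq_zero_iff.1 (by simpa using h)
    exact Or.inl (by simp [this])
  · exact Or.inr hd

theorem isOpen_cylinder (w : List Bool) : IsOpen (cylinder w) := by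
  induction w with
  | nil =>
    have : cylinder [] = Set.univ := Set.eq_univ_of_forall fun x => ⟨x, rfl⟩
    rw [this]
    exact isOpen_univ
  | cons b w ih =>
    have : cylinder (b :: w) = {x : Cantor | x 0 = b} ∩ (fun x n => x (n + 1)) ⁻¹' cylinder w := by
      ext x
      constructor
      · rintro ⟨y, rfl⟩
        exact ⟨rfl, y, rfl⟩
      · rintro ⟨h0, y, hy⟩
        refine ⟨y, funext fun n => ?_⟩
        cases n with
        | zero => exact h0.symm
        | succ n => exact congrFun hy n
    rw [this]
    refine IsOpen.inter ?_ (ih.preimage (by fun_prop))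
    exact isOpen_discrete {b} |>.preimage (continuous_apply (A := fun _ : ℕ => Bool) 0)

theorem isClosed_cylinder (w : List Bool) : IsClosed (cylinder w) :=
  (isCompact_range (continuous_prepend w)).isClosed

theorem exists_cylinder_subset {x : Cantor} {O : Set Cantor} (hO : O ∈ 𝓝 x) :
    ∃ N, ∀ (w : List Bool) (y : Cantor), N ≤ w.length → prepend w y = x → cylinder w ⊆ O := by
  obtain ⟨O', hsub, hO', hx⟩ := mem_nhds_iff.1 hO
  obtain ⟨_, ⟨z, n, rfl⟩, hxz, hz⟩ :=
    (PiNat.isTopologicalBasis_cylinders (fun _ => Bool)).exists_subset_of_mem_open hx hO'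
  have hagree : ∀ (w : List Bool) (y y' : Cantor) (i : ℕ), i < w.length →
      prepend w y i = prepend w y' i := by
    intro w y y'
    induction w with
    | nil => exact fun i hi => absurd hi (Nat.not_lt_zero i)
    | cons b w ih =>
      intro i hi
      cases i with
      | zero => rfl
      | succ i => exact ih i (by simpa using hi)
  refine ⟨n, ?_⟩
  rintro w y hw rfl _ ⟨y', rfl⟩
  exact hsub (hz fun i hi => (hagree w y' y i (by omega)).trans (hxz i hi))

theorem exists_cylinder_mem_subset {x : Cantor} {O : Set Cantor} (hO : O ∈ 𝓝 x) :
    ∃ (w : List Bool) (y : Cantor), prepend w y = x ∧ cylinder w ⊆ O := by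
  obtain ⟨N, hN⟩ := exists_cylinder_subset hO
  obtain ⟨w, y, hw, hy⟩ := exists_prepend N x
  exact ⟨w, y, hy, hN w y hw.ge hy⟩

/-- The map `f` replaces the prefixes of some fixed length. -/
def ReplacesPrefixes (f : Cantor → Cantor) : Prop :=
  ∃ N : ℕ, ∀ w : List Bool, w.length = N → ∃ z, ∀ y, f (prepend w y) = prepend z y

theorem ReplacesPrefixes.continuous {f : Cantor → Cantor} (hf : ReplacesPrefixes f) :
    Continuous f := by
  obtain ⟨N, hN⟩ := hf
  rw [continuous_iff_continuousAt]
  intro x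
  obtain ⟨w, y, hw, rfl⟩ := exists_prepend N x
  obtain ⟨z, hz⟩ := hN w hw
  have htail : ∀ (w : List Bool) (y : Cantor) (n : ℕ), prepend w y (w.length + n) = y n := by
    intro w y n
    induction w with
    | nil => simp [prepend]
    | cons b w ih =>
      rw [List.length_cons, Nat.add_right_comm]
      exact ih
  have hc : Continuous fun x : Cantor => prepend z fun n => x (w.length + n) :=
    (continuous_prepend z).comp (by fun_prop)
  refine hc.continuousAt.congr ?_
  filter_upwards [(isOpen_cylinder w).mem_nhds (prepend_mem_cylinder w y)]
  rintro _ ⟨y', rfl⟩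
  rw [hz]
  exact congrArg (prepend z) (funext fun n => htail w y' n)

/-- A permutation of the Cantor set that replaces prefixes, as an element of `V`. -/
def ofPrefix (e : Equiv.Perm Cantor) (h : ReplacesPrefixes e) : thompsonV :=
  ⟨Continuous.homeoOfEquivCompactToT2 (f := e) h.continuous, (isThompsonV_iff _).2 h⟩

theorem ofPrefix_smul (e : Equiv.Perm Cantor) (h : ReplacesPrefixes e) (x : Cantor) :
    ofPrefix e h • x = e x := rfl

theorem replacesPrefixes_smul (g : thompsonV) : ReplacesPrefixes (g • · : Cantor → Cantor) :=
  (isThompsonV_iff _).1 g.2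

theorem thompsonV_ext {g h : thompsonV} (H : ∀ x : Cantor, g • x = h • x) : g = h :=
  FaithfulSMul.eq_of_smul_eq_smul H

/-- The sequence `x` without its first `u.length` entries. -/
def dropPrefix (u : List Bool) (x : Cantor) : Cantor := fun n => x (u.length + n)

theorem dropPrefix_prepend (u : List Bool) (x : Cantor) : dropPrefix u (prepend u x) = x := by
  funext n
  induction u with
  | nil => simp [prepend, dropPrefix]
  | cons b w ih =>
    rw [dropPrefix, List.length_cons, Nat.add_right_comm]
    exact ih

open scoped Classical in
/-- The map that exchanges the prefixes `u` and `v`. -/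
noncomputable def swapFun (u v : List Bool) (x : Cantor) : Cantor :=
  if x ∈ cylinder u then prepend v (dropPrefix u x)
  else if x ∈ cylinder v then prepend u (dropPrefix v x) else x

theorem swapFun_left (u v : List Bool) (y : Cantor) :
    swapFun u v (prepend u y) = prepend v y := by
  rw [swapFun, if_pos (prepend_mem_cylinder u y), dropPrefix_prepend]

theorem swapFun_right {u v : List Bool} (h : Disjoint (cylinder u) (cylinder v)) (y : Cantor) :
    swapFun u v (prepend v y) = prepend u y := by
  rw [swapFun, if_neg (Set.disjoint_right.1 h (prepend_mem_cylinder v y)),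
    if_pos (prepend_mem_cylinder v y), dropPrefix_prepend]

theorem swapFun_of_notMem {u v : List Bool} {x : Cantor} (hu : x ∉ cylinder u)
    (hv : x ∉ cylinder v) : swapFun u v x = x := by
  rw [swapFun, if_neg hu, if_neg hv]

theorem swapFun_involutive {u v : List Bool} (h : Disjoint (cylinder u) (cylinder v)) :
    Function.Involutive (swapFun u v) := by
  intro x
  by_cases hu : x ∈ cylinder u
  · obtain ⟨y, rfl⟩ := hu
    rw [swapFun_left, swapFun_right h]
  · by_cases hv : x ∈ cylinder v
    · obtain ⟨y, rfl⟩ := hv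
      rw [swapFun_right h, swapFun_left]
    · rw [swapFun_of_notMem hu hv, swapFun_of_notMem hu hv]

theorem replacesPrefixes_swapFun {u v : List Bool} (h : Disjoint (cylinder u) (cylinder v)) :
    ReplacesPrefixes (swapFun u v) := by
  refine ⟨max u.length v.length, fun w hw => ?_⟩
  rcases eq_append_or_disjoint u w (by omega) with ⟨r, rfl⟩ | hu
  · exact ⟨v ++ r, fun y => by rw [prepend_append, prepend_append, swapFun_left]⟩
  · rcases eq_append_or_disjoint v w (by omega) with ⟨r, rfl⟩ | hv
    · exact ⟨u ++ r, fun y => by rw [prepend_append, prepend_append, swapFun_right h]⟩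
    · exact ⟨w, fun y => swapFun_of_notMem (Set.disjoint_right.1 hu (prepend_mem_cylinder w y))
        (Set.disjoint_right.1 hv (prepend_mem_cylinder w y))⟩

open scoped Classical in
/-- The element of `V` that exchanges the prefixes `u` and `v`; by convention it is trivial if
the cylinders of `u` and `v` are not disjoint. -/
noncomputable def swap (u v : List Bool) : thompsonV :=
  if h : Disjoint (cylinder u) (cylinder v) then
    ofPrefix (swapFun_involutive h).toPerm (replacesPrefixes_swapFun h)
  else 1

theorem swap_smul {u v : List Bool} (h : Disjoint (cylinder u) (cylinder v)) (x : Cantor) :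
    swap u v • x = swapFun u v x := by
  rw [swap, dif_pos h]
  rfl

theorem not_disjoint_cylinder_self (u : List Bool) : ¬ Disjoint (cylinder u) (cylinder u) :=
  Set.not_disjoint_iff.2 ⟨_, prepend_mem_cylinder u fun _ => false, prepend_mem_cylinder u _⟩

theorem swap_smul_left {u v : List Bool} (h : v = u ∨ Disjoint (cylinder u) (cylinder v))
    (y : Cantor) : swap u v • prepend u y = prepend v y := by
  rcases h with rfl | h
  · rw [swap, dif_neg (not_disjoint_cylinder_self v), one_smul]
  · rw [swap_smul h, swapFun_left]

theorem swap_smul_right {u v : List Bool} (h : v = u ∨ Disjoint (cylinder u) (cylinder v))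
    (y : Cantor) : swap u v • prepend v y = prepend u y := by
  rcases h with rfl | h
  · rw [swap, dif_neg (not_disjoint_cylinder_self v), one_smul]
  · rw [swap_smul h, swapFun_right h]

theorem swap_smul_of_notMem {u v : List Bool} {x : Cantor} (hu : x ∉ cylinder u)
    (hv : x ∉ cylinder v) : swap u v • x = x := by
  by_cases h : Disjoint (cylinder u) (cylinder v)
  · rw [swap_smul h, swapFun_of_notMem hu hv]
  · rw [swap, dif_neg h, one_smul]

theorem conj_swap {u v u' v' : List Bool} {g : thompsonV}
    (h : Disjoint (cylinder u) (cylinder v)) (h' : Disjoint (cylinder u') (cylinder v'))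
    (hu : ∀ y, g • prepend u y = prepend u' y) (hv : ∀ y, g • prepend v y = prepend v' y) :
    g * swap u v * g⁻¹ = swap u' v' := by
  rw [mul_inv_eq_iff_eq_mul]
  refine thompsonV_ext fun x => ?_
  rw [mul_smul, mul_smul]
  by_cases hxu : x ∈ cylinder u
  · obtain ⟨y, rfl⟩ := hxu
    rw [swap_smul_left (Or.inr h), hu, hv, swap_smul_left (Or.inr h')]
  · by_cases hxv : x ∈ cylinder v
    · obtain ⟨y, rfl⟩ := hxv
      rw [swap_smul_right (Or.inr h), hu, hv, swap_smul_right (Or.inr h')]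
    · rw [swap_smul_of_notMem hxu hxv, swap_smul_of_notMem]
      · rintro ⟨y, hy⟩
        exact hxu ⟨y, smul_left_cancel g (by rw [hu, hy])⟩
      · rintro ⟨y, hy⟩
        exact hxv ⟨y, smul_left_cancel g (by rw [hv, hy])⟩

theorem disjoint_cylinder_append {u v : List Bool} (h : Disjoint (cylinder u) (cylinder v))
    (r s : List Bool) : Disjoint (cylinder (u ++ r)) (cylinder (v ++ s)) :=
  h.mono (cylinder_append_subset u r) (cylinder_append_subset v s)

theorem prepend_dropPrefix_nil (y : Cantor) : prepend [y 0] (dropPrefix [y 0] y) = y := by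
  funext n
  cases n with
  | zero => rfl
  | succ n => simp [prepend, dropPrefix, Nat.add_comm]

theorem disjoint_cylinder_siblings (u : List Bool) (b : Bool) :
    Disjoint (cylinder (u ++ [b])) (cylinder (u ++ [!b])) := by
  rw [Set.disjoint_left]
  rintro _ ⟨x, rfl⟩ ⟨y, hy⟩
  rw [prepend_append, prepend_append] at hy
  have := congrFun (prepend_injective u hy) 0
  simp [prepend] at this

theorem swap_eq_mul {u v : List Bool} (h : Disjoint (cylinder u) (cylinder v)) :
    swap u v = swap (u ++ [false]) (v ++ [false]) * swap (u ++ [true]) (v ++ [true]) := by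
  have hb := fun b c => disjoint_cylinder_append h [b] [c]
  have hs := fun w b => disjoint_cylinder_siblings w b
  refine thompsonV_ext fun x => ?_
  rw [mul_smul]
  by_cases hxu : x ∈ cylinder u
  · obtain ⟨y, rfl⟩ := hxu
    rw [swap_smul_left (Or.inr h), ← prepend_dropPrefix_nil y]
    generalize dropPrefix [y 0] y = y'
    rw [← prepend_append, ← prepend_append]
    cases y 0
    · rw [swap_smul_of_notMem (u := u ++ [true]), swap_smul_left (Or.inr (hb _ _))]
      · exact Set.disjoint_left.1 (hs u false) (prepend_mem_cylinder _ _)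
      · exact Set.disjoint_left.1 (hb _ _) (prepend_mem_cylinder _ _)
    · rw [swap_smul_left (Or.inr (hb _ _)), swap_smul_of_notMem]
      · exact Set.disjoint_right.1 (hb _ _) (prepend_mem_cylinder _ _)
      · exact Set.disjoint_left.1 (hs v true) (prepend_mem_cylinder _ _)
  · by_cases hxv : x ∈ cylinder v
    · obtain ⟨y, rfl⟩ := hxv
      rw [swap_smul_right (Or.inr h), ← prepend_dropPrefix_nil y]
      generalize dropPrefix [y 0] y = y'
      rw [← prepend_append, ← prepend_append]
      cases y 0
      · rw [swap_smul_of_notMem (u := u ++ [true]), swap_smul_right (Or.inr (hb _ _))]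
        · exact Set.disjoint_right.1 (hb _ _) (prepend_mem_cylinder _ _)
        · exact Set.disjoint_left.1 (hs v false) (prepend_mem_cylinder _ _)
      · rw [swap_smul_right (Or.inr (hb _ _)), swap_smul_of_notMem]
        · exact Set.disjoint_left.1 (hs u true) (prepend_mem_cylinder _ _)
        · exact Set.disjoint_left.1 (hb _ _) (prepend_mem_cylinder _ _)
    · have hu : ∀ b, x ∉ cylinder (u ++ [b]) := fun b hx => hxu (cylinder_append_subset _ _ hx)
      have hv : ∀ b, x ∉ cylinder (v ++ [b]) := fun b hx => hxv (cylinder_append_subset _ _ hx)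
      rw [swap_smul_of_notMem hxu hxv, swap_smul_of_notMem (hu _) (hv _),
        swap_smul_of_notMem (hu _) (hv _)]

/-! ### Swaps generate `V` -/

/-- The cylinders of the words in the finite set `W` form a partition of the Cantor set. -/
def IsCylinderFamily (W : Finset (List Bool)) : Prop :=
  ∀ x : Cantor, ∃! w, w ∈ W ∧ x ∈ cylinder w

theorem IsCylinderFamily.eq_or_disjoint {W : Finset (List Bool)} (hW : IsCylinderFamily W)
    {u v : List Bool} (hu : u ∈ W) (hv : v ∈ W) : v = u ∨ Disjoint (cylinder u) (cylinder v) := by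
  by_cases hd : Disjoint (cylinder u) (cylinder v)
  · exact Or.inr hd
  · obtain ⟨x, hxu, hxv⟩ := Set.not_disjoint_iff.1 hd
    exact Or.inl ((hW x).unique ⟨hv, hxv⟩ ⟨hu, hxu⟩)

/-- A cylinder partition is trivial or contains two sibling cylinders. -/
theorem IsCylinderFamily.exists_siblings {W : Finset (List Bool)} (hW : IsCylinderFamily W) :
    W = {[]} ∨ ∃ u, u ++ [false] ∈ W ∧ u ++ [true] ∈ W := by
  have hne : W.Nonempty := by
    obtain ⟨w, ⟨hw, -⟩, -⟩ := hW fun _ => false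
    exact ⟨w, hw⟩
  obtain ⟨l, hl, hmax⟩ := W.exists_max_image List.length hne
  rcases List.eq_nil_or_concat' l with rfl | ⟨u, b, rfl⟩
  · refine Or.inl (Finset.eq_singleton_iff_unique_mem.2 ⟨hl, fun w hw => ?_⟩)
    have := hmax w hw
    exact List.length_eq_zero_iff.1 (by simpa using this)
  · refine Or.inr ⟨u, ?_⟩
    have hsib : u ++ [!b] ∈ W := by
      obtain ⟨w, ⟨hw, y, hy⟩, -⟩ := hW (prepend (u ++ [!b]) fun _ => false)
      have hlen := hmax w hw
      obtain ⟨r, hr⟩ := exists_prefix hy (by simpa using hlen)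
      rcases List.eq_nil_or_concat' r with rfl | ⟨r, c, rfl⟩
      · rw [hr, List.append_nil]
        exact hw
      · -- otherwise `w` is a prefix of `u`, and its cylinder meets that of `u ++ [b]`
        rw [← List.append_assoc] at hr
        obtain ⟨h1, -⟩ := List.append_inj' hr rfl
        rcases hW.eq_or_disjoint hw hl with h2 | h2
        · rw [h1, List.append_assoc] at h2
          simp at h2
        · refine absurd h2 (Set.not_disjoint_iff.2 ⟨_, ?_, prepend_mem_cylinder _ fun _ => false⟩)
          rw [h1, List.append_assoc]
          exact cylinder_append_subset _ _ (prepend_mem_cylinder _ _)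
    cases b
    · exact ⟨hl, hsib⟩
    · exact ⟨hsib, hl⟩

/-- Induction on the number of cylinders on which `g` replaces prefixes: composing `g` with swaps
of these cylinders makes it send two siblings to two siblings, which can then be merged. -/
theorem mem_of_cylinderFamily {K : Subgroup thompsonV}
    (hK : ∀ u v, Disjoint (cylinder u) (cylinder v) → swap u v ∈ K) (n : ℕ) :
    ∀ W : Finset (List Bool), W.card = n → IsCylinderFamily W → ∀ g : thompsonV,
      (∀ w ∈ W, ∃ z, ∀ y, g • prepend w y = prepend z y) → g ∈ K := by
  classical
  have hK' : ∀ u v, swap u v ∈ K := fun u v => by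
    by_cases h : Disjoint (cylinder u) (cylinder v)
    · exact hK u v h
    · rw [swap, dif_neg h]
      exact K.one_mem
  induction n with
  | zero =>
    intro W hW0 hW
    obtain ⟨w, ⟨hw, -⟩, -⟩ := hW fun _ => false
    rw [Finset.card_eq_zero] at hW0
    simp [hW0] at hw
  | succ n ih =>
    intro W hcard hW g hg
    choose! z hz using hg
    have hinj : ∀ w ∈ W, ∀ w' ∈ W, ¬ Disjoint (cylinder (z w)) (cylinder (z w')) → w = w' := by
      intro w hw w' hw' hd
      obtain ⟨_, ⟨x, rfl⟩, y, hy⟩ := Set.not_disjoint_iff.1 hd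
      rw [← hz w hw, ← hz w' hw'] at hy
      have h2 := smul_left_cancel g hy
      exact (hW (prepend w x)).unique ⟨hw, prepend_mem_cylinder w x⟩ ⟨hw', y, h2⟩
    -- the images of the cylinders form a partition as well
    have hZ : IsCylinderFamily (W.image z) := by
      intro x
      obtain ⟨w, ⟨hw, y, hy⟩, -⟩ := hW (g⁻¹ • x)
      have hx : x = prepend (z w) y := by rw [← hz w hw, hy, smul_inv_smul]
      refine ⟨z w, ⟨Finset.mem_image_of_mem z hw, y, hx.symm⟩, ?_⟩
      rintro v ⟨hv, hv'⟩
      obtain ⟨w', hw', rfl⟩ := Finset.mem_image.1 hv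
      rw [hinj w' hw' w hw (Set.not_disjoint_iff.2 ⟨x, hv', y, hx.symm⟩)]
    rcases hW.exists_siblings with rfl | ⟨u, hu0, hu1⟩
    · -- `g` prepends a word, which is empty because `g` is surjective
      rcases hZ.exists_siblings with h | ⟨v, hv0, hv1⟩
      · rw [Finset.image_singleton, Finset.singleton_inj] at h
        have : g = 1 := thompsonV_ext fun x => by
          have := hz [] (Finset.mem_singleton_self _) x
          rw [h] at this
          simpa [prepend] using this
        rw [this]
        exact K.one_mem
      · rw [Finset.image_singleton, Finset.mem_singleton] at hv0 hv1
        have := hv0.trans hv1.symm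
        simp at this
    · rcases hZ.exists_siblings with h | ⟨v, hv0, hv1⟩
      · have h0 : z (u ++ [false]) = z (u ++ [true]) := by
          have h0 := Finset.mem_image_of_mem z hu0
          have h1 := Finset.mem_image_of_mem z hu1
          rw [h, Finset.mem_singleton] at h0 h1
          rw [h0, h1]
        have := hinj _ hu0 _ hu1 (by rw [h0]; exact not_disjoint_cylinder_self _)
        simp at this
      · obtain ⟨a, ha, hav⟩ := Finset.mem_image.1 hv0
        obtain ⟨b, hb, hbv⟩ := Finset.mem_image.1 hv1
        have hab : a ≠ b := by
          rintro rfl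
          rw [hav] at hbv
          simp at hbv
        have hswap : ∀ c ∈ W, ∀ d ∈ W, ∀ w ∈ W, ∃ w' ∈ W, ∀ y,
            swap c d • prepend w y = prepend w' y := by
          intro c hc d hd w hw
          rcases hW.eq_or_disjoint hc hw with rfl | h1
          · exact ⟨d, hd, swap_smul_left (hW.eq_or_disjoint hc hd)⟩
          · rcases hW.eq_or_disjoint hd hw with rfl | h2
            · exact ⟨c, hc, swap_smul_right (hW.eq_or_disjoint hc hd)⟩
            · exact ⟨w, hw, fun y => swap_smul_of_notMem
                (Set.disjoint_right.1 h1 (prepend_mem_cylinder _ _))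
                (Set.disjoint_right.1 h2 (prepend_mem_cylinder _ _))⟩
        -- permute the cylinders of `W` so that siblings are sent to siblings, and merge them
        have hp0 := swap_smul_left (hW.eq_or_disjoint hu0 ha)
        obtain ⟨c, hc, hpc⟩ := hswap _ hu0 a ha _ hu1
        have hca : c ≠ a := by
          rintro rfl
          have := smul_left_cancel _ ((hp0 fun _ => false).trans (hpc fun _ => false).symm)
          rw [prepend_append, prepend_append] at this
          have := congrFun (prepend_injective u this) 0
          simp [prepend] at this
        have hqc := swap_smul_left (hW.eq_or_disjoint hc hb)
        have hqa : ∀ y, swap c b • prepend a y = prepend a y := fun y => swap_smul_of_notMem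
          (Set.disjoint_right.1 ((hW.eq_or_disjoint hc ha).resolve_left hca.symm)
            (prepend_mem_cylinder _ _))
          (Set.disjoint_right.1 ((hW.eq_or_disjoint hb ha).resolve_left hab)
            (prepend_mem_cylinder _ _))
        have hmem : g * swap c b * swap (u ++ [false]) a ∈ K := by
          refine ih (insert u ((W.erase (u ++ [false])).erase (u ++ [true]))) ?_ ?_ _ ?_
          · have hu : u ∉ W := by
              intro hu
              rcases hW.eq_or_disjoint hu hu0 with h | h
              · simp at h
              · exact Set.disjoint_right.1 h (prepend_mem_cylinder _ fun _ => false)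
                  (cylinder_append_subset _ _ (prepend_mem_cylinder _ _))
            rw [Finset.card_insert_of_notMem (by simp [hu]),
              Finset.card_erase_of_mem (by simp [hu1]), Finset.card_erase_of_mem hu0, hcard]
            have : 0 < W.card := Finset.card_pos.2 ⟨_, hu0⟩
            have h2 : 1 < W.card := Finset.one_lt_card.2 ⟨_, hu0, _, hu1, by simp⟩
            omega
          · intro x
            by_cases hx : x ∈ cylinder u
            · refine ⟨u, ⟨Finset.mem_insert_self _ _, hx⟩, ?_⟩
              rintro w ⟨hw, hxw⟩
              rcases Finset.mem_insert.1 hw with h | h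
              · exact h
              · exfalso
                rw [Finset.mem_erase, Finset.mem_erase] at h
                obtain ⟨y, rfl⟩ := hx
                rw [← prepend_dropPrefix_nil y, ← prepend_append] at hxw
                cases hy0 : y 0
                · rw [hy0] at hxw
                  exact h.2.1 ((hW _).unique ⟨h.2.2, hxw⟩ ⟨hu0, prepend_mem_cylinder _ _⟩)
                · rw [hy0] at hxw
                  exact h.1 ((hW _).unique ⟨h.2.2, hxw⟩ ⟨hu1, prepend_mem_cylinder _ _⟩)
            · obtain ⟨w, ⟨hw, hxw⟩, hun⟩ := hW x
              have hne : ∀ b, w ≠ u ++ [b] := by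
                rintro b rfl
                exact hx (cylinder_append_subset _ _ hxw)
              refine ⟨w, ⟨by simp [hw, hne], hxw⟩, ?_⟩
              rintro w' ⟨hw', hxw'⟩
              rcases Finset.mem_insert.1 hw' with rfl | h
              · exact absurd hxw' hx
              · exact hun w' ⟨(Finset.mem_erase.1 (Finset.mem_erase.1 h).2).2, hxw'⟩
          · intro w hw
            rcases Finset.mem_insert.1 hw with rfl | h
            · refine ⟨v, fun y => ?_⟩
              rw [← prepend_dropPrefix_nil y]
              generalize dropPrefix [y 0] y = y'
              rw [← prepend_append, ← prepend_append, mul_smul, mul_smul]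
              cases y 0
              · rw [hp0, hqa, hz a ha, hav]
              · rw [hpc, hqc, hz b hb, hbv]
            · obtain ⟨w₁, hw₁, h₁⟩ := hswap _ hu0 a ha w
                (Finset.mem_erase.1 (Finset.mem_erase.1 h).2).2
              obtain ⟨w₂, hw₂, h₂⟩ := hswap c hc b hb w₁ hw₁
              exact ⟨z w₂, fun y => by rw [mul_smul, mul_smul, h₁, h₂, hz w₂ hw₂]⟩
        rw [mul_assoc] at hmem
        exact (K.mul_mem_cancel_right (K.mul_mem (hK' _ _) (hK' _ _))).1 hmem

/-- Swaps of disjoint cylinders generate `V`. -/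
theorem mem_of_swap_mem {K : Subgroup thompsonV}
    (hK : ∀ u v, Disjoint (cylinder u) (cylinder v) → swap u v ∈ K) (g : thompsonV) : g ∈ K := by
  classical
  obtain ⟨n, w, z, hw, -, hg⟩ := g.2
  refine mem_of_cylinderFamily hK _ (Finset.univ.image w) rfl (fun x => ?_) g ?_
  · obtain ⟨i, hi, hun⟩ := hw x
    refine ⟨w i, ⟨Finset.mem_image_of_mem w (Finset.mem_univ i), hi⟩, ?_⟩
    rintro v ⟨hv, hxv⟩
    obtain ⟨j, -, rfl⟩ := Finset.mem_image.1 hv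
    rw [hun j hxv]
  · intro v hv
    obtain ⟨j, -, rfl⟩ := Finset.mem_image.1 hv
    exact ⟨z j, hg j⟩

/-! ### Copies of `V` in cylinders -/

theorem viaEmbedding_prepend (w : List Bool) (e : Equiv.Perm Cantor) (y : Cantor) :
    e.viaEmbedding ⟨prepend w, prepend_injective w⟩ (prepend w y) = prepend w (e y) :=
  e.viaEmbedding_apply ⟨prepend w, prepend_injective w⟩ y

theorem viaEmbedding_of_notMem (w : List Bool) (e : Equiv.Perm Cantor) {x : Cantor}
    (hx : x ∉ cylinder w) : e.viaEmbedding ⟨prepend w, prepend_injective w⟩ x = x :=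
  e.viaEmbedding_apply_of_notMem ⟨prepend w, prepend_injective w⟩ x hx

theorem replacesPrefixes_viaEmbedding (w : List Bool) {e : Equiv.Perm Cantor}
    (he : ReplacesPrefixes e) :
    ReplacesPrefixes (e.viaEmbedding ⟨prepend w, prepend_injective w⟩) := by
  obtain ⟨N, hN⟩ := he
  refine ⟨w.length + N, fun u hu => ?_⟩
  rcases eq_append_or_disjoint w u (by omega) with ⟨r, rfl⟩ | h
  · obtain ⟨z, hz⟩ := hN r (by simpa using hu)
    exact ⟨w ++ z, fun y => by
      rw [prepend_append, prepend_append, viaEmbedding_prepend, hz]⟩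
  · exact ⟨u, fun y =>
      viaEmbedding_of_notMem w e (Set.disjoint_right.1 h (prepend_mem_cylinder u y))⟩

/-- The element `place w g` acts on the cylinder of `w` as `g` does on the whole Cantor set. -/
noncomputable def place (w : List Bool) : thompsonV →* thompsonV where
  toFun g := ofPrefix (Equiv.Perm.viaEmbedding g.1.toEquiv ⟨prepend w, prepend_injective w⟩)
    (replacesPrefixes_viaEmbedding w (replacesPrefixes_smul g))
  map_one' := thompsonV_ext fun x => by
    rw [ofPrefix_smul, one_smul]
    by_cases hx : x ∈ cylinder w
    · obtain ⟨y, rfl⟩ := hx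
      exact viaEmbedding_prepend w _ y
    · exact viaEmbedding_of_notMem w _ hx
  map_mul' g h := thompsonV_ext fun x => by
    rw [mul_smul, ofPrefix_smul, ofPrefix_smul, ofPrefix_smul]
    by_cases hx : x ∈ cylinder w
    · obtain ⟨y, rfl⟩ := hx
      rw [viaEmbedding_prepend, viaEmbedding_prepend, viaEmbedding_prepend]
      rfl
    · rw [viaEmbedding_of_notMem w _ hx, viaEmbedding_of_notMem w _ hx,
        viaEmbedding_of_notMem w _ hx]

theorem place_smul_prepend (w : List Bool) (g : thompsonV) (y : Cantor) :
    place w g • prepend w y = prepend w (g • y) := viaEmbedding_prepend w _ y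

theorem place_smul_of_notMem {w : List Bool} (g : thompsonV) {x : Cantor} (hx : x ∉ cylinder w) :
    place w g • x = x := viaEmbedding_of_notMem w _ hx

theorem place_injective (w : List Bool) : Function.Injective (place w) := fun g h hgh =>
  thompsonV_ext fun x => prepend_injective w (by
    rw [← place_smul_prepend, ← place_smul_prepend, hgh])

theorem place_place (u v : List Bool) (g : thompsonV) :
    place u (place v g) = place (u ++ v) g := by
  refine thompsonV_ext fun x => ?_
  by_cases hx : x ∈ cylinder u
  · obtain ⟨x, rfl⟩ := hx
    rw [place_smul_prepend]
    by_cases hx : x ∈ cylinder v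
    · obtain ⟨x, rfl⟩ := hx
      rw [place_smul_prepend, ← prepend_append, ← prepend_append, place_smul_prepend]
    · rw [place_smul_of_notMem g hx, place_smul_of_notMem]
      rintro ⟨y, hy⟩
      rw [prepend_append] at hy
      exact hx ⟨y, prepend_injective u hy⟩
  · rw [place_smul_of_notMem _ hx, place_smul_of_notMem]
    exact fun h => hx (cylinder_append_subset u v h)

theorem disjoint_cylinder_append_left {u v : List Bool} (w : List Bool)
    (h : Disjoint (cylinder u) (cylinder v)) :
    Disjoint (cylinder (w ++ u)) (cylinder (w ++ v)) := by
  rw [Set.disjoint_left]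
  rintro _ ⟨x, rfl⟩ ⟨y, hy⟩
  rw [prepend_append, prepend_append] at hy
  exact Set.disjoint_left.1 h ⟨x, rfl⟩ ⟨y, prepend_injective w hy⟩

theorem place_swap {u v : List Bool} (w : List Bool) (h : Disjoint (cylinder u) (cylinder v)) :
    place w (swap u v) = swap (w ++ u) (w ++ v) := by
  have h' := disjoint_cylinder_append_left w h
  refine thompsonV_ext fun x => ?_
  by_cases hx : x ∈ cylinder w
  · obtain ⟨x, rfl⟩ := hx
    rw [place_smul_prepend]
    by_cases hu : x ∈ cylinder u
    · obtain ⟨x, rfl⟩ := hu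
      rw [swap_smul_left (Or.inr h), ← prepend_append, ← prepend_append,
        swap_smul_left (Or.inr h')]
    · by_cases hv : x ∈ cylinder v
      · obtain ⟨x, rfl⟩ := hv
        rw [swap_smul_right (Or.inr h), ← prepend_append, ← prepend_append,
          swap_smul_right (Or.inr h')]
      · rw [swap_smul_of_notMem hu hv, swap_smul_of_notMem]
        · rintro ⟨y, hy⟩
          rw [prepend_append] at hy
          exact hu ⟨y, prepend_injective w hy⟩
        · rintro ⟨y, hy⟩
          rw [prepend_append] at hy
          exact hv ⟨y, prepend_injective w hy⟩
  · rw [place_smul_of_notMem _ hx, swap_smul_of_notMem]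
    · exact fun h => hx (cylinder_append_subset w u h)
    · exact fun h => hx (cylinder_append_subset w v h)

/-! ### The germ stabilizer of `000…` in `V` -/

/-- The sequence `000…`. -/
def zeroSeq : Cantor := fun _ => false

theorem prepend_replicate_zeroSeq (k : ℕ) :
    prepend (List.replicate k false) zeroSeq = zeroSeq := by
  induction k with
  | zero => rfl
  | succ k ih =>
    funext n
    cases n with
    | zero => rfl
    | succ n => exact congrFun ih n

theorem zeroSeq_notMem_cylinder {u : List Bool} (hu : true ∈ u) : zeroSeq ∉ cylinder u := by
  rintro ⟨y, hy⟩
  have := exists_prefix (hy.trans (prepend_replicate_zeroSeq u.length).symm) (by simp)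
  obtain ⟨r, hr⟩ := this
  have : true ∈ List.replicate u.length false := hr ▸ List.mem_append_left r hu
  simpa using List.eq_of_mem_replicate this

theorem true_mem_of_notMem {u : List Bool} (hu : zeroSeq ∉ cylinder u) : true ∈ u := by
  by_contra h
  have : u = List.replicate u.length false := by
    rw [List.eq_replicate_iff]
    exact ⟨rfl, fun b hb => by cases b <;> simp_all⟩
  exact hu ⟨zeroSeq, by rw [this]; exact prepend_replicate_zeroSeq _⟩

theorem disjoint_cylinder_replicate {u : List Bool} (hu : true ∈ u) {k : ℕ} (hk : u.length ≤ k) :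
    Disjoint (cylinder u) (cylinder (List.replicate k false)) := by
  rcases eq_append_or_disjoint u (List.replicate k false) (by simpa using hk) with ⟨r, hr⟩ | h
  · have : true ∈ List.replicate k false := hr ▸ List.mem_append_left r hu
    simpa using List.eq_of_mem_replicate this
  · exact h

theorem mem_nbhdStabilizer_of_notMem {z : Cantor} {g : thompsonV} {w : List Bool}
    (hz : z ∈ cylinder w) (h : ∀ x ∈ cylinder w, g • x = x) :
    g ∈ nbhdStabilizer thompsonV z := by
  show ∀ᶠ x in 𝓝 z, g • x = x
  filter_upwards [(isOpen_cylinder w).mem_nhds hz] with x hx using h x hx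

theorem swap_mem_nbhdStabilizer {z : Cantor} {u v : List Bool} (hu : z ∉ cylinder u)
    (hv : z ∉ cylinder v) : swap u v ∈ nbhdStabilizer thompsonV z := by
  show ∀ᶠ x in 𝓝 z, swap u v • x = x
  filter_upwards [(isClosed_cylinder u).isOpen_compl.mem_nhds hu,
    (isClosed_cylinder v).isOpen_compl.mem_nhds hv] with x hxu hxv
  exact swap_smul_of_notMem hxu hxv

/-- The elements of `V` that are trivial near `000…`. -/
abbrev germV : Subgroup thompsonV := nbhdStabilizer thompsonV zeroSeq

theorem exists_replicate_of_mem_germV {g : thompsonV} (hg : g ∈ germV) :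
    ∃ k, ∀ m ≥ k, ∀ x ∈ cylinder (List.replicate m false), g • x = x := by
  have hg : ∀ᶠ x in 𝓝 zeroSeq, g • x = x := hg
  obtain ⟨k, hk⟩ := exists_cylinder_subset hg
  exact ⟨k, fun m hm x hx => hk _ _ (by simpa using hm) (prepend_replicate_zeroSeq m) hx⟩

/-- Up to elements trivial near `000…`, all cylinders not containing `000…` are the same. -/
theorem exists_mem_germV_prepend {u v : List Bool} (hu : true ∈ u) (hv : true ∈ v) :
    ∃ h ∈ germV, ∀ y, h • prepend u y = prepend v y := by
  -- a third cylinder, disjoint from those of `u` and `v`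
  let q := List.replicate (u.length + v.length) false ++ [true]
  have hq : true ∈ q := by simp [q]
  have huq : Disjoint (cylinder u) (cylinder q) :=
    (disjoint_cylinder_replicate hu (by omega)).mono_right (cylinder_append_subset _ _)
  have hvq : Disjoint (cylinder v) (cylinder q) :=
    (disjoint_cylinder_replicate hv (by omega)).mono_right (cylinder_append_subset _ _)
  refine ⟨swap q v * swap u q, Subgroup.mul_mem _
    (swap_mem_nbhdStabilizer (zeroSeq_notMem_cylinder hq) (zeroSeq_notMem_cylinder hv))
    (swap_mem_nbhdStabilizer (zeroSeq_notMem_cylinder hu) (zeroSeq_notMem_cylinder hq)),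
    fun y => ?_⟩
  rw [mul_smul, swap_smul_left (Or.inr huq), swap_smul_left (Or.inr hvq.symm)]

/-- The swap of the cylinders of `u` and `v` is the product of the swaps `s` of their first halves
and `k s k⁻¹` of their second halves. Since `s` is an involution, this product is a commutator. -/
theorem swap_mem_commutator {u v : List Bool} (hu : true ∈ u) (hv : true ∈ v)
    (h : Disjoint (cylinder u) (cylinder v)) : swap u v ∈ ⁅germV, germV⁆ := by
  have hmem : ∀ {a b : List Bool}, true ∈ a → true ∈ b → swap a b ∈ germV := fun ha hb =>
    swap_mem_nbhdStabilizer (zeroSeq_notMem_cylinder ha) (zeroSeq_notMem_cylinder hb)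
  have hu' : ∀ b, true ∈ u ++ [b] := fun b => List.mem_append_left _ hu
  have hv' : ∀ b, true ∈ v ++ [b] := fun b => List.mem_append_left _ hv
  have hb := fun b c => disjoint_cylinder_append h [b] [c]
  have hs := fun w => disjoint_cylinder_siblings w false
  set s := swap (u ++ [false]) (v ++ [false]) with hs_def
  set k := swap (v ++ [false]) (v ++ [true]) * swap (u ++ [false]) (u ++ [true]) with hk_def
  have hconj : k * s * k⁻¹ = swap (u ++ [true]) (v ++ [true]) := by
    refine conj_swap (hb _ _) (hb _ _) (fun y => ?_) (fun y => ?_)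
    · rw [mul_smul, swap_smul_left (Or.inr (hs u) : u ++ [true] = _ ∨ _), swap_smul_of_notMem]
      · exact Set.disjoint_left.1 (hb _ _) (prepend_mem_cylinder _ _)
      · exact Set.disjoint_left.1 (hb _ _) (prepend_mem_cylinder _ _)
    · rw [mul_smul, swap_smul_of_notMem (u := u ++ [false]),
        swap_smul_left (Or.inr (hs v) : v ++ [true] = _ ∨ _)]
      · exact Set.disjoint_right.1 (hb _ _) (prepend_mem_cylinder _ _)
      · exact Set.disjoint_right.1 (hb _ _) (prepend_mem_cylinder _ _)
  have hss : s⁻¹ = s := by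
    rw [inv_eq_iff_mul_eq_one]
    refine thompsonV_ext fun x => ?_
    rw [mul_smul, one_smul, hs_def, swap_smul (hb _ _), swap_smul (hb _ _),
      swapFun_involutive (hb _ _)]
  have hmem' := Subgroup.commutator_mem_commutator (hmem (hu' false) (hv' false))
    (Subgroup.mul_mem _ (hmem (hv' false) (hv' true)) (hmem (hu' false) (hu' true)))
  rwa [← hs_def, ← hk_def, commutatorElement_def, hss, mul_assoc, mul_assoc, ← mul_assoc k, hconj,
    ← swap_eq_mul h] at hmem'

open scoped Classical in
/-- The involution that exchanges the complement `S` of the cylinder of `c` with its copy `w S`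
in the cylinder of `w`, where `w` extends `c`. -/
noncomputable def compressFun (c w : List Bool) (x : Cantor) : Cantor :=
  if x ∉ cylinder c then prepend w x
  else if x ∈ cylinder w ∧ dropPrefix w x ∉ cylinder c then dropPrefix w x else x

section compress

variable {c r : List Bool}

theorem compressFun_of_notMem {w : List Bool} {x : Cantor} (hx : x ∉ cylinder c) :
    compressFun c w x = prepend w x := if_pos hx

theorem compressFun_prepend {x : Cantor} (hx : x ∉ cylinder c) :
    compressFun c (c ++ r) (prepend (c ++ r) x) = x := by
  rw [compressFun, if_neg (not_not.2 (cylinder_append_subset c r (prepend_mem_cylinder _ x))),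
    dropPrefix_prepend, if_pos ⟨prepend_mem_cylinder _ x, hx⟩]

theorem compressFun_of_mem {w : List Bool} {x : Cantor} (hx : x ∈ cylinder c)
    (h : ∀ y, prepend w y = x → y ∈ cylinder c) : compressFun c w x = x := by
  rw [compressFun, if_neg (not_not.2 hx), if_neg]
  rintro ⟨⟨y, rfl⟩, h2⟩
  rw [dropPrefix_prepend] at h2
  exact h2 (h y rfl)

theorem compressFun_involutive (c r : List Bool) :
    Function.Involutive (compressFun c (c ++ r)) := by
  intro x
  by_cases hx : x ∈ cylinder c
  · by_cases h : ∀ y, prepend (c ++ r) y = x → y ∈ cylinder c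
    · rw [compressFun_of_mem hx h, compressFun_of_mem hx h]
    · push Not at h
      obtain ⟨y, rfl, hy⟩ := h
      rw [compressFun_prepend hy, compressFun_of_notMem hy]
  · rw [compressFun_of_notMem hx, compressFun_prepend hx]

theorem replacesPrefixes_compressFun (c r : List Bool) :
    ReplacesPrefixes (compressFun c (c ++ r)) := by
  refine ⟨(c ++ r).length + c.length, fun p hp => ?_⟩
  have hlen : (c ++ r).length = c.length + r.length := List.length_append
  rcases eq_append_or_disjoint c p (by omega) with ⟨p', hp'⟩ | hd
  · have hmem : ∀ y, prepend p y ∈ cylinder c := fun y => by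
      rw [hp']
      exact cylinder_append_subset _ _ (prepend_mem_cylinder _ _)
    rcases eq_append_or_disjoint (c ++ r) p (by omega) with ⟨s, rfl⟩ | hd
    · rcases eq_or_disjoint_cylinder c s (by rw [List.length_append] at hp; omega) with rfl | hs
      · refine ⟨_, fun y => compressFun_of_mem (hmem y) fun y' hy' => ?_⟩
        rw [prepend_append (s ++ r)] at hy'
        rw [prepend_injective (s ++ r) hy']
        exact prepend_mem_cylinder _ _
      · refine ⟨s, fun y => ?_⟩
        rw [prepend_append, compressFun_prepend]
        exact Set.disjoint_right.1 hs (prepend_mem_cylinder _ _)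
    · refine ⟨p, fun y => compressFun_of_mem (hmem y) fun y' hy' => ?_⟩
      exact absurd ⟨y', hy'⟩ (Set.disjoint_right.1 hd (prepend_mem_cylinder p y))
  · refine ⟨c ++ r ++ p, fun y => ?_⟩
    rw [prepend_append, compressFun_of_notMem]
    exact Set.disjoint_right.1 hd (prepend_mem_cylinder p y)

end compress

/-- An element of `V`, trivial near `000…`, that carries the complement of the cylinder of `0ᵏ`
into the cylinder of a given word, provided that the latter does not contain `000…`. -/
theorem exists_mem_germV_compress (k : ℕ) {u : List Bool} (hu : true ∈ u) :
    ∃ h ∈ germV, (∀ x ∉ cylinder (List.replicate k false), h • x = prepend u x) := by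
  let c := List.replicate k false
  let t : thompsonV := ofPrefix (compressFun_involutive c [true]).toPerm
    (replacesPrefixes_compressFun c [true])
  have ht : t ∈ germV := by
    refine mem_nbhdStabilizer_of_notMem (w := c ++ [false]) ⟨zeroSeq, ?_⟩ ?_
    · have := prepend_replicate_zeroSeq (k + 1)
      rwa [List.replicate_succ'] at this
    · intro x hx
      refine compressFun_of_mem (cylinder_append_subset _ _ hx) fun y hy => ?_
      exact absurd ⟨y, hy⟩ (Set.disjoint_left.1 (disjoint_cylinder_siblings c false) hx)
  obtain ⟨h, hh, hhu⟩ := exists_mem_germV_prepend (u := c ++ [true]) (v := u) (by simp) hu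
  refine ⟨h * t, Subgroup.mul_mem _ hh ht, fun x hx => ?_⟩
  rw [mul_smul, ← hhu]
  exact congrArg _ (compressFun_of_notMem hx)

/-- Conjugation by an element `h` as in `exists_mem_germV_compress` moves `g` to its copy in the
cylinder of `u`. -/
theorem conj_eq_place {k : ℕ} {u : List Bool} {h g : thompsonV}
    (hh : ∀ x ∉ cylinder (List.replicate k false), h • x = prepend u x)
    (hg : ∀ x ∈ cylinder (List.replicate k false), g • x = x) : h * g * h⁻¹ = place u g := by
  set c := List.replicate k false
  have hinv : ∀ x ∉ cylinder c, g • x ∉ cylinder c := fun x hx hgx =>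
    hx (by rwa [smul_left_cancel g (hg _ hgx)] at hgx)
  rw [mul_inv_eq_iff_eq_mul]
  refine thompsonV_ext fun x => ?_
  rw [mul_smul, mul_smul]
  by_cases hx : x ∈ cylinder c
  · rw [hg x hx]
    by_cases hu : h • x ∈ cylinder u
    · obtain ⟨y, hy⟩ := hu
      rw [← hy, place_smul_prepend]
      by_cases hyc : y ∈ cylinder c
      · rw [hg y hyc]
      · rw [← hh y hyc] at hy
        exact absurd hx (smul_left_cancel h hy ▸ hyc)
    · rw [place_smul_of_notMem _ hu]
  · rw [hh x hx, hh _ (hinv x hx), place_smul_prepend]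

/-- An element trivial near `000…` is conjugate in `germV` to a copy of itself in the cylinder of
`1`, and such copies are products of swaps. -/
theorem germV_perfect : commutator germV = ⊤ := by
  have hle : germV ≤ ⁅germV, germV⁆ := by
    intro g hg
    obtain ⟨k, hk⟩ := exists_replicate_of_mem_germV hg
    obtain ⟨h, hh, hhu⟩ := exists_mem_germV_compress k (u := [true]) (by simp)
    have hplace : place [true] g ∈ ⁅germV, germV⁆ := by
      refine mem_of_swap_mem (K := (⁅germV, germV⁆).comap (place [true])) (fun u v huv => ?_) g
      rw [Subgroup.mem_comap, place_swap _ huv]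
      exact swap_mem_commutator (by simp) (by simp) (disjoint_cylinder_append_left _ huv)
    rw [← conj_eq_place hhu (hk k le_rfl)] at hplace
    have h1 := Subgroup.commutator_mem_commutator hh hg
    rw [commutatorElement_def] at h1
    have := Subgroup.mul_mem _ (Subgroup.inv_mem _ h1) hplace
    simpa [mul_assoc] using this
  refine Subgroup.map_injective germV.subtype_injective ?_
  rw [Subgroup.map_subtype_commutator, ← MonoidHom.range_eq_map, Subgroup.range_subtype]
  exact le_antisymm (Subgroup.commutator_le_self germV) hle

theorem germV_infinite : Infinite germV := by
  choose h hh hhu using fun n : ℕ =>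
    exists_mem_germV_prepend (u := [true]) (v := List.replicate n false ++ [true])
      (by simp) (by simp)
  refine Infinite.of_injective (fun n => (⟨h n, hh n⟩ : germV)) fun m n hmn => ?_
  have hmn : h m = h n := congrArg Subtype.val hmn
  have key : ∀ m n : ℕ, m < n → h m = h n → False := by
    intro m n hlt hmn
    have h1 := (hhu m zeroSeq).symm.trans ((congrArg (· • prepend [true] zeroSeq) hmn).trans
      (hhu n zeroSeq))
    have hd := disjoint_cylinder_replicate (u := List.replicate m false ++ [true]) (k := n)
      (by simp) (by simpa using hlt)
    exact Set.disjoint_left.1 hd ⟨_, rfl⟩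
      (by rw [h1]; exact cylinder_append_subset _ _ (prepend_mem_cylinder _ _))
  rcases lt_trichotomy m n with h | h | h
  · exact (key m n h hmn).elim
  · exact h
  · exact (key n m h hmn.symm).elim

/-- Elements trivial near `000…` can be squeezed into a cylinder displaced by a given `n ≠ 1`. -/
theorem germV_isSimpleGroup : IsSimpleGroup germV := by
  have := germV_infinite
  refine isSimpleGroup_of_perfect germV_perfect fun n hn a b => ?_
  obtain ⟨y, hy⟩ : ∃ y : Cantor, (n : thompsonV) • y ≠ y := by
    by_contra! h
    exact hn (Subtype.ext (thompsonV_ext fun x => by rw [h]; exact (one_smul _ x).symm))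
  have hy0 : y ≠ zeroSeq := by
    rintro rfl
    have : ∀ᶠ x in 𝓝 zeroSeq, (n : thompsonV) • x = x := n.2
    exact hy this.self_of_nhds
  obtain ⟨A, B, hA, hB, hyA, hyB, hAB⟩ := t2_separation hy
  have hO : ((n : thompsonV) • ·) ⁻¹' A ∩ B ∩ {zeroSeq}ᶜ ∈ 𝓝 y :=
    (((hA.preimage (continuous_const_smul _)).inter hB).inter isOpen_compl_singleton).mem_nhds
      ⟨⟨hyA, hyB⟩, hy0⟩
  obtain ⟨u, -, -, hu⟩ := exists_cylinder_mem_subset hO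
  have hu0 : true ∈ u := true_mem_of_notMem fun h => (hu h).2 rfl
  obtain ⟨k₁, hk₁⟩ := exists_replicate_of_mem_germV a.2
  obtain ⟨k₂, hk₂⟩ := exists_replicate_of_mem_germV b.2
  obtain ⟨h, hh, hhu⟩ := exists_mem_germV_compress (max k₁ k₂) hu0
  refine ⟨⟨h, hh⟩, Subtype.ext ?_⟩
  show h * a * h⁻¹ * (n * (h * b * h⁻¹) * (n : thompsonV)⁻¹) =
    n * (h * b * h⁻¹) * (n : thompsonV)⁻¹ * (h * a * h⁻¹)
  rw [conj_eq_place hhu (hk₁ _ (le_max_left _ _)), conj_eq_place hhu (hk₂ _ (le_max_right _ _))]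
  refine commute_of_disjoint_support (Y := Cantor) (A := cylinder u)
    (B := ((n : thompsonV)⁻¹ • ·) ⁻¹' cylinder u) ?_ (fun x hx => place_smul_of_notMem _ hx) ?_
  · rw [Set.disjoint_left]
    intro x hx hx'
    have := (hu hx').1.1
    rw [Set.mem_preimage, smul_inv_smul] at this
    exact Set.disjoint_left.1 hAB this (hu hx).1.2
  · intro x hx
    rw [mul_smul, mul_smul, place_smul_of_notMem _ hx, smul_inv_smul]

theorem exists_mul_ne_of_perfect {D : Type*} [Group D] [Nontrivial D] (h : commutator D = ⊤) :
    ∃ a b : D, a * b ≠ b * a := by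
  by_contra! hcon
  have : commutator D ≤ ⊥ := by
    rw [commutator_def, Subgroup.commutator_le]
    intro a _ b _
    rw [Subgroup.mem_bot, commutatorElement_eq_one_iff_mul_comm]
    exact hcon a b
  rw [h] at this
  exact bot_ne_top (top_le_iff.1 this)

/-! ### Minimal actions of `V` -/

/-- If an action of `V` on a compact space has confined stabilizers, then some point is fixed by
all elements that are trivial near `000…`. -/
theorem exists_germV_le_stabilizer {X : Type*} [TopologicalSpace X] [CompactSpace X] [T2Space X]
    [Nonempty X] [MulAction thompsonV X] [ContinuousConstSMul thompsonV X]
    (hP : ∃ P : Finset thompsonV, 1 ∉ P ∧ ∀ x : X, ∃ p ∈ P, p • x = x) :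
    ∃ x : X, germV ≤ MulAction.stabilizer thompsonV x := by
  have := germV_isSimpleGroup
  have := germV_infinite
  have e := fun w => germV.equivMapOfInjective (place w) (place_injective w)
  obtain ⟨x₀, w, hx₀⟩ := exists_le_stabilizer_of_confined (X := X) (Y := Cantor) cylinder
    (fun w => germV.map (place w)) (fun O hO ⟨y, hy⟩ => by
      obtain ⟨w, -, -, hw⟩ := exists_cylinder_mem_subset (hO.mem_nhds hy)
      exact ⟨w, hw⟩)
    (by
      rintro w _ ⟨g, -, rfl⟩ y hy
      exact place_smul_of_notMem g hy)
    (fun w => (e w).symm.isSimpleGroup) (fun w => Infinite.of_injective (e w) (e w).injective)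
    (fun w => by
      obtain ⟨a, b, hab⟩ := exists_mul_ne_of_perfect germV_perfect
      exact ⟨e w a, e w b, fun h => hab ((e w).injective (by simpa using h))⟩) hP
  let Z : ℕ → Set X := fun k => {x | ∀ g : thompsonV,
    (∀ y ∈ cylinder (List.replicate k false), g • y = y) → g • x = x}
  have hZ : (⋂ k, Z k).Nonempty := by
    have hclosed : ∀ k, IsClosed (Z k) := fun k => by
      simp only [Z, Set.ofPred_forall]
      exact isClosed_iInter fun g => isClosed_iInter fun _ =>
        isClosed_eq (continuous_const_smul g) continuous_id
    refine IsCompact.nonempty_iInter_of_sequence_nonempty_isCompact_isClosed Z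
      (fun k x hx g hg => ?_) (fun k => ?_) (hclosed 0).isCompact hclosed
    · refine hx g fun y hy => hg y ?_
      rw [List.replicate_succ'] at hy
      exact cylinder_append_subset _ _ hy
    · -- move `x₀` by an element expanding the cylinder of `w`
      obtain ⟨h, -, hh⟩ := exists_mem_germV_compress k (u := w ++ [true]) (by simp)
      refine ⟨h⁻¹ • x₀, fun g hg => ?_⟩
      have hmem : h * g * h⁻¹ ∈ MulAction.stabilizer thompsonV x₀ := by
        refine hx₀ ⟨place [true] g, ?_, ?_⟩
        · refine mem_nbhdStabilizer_of_notMem (w := [false])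
            ⟨zeroSeq, prepend_replicate_zeroSeq 1⟩ fun x hx => place_smul_of_notMem _ ?_
          exact Set.disjoint_left.1 (disjoint_cylinder_siblings [] false) hx
        · rw [conj_eq_place hh hg, place_place]
      rw [MulAction.mem_stabilizer_iff, mul_smul, mul_smul] at hmem
      rw [eq_inv_smul_iff]
      exact hmem
  obtain ⟨x, hx⟩ := hZ
  refine ⟨x, fun g hg => ?_⟩
  obtain ⟨k, hk⟩ := exists_replicate_of_mem_germV hg
  exact Set.mem_iInter.1 hx k g (hk k le_rfl)

theorem exists_mem_nbhdStabilizer_smul_ne_cantor (z y : Cantor) (h : y ≠ z) :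
    ∃ g ∈ nbhdStabilizer thompsonV z, g • y ≠ y := by
  obtain ⟨u, x, rfl, hu⟩ := exists_cylinder_mem_subset (isOpen_compl_singleton.mem_nhds h)
  have hz : ∀ b, z ∉ cylinder (u ++ [b]) := fun b hz =>
    hu (cylinder_append_subset _ _ hz) rfl
  refine ⟨swap (u ++ [x 0]) (u ++ [!x 0]), swap_mem_nbhdStabilizer (hz _) (hz _), ?_⟩
  have hd := disjoint_cylinder_siblings u (x 0)
  rw [← congrArg (prepend u) (prepend_dropPrefix_nil x)]
  generalize dropPrefix [x 0] x = x'
  rw [← prepend_append, swap_smul_left (Or.inr hd)]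
  intro heq
  exact Set.disjoint_left.1 hd (prepend_mem_cylinder _ _) (heq ▸ prepend_mem_cylinder _ _)

instance isMinimal_thompsonV : MulAction.IsMinimal thompsonV Cantor := by
  refine ⟨fun x => dense_iff_inter_open.2 fun O hO ⟨y, hy⟩ => ?_⟩
  obtain ⟨u, y, rfl, hu⟩ := exists_cylinder_mem_subset (hO.mem_nhds hy)
  by_cases hx : x ∈ cylinder u
  · exact ⟨x, hu hx, MulAction.mem_orbit_self x⟩
  · obtain ⟨w, x, rfl, hw⟩ :=
      exists_cylinder_mem_subset ((isClosed_cylinder u).isOpen_compl.mem_nhds hx)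
    refine ⟨swap w u • prepend w x, ?_, MulAction.mem_orbit _ _⟩
    rw [swap_smul_left (Or.inr (Set.disjoint_left.2 fun a ha => hw ha))]
    exact hu (prepend_mem_cylinder _ _)

/-- The group `V` is generated by any two of its germ stabilizers: an element that does not send `z`
to `z'` agrees near `z` with an element trivial near `z'`. -/
theorem nbhdStabilizer_sup_cantor (z z' : Cantor) (hne : z ≠ z') :
    nbhdStabilizer thompsonV z ⊔ nbhdStabilizer thompsonV z' = ⊤ := by
  rw [eq_top_iff]
  set S := nbhdStabilizer thompsonV z ⊔ nbhdStabilizer thompsonV z' with hS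
  -- if `g` does not send `z` to `z'`, some element trivial near `z'` has the same germ at `z`
  have key : ∀ g : thompsonV, g • z ≠ z' → g ∈ S := by
    intro g hg
    obtain ⟨q, hq⟩ : ∃ q, cylinder q ⊆ ({z, g • z, z'} : Set Cantor)ᶜ := by
      have hinf : (({z, g • z, z'} : Set Cantor)ᶜ).Nonempty :=
        (Set.toFinite _).infinite_compl.nonempty
      obtain ⟨y, hy⟩ := hinf
      obtain ⟨q, -, -, hq⟩ := exists_cylinder_mem_subset
        ((Set.toFinite ({z, g • z, z'} : Set Cantor)).isClosed.isOpen_compl.mem_nhds hy)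
      exact ⟨q, hq⟩
    have hzq : z ∉ cylinder q := fun h => hq h (by simp)
    have hgq : g • z ∉ cylinder q := fun h => hq h (by simp)
    have hz'q : z' ∉ cylinder q := fun h => hq h (by simp)
    obtain ⟨N, hN⟩ := replacesPrefixes_smul g
    have hO : (cylinder q)ᶜ ∩ {z'}ᶜ ∈ 𝓝 z :=
      ((isClosed_cylinder q).isOpen_compl.inter isOpen_compl_singleton).mem_nhds ⟨hzq, hne⟩
    have hO' : (g • · : Cantor → Cantor) ⁻¹' ((cylinder q)ᶜ ∩ {z'}ᶜ) ∈ 𝓝 z :=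
      (((isClosed_cylinder q).isOpen_compl.inter isOpen_compl_singleton).preimage
        (continuous_const_smul g)).mem_nhds ⟨hgq, hg⟩
    obtain ⟨M, hM⟩ := exists_cylinder_subset (Filter.inter_mem hO hO')
    obtain ⟨w, y, hw, rfl⟩ := exists_prepend (N + M) z
    have hwM := hM w y (by omega) rfl
    obtain ⟨v, hv⟩ : ∃ v, ∀ y, g • prepend w y = prepend v y := by
      obtain ⟨v, hv⟩ := hN (w.take N) (by simp [hw])
      refine ⟨v ++ w.drop N, fun y => ?_⟩
      conv_lhs => rw [← List.take_append_drop N w]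
      rw [prepend_append, prepend_append]
      exact hv _
    have hwq : Disjoint (cylinder w) (cylinder q) := Set.disjoint_left.2 fun a ha => (hwM ha).1.1
    have hvq : Disjoint (cylinder v) (cylinder q) := Set.disjoint_left.2 fun a ha => by
      obtain ⟨a, rfl⟩ := ha
      rw [← hv]
      exact (hwM (prepend_mem_cylinder w a)).2.1
    have hz'w : z' ∉ cylinder w := fun h => (hwM h).1.2 rfl
    have hz'v : z' ∉ cylinder v := by
      rintro ⟨a, ha⟩
      rw [← hv] at ha
      exact (hwM (prepend_mem_cylinder w a)).2.2 ha
    have h1 : swap q v * swap w q ∈ S := Subgroup.mem_sup_right (Subgroup.mul_mem _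
      (swap_mem_nbhdStabilizer hz'q hz'v) (swap_mem_nbhdStabilizer hz'w hz'q))
    have h2 : (swap q v * swap w q)⁻¹ * g ∈ S := by
      refine Subgroup.mem_sup_left
        (mem_nbhdStabilizer_of_notMem (prepend_mem_cylinder w y) ?_)
      rintro _ ⟨a, rfl⟩
      rw [mul_smul, inv_smul_eq_iff, hv, mul_smul, swap_smul_left (Or.inr hwq),
        swap_smul_left (Or.inr hvq.symm)]
    simpa only [mul_inv_cancel_left] using S.mul_mem h1 h2
  intro g _
  by_cases hg : g • z = z'
  · obtain ⟨s, hs, hsz⟩ := exists_mem_nbhdStabilizer_smul_ne_cantor z z' hne.symm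
    have := key (s * g) (by rw [mul_smul, hg]; exact hsz)
    exact (S.mul_mem_cancel_left (Subgroup.mem_sup_left hs)).1 this
  · exact key g hg

/-- A non-trivial minimal action of `V` on a compact space that is not topologically free has a
unique factor map to the Cantor set, which is determined by germ stabilizers. -/
theorem exists_factorMap_cantor (X : Type*) [TopologicalSpace X] [CompactSpace X] [T2Space X]
    [MulAction thompsonV X] [ContinuousConstSMul thompsonV X] [MulAction.IsMinimal thompsonV X]
    (hnt : IsNontrivialAction thompsonV X) (hfree : ¬ IsTopologicallyFree thompsonV X) :
    ∃ φ : X → Cantor, IsFactorMap thompsonV φ ∧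
      (∀ ψ : X → Cantor, IsFactorMap thompsonV ψ → ψ = φ) ∧
      ∀ (x : X) (z : Cantor),
        nbhdStabilizer thompsonV z ≤ MulAction.stabilizer thompsonV x ↔ z = φ x := by
  obtain ⟨hX, hP⟩ := exists_finset_confining hfree
  obtain ⟨x, hx⟩ := exists_germV_le_stabilizer hP
  exact existsUnique_factorMap hnt nbhdStabilizer_sup_cantor
    exists_mem_nbhdStabilizer_smul_ne_cantor ⟨x, zeroSeq, hx⟩

/-! ### Dyadic rationals -/

/-- The real number `x` is a dyadic rational. -/
def IsDyadic (x : ℝ) : Prop := ∃ (a : ℤ) (n : ℕ), x = a / 2 ^ n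

theorem IsDyadic.exists_eq_div {x : ℝ} (hx : IsDyadic x) :
    ∃ N : ℕ, ∀ n ≥ N, ∃ a : ℤ, x = a / 2 ^ n := by
  obtain ⟨a, N, rfl⟩ := hx
  refine ⟨N, fun n hn => ⟨a * 2 ^ (n - N), ?_⟩⟩
  obtain ⟨m, rfl⟩ := Nat.exists_eq_add_of_le hn
  rw [Nat.add_sub_cancel_left, pow_add]
  push_cast
  field_simp

theorem isDyadic_intCast (a : ℤ) : IsDyadic a := ⟨a, 0, by simp⟩

theorem IsDyadic.add {x y : ℝ} (hx : IsDyadic x) (hy : IsDyadic y) : IsDyadic (x + y) := by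
  obtain ⟨M, hM⟩ := hx.exists_eq_div
  obtain ⟨N, hN⟩ := hy.exists_eq_div
  obtain ⟨a, ha⟩ := hM (max M N) (le_max_left _ _)
  obtain ⟨b, hb⟩ := hN (max M N) (le_max_right _ _)
  exact ⟨a + b, max M N, by rw [ha, hb]; push_cast; ring⟩

theorem IsDyadic.neg {x : ℝ} (hx : IsDyadic x) : IsDyadic (-x) := by
  obtain ⟨a, n, rfl⟩ := hx
  exact ⟨-a, n, by push_cast; ring⟩

theorem IsDyadic.sub {x y : ℝ} (hx : IsDyadic x) (hy : IsDyadic y) : IsDyadic (x - y) :=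
  sub_eq_add_neg x y ▸ hx.add hy.neg

theorem IsDyadic.zpow_mul {x : ℝ} (hx : IsDyadic x) (k : ℤ) : IsDyadic ((2 : ℝ) ^ k * x) := by
  obtain ⟨a, n, rfl⟩ := hx
  rcases k with k | k
  · exact ⟨a * 2 ^ k, n, by
      rw [Int.ofNat_eq_natCast, zpow_natCast]; push_cast; ring⟩
  · exact ⟨a, n + (k + 1), by rw [zpow_negSucc, pow_add]; field_simp; ring⟩

theorem exists_isDyadic_between {x y : ℝ} (h : x < y) : ∃ r, IsDyadic r ∧ x < r ∧ r < y := by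
  obtain ⟨n, hn⟩ := exists_nat_gt (1 / (y - x))
  have hpos : 0 < y - x := sub_pos.2 h
  have hn2 : 1 / (y - x) < 2 ^ n := hn.trans (by exact_mod_cast Nat.lt_two_pow_self)
  have h2 : (0 : ℝ) < 2 ^ n := by positivity
  rw [div_lt_iff₀ hpos] at hn2
  refine ⟨(⌊x * 2 ^ n⌋ + 1 : ℤ) / 2 ^ n, ⟨_, n, rfl⟩, ?_, ?_⟩
  · rw [lt_div_iff₀ h2]
    push_cast
    exact Int.lt_floor_add_one _
  · rw [div_lt_iff₀ h2]
    push_cast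
    have := Int.floor_le (x * 2 ^ n)
    nlinarith

/-! ### Dyadic piecewise linear homeomorphisms of the line -/

/-- An increasing homeomorphism of the line that is piecewise linear with finitely many
breakpoints, all dyadic, with slopes in `2^ℤ`, and that preserves the set of dyadic rationals. -/
structure IsDyadicPL (f : ℝ ≃o ℝ) : Prop where
  piecewise : ∃ B : Set ℝ, B.Finite ∧ (∀ x ∈ B, IsDyadic x) ∧
    ∀ x ∉ B, ∃ k : ℤ, ∀ᶠ t in 𝓝 (0 : ℝ), f (x + t) = f x + (2 : ℝ) ^ k * t
  dyadic : ∀ x, IsDyadic (f x) ↔ IsDyadic x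

theorem tendsto_zpow_mul_zero (k : ℤ) :
    Filter.Tendsto (fun t : ℝ => (2 : ℝ) ^ k * t) (𝓝 0) (𝓝 0) := by
  have : Continuous (fun t : ℝ => (2 : ℝ) ^ k * t) := by fun_prop
  simpa using this.tendsto 0

/-- The group of dyadic piecewise linear homeomorphisms of the line. -/
def dyadicPL : Subgroup (ℝ ≃o ℝ) where
  carrier := {f | IsDyadicPL f}
  one_mem' := ⟨⟨∅, Set.finite_empty, by simp, fun _ _ => ⟨0, by simp⟩⟩, by simp⟩
  mul_mem' := by
    rintro f g ⟨⟨B, hB, hBd, hBa⟩, hf⟩ ⟨⟨C, hC, hCd, hCa⟩, hg⟩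
    refine ⟨⟨C ∪ g ⁻¹' B, hC.union (hB.preimage g.injective.injOn), ?_, ?_⟩, ?_⟩
    · rintro x (hx | hx)
      · exact hCd x hx
      · exact (hg x).1 (hBd _ hx)
    · intro x hx
      simp only [Set.mem_union, Set.mem_preimage, not_or] at hx
      obtain ⟨k, hk⟩ := hCa x hx.1
      obtain ⟨l, hl⟩ := hBa (g x) hx.2
      refine ⟨l + k, ?_⟩
      filter_upwards [hk, (tendsto_zpow_mul_zero k).eventually hl] with t h1 h2
      rw [RelIso.mul_apply, RelIso.mul_apply, h1, h2, zpow_add₀ (by norm_num), mul_assoc]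
    · intro x
      rw [RelIso.mul_apply, hf, hg]
  inv_mem' := by
    rintro f ⟨⟨B, hB, hBd, hBa⟩, hf⟩
    refine ⟨⟨f '' B, hB.image f, ?_, ?_⟩, ?_⟩
    · rintro _ ⟨x, hx, rfl⟩
      exact (hf x).2 (hBd x hx)
    · intro y hy
      obtain ⟨x, rfl⟩ := f.surjective y
      have hx : x ∉ B := fun h => hy ⟨x, h, rfl⟩
      obtain ⟨k, hk⟩ := hBa x hx
      refine ⟨-k, ?_⟩
      filter_upwards [(tendsto_zpow_mul_zero (-k)).eventually hk] with t h1
      have h2 : (2 : ℝ) ^ k * ((2 : ℝ) ^ (-k) * t) = t := by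
        rw [← mul_assoc, ← zpow_add₀ (by norm_num)]
        simp
      rw [h2] at h1
      rw [← h1, RelIso.inv_apply_self, RelIso.inv_apply_self]
    · intro y
      obtain ⟨x, rfl⟩ := f.surjective y
      rw [RelIso.inv_apply_self, hf]

/-- The affine map `x ↦ 2ᵏ x + c`. -/
noncomputable def affineIso (k : ℤ) (c : ℝ) : ℝ ≃o ℝ :=
  (OrderIso.mulLeft₀ ((2 : ℝ) ^ k) (by positivity)).trans (OrderIso.addRight c)

theorem affineIso_apply (k : ℤ) (c x : ℝ) : affineIso k c x = (2 : ℝ) ^ k * x + c := rfl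

theorem affineIso_mem (k : ℤ) {c : ℝ} (hc : IsDyadic c) : affineIso k c ∈ dyadicPL := by
  refine ⟨⟨∅, Set.finite_empty, by simp, fun x _ => ⟨k, Filter.Eventually.of_forall fun t => ?_⟩⟩,
    fun x => ⟨fun h => ?_, fun h => ?_⟩⟩
  · simp only [affineIso_apply]
    ring
  · rw [affineIso_apply] at h
    have := (h.sub hc).zpow_mul (-k)
    rwa [add_sub_cancel_right, ← mul_assoc, ← zpow_add₀ (by norm_num), neg_add_cancel, zpow_zero,
      one_mul] at this
  · rw [affineIso_apply]
    exact (h.zpow_mul k).add hc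

/-- Two dyadic piecewise linear maps that agree at a dyadic point can be glued there. -/
theorem exists_glue {f g : ℝ ≃o ℝ} (hf : f ∈ dyadicPL) (hg : g ∈ dyadicPL) {a : ℝ}
    (ha : IsDyadic a) (h : f a = g a) :
    ∃ φ ∈ dyadicPL, (∀ x ≤ a, φ x = f x) ∧ ∀ x ≥ a, φ x = g x := by
  let F : ℝ → ℝ := fun x => if x ≤ a then f x else g x
  have hFl : ∀ x ≤ a, F x = f x := fun x hx => if_pos hx
  have hFr : ∀ x ≥ a, F x = g x := fun x hx => by
    rcases hx.lt_or_eq with hx | hx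
    · exact if_neg (not_le.2 hx)
    · rw [← hx, ← h]
      exact if_pos le_rfl
  have hmono : StrictMono F := by
    intro x y hxy
    rcases le_total y a with hy | hy
    · rw [hFl x (hxy.le.trans hy), hFl y hy]
      exact f.strictMono hxy
    · rcases le_total x a with hx | hx
      · rw [hFl x hx, hFr y hy]
        rcases hx.lt_or_eq with hx' | rfl
        · exact (f.strictMono hx').trans_le (h ▸ g.monotone hy)
        · rw [h]
          exact g.strictMono hxy
      · rw [hFr x hx, hFr y hy]
        exact g.strictMono hxy
  have hsurj : Function.Surjective F := by
    intro y
    rcases le_total y (f a) with hy | hy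
    · exact ⟨f.symm y, by rw [hFl _ (f.symm_apply_le.2 hy), f.apply_symm_apply]⟩
    · exact ⟨g.symm y, by rw [hFr _ (g.le_symm_apply.2 (h ▸ hy)), g.apply_symm_apply]⟩
  refine ⟨hmono.orderIsoOfSurjective F hsurj, ?_, hFl, hFr⟩
  obtain ⟨⟨B, hB, hBd, hBa⟩, hfd⟩ := hf
  obtain ⟨⟨C, hC, hCd, hCa⟩, hgd⟩ := hg
  refine ⟨⟨insert a (B ∪ C), (hB.union hC).insert a, ?_, fun x hx => ?_⟩, fun x => ?_⟩
  · rintro x (rfl | hx | hx)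
    · exact ha
    · exact hBd x hx
    · exact hCd x hx
  · simp only [Set.mem_insert_iff, Set.mem_union, not_or] at hx
    have hc : Filter.Tendsto (fun t : ℝ => x + t) (𝓝 0) (𝓝 x) := by
      have : Continuous (fun t : ℝ => x + t) := by fun_prop
      simpa using this.tendsto 0
    simp only [StrictMono.coe_orderIsoOfSurjective]
    rcases lt_or_gt_of_ne hx.1 with hxa | hxa
    · obtain ⟨k, hk⟩ := hBa x hx.2.1
      refine ⟨k, ?_⟩
      filter_upwards [hk, hc.eventually (eventually_lt_nhds hxa)] with t h1 h2
      rw [hFl _ h2.le, hFl x hxa.le, h1]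
    · obtain ⟨k, hk⟩ := hCa x hx.2.2
      refine ⟨k, ?_⟩
      filter_upwards [hk, hc.eventually (eventually_gt_nhds hxa)] with t h1 h2
      rw [hFr _ (le_of_lt h2), hFr x (le_of_lt hxa), h1]
  · simp only [StrictMono.coe_orderIsoOfSurjective]
    rcases le_total x a with hx | hx
    · rw [hFl x hx, hfd]
    · rw [hFr x hx, hgd]

theorem exists_map_zero_one (m : ℕ) :
    ∃ f ∈ dyadicPL, f 0 = 0 ∧ f 1 = (m + 1 : ℕ) := by
  induction m with
  | zero => exact ⟨1, dyadicPL.one_mem, rfl, by simp⟩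
  | succ m ih =>
    obtain ⟨f, hf, h0, h1⟩ := ih
    -- doubling on `[0, 1]` and translation afterwards
    have hd : IsDyadic 0 := by exact_mod_cast isDyadic_intCast 0
    have hd1 : IsDyadic 1 := by exact_mod_cast isDyadic_intCast 1
    obtain ⟨φ, hφ, hl, hr⟩ := exists_glue (affineIso_mem 1 hd) (affineIso_mem 0 hd1) hd1
      (by norm_num [affineIso_apply])
    refine ⟨φ * f, dyadicPL.mul_mem hφ hf, ?_, ?_⟩
    · rw [RelIso.mul_apply, h0, hl 0 zero_le_one, affineIso_apply]
      norm_num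
    · rw [RelIso.mul_apply, h1, hr _ (by push_cast; linarith [(Nat.cast_nonneg m : (0:ℝ) ≤ m)]),
        affineIso_apply]
      push_cast
      norm_num

/-- Dyadic intervals are all the same for dyadic piecewise linear maps. -/
theorem exists_map_interval {a b c d : ℝ} (ha : IsDyadic a) (hb : IsDyadic b) (hab : a < b)
    (hc : IsDyadic c) (hd : IsDyadic d) (hcd : c < d) :
    ∃ f ∈ dyadicPL, f a = c ∧ f b = d := by
  have key : ∀ a b : ℝ, IsDyadic a → IsDyadic b → a < b → ∃ f ∈ dyadicPL, f 0 = a ∧ f 1 = b := by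
    intro a b ha hb hab
    obtain ⟨z, n, hz⟩ := hb.sub ha
    have hpos : 0 < z := by
      have h1 : (0 : ℝ) < z / 2 ^ n := hz ▸ sub_pos.2 hab
      have h2 : (0 : ℝ) < z := (div_pos_iff_of_pos_right (by positivity)).1 h1
      exact_mod_cast h2
    obtain ⟨m, rfl⟩ : ∃ m : ℕ, z = (m + 1 : ℕ) := ⟨(z - 1).toNat, by omega⟩
    obtain ⟨f, hf, h0, h1⟩ := exists_map_zero_one m
    refine ⟨affineIso (-n) a * f, dyadicPL.mul_mem (affineIso_mem _ ha) hf, ?_, ?_⟩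
    · rw [RelIso.mul_apply, h0, affineIso_apply]
      simp
    · rw [RelIso.mul_apply, h1, affineIso_apply, zpow_neg, zpow_natCast, ← div_eq_inv_mul]
      rw [Int.cast_natCast] at hz
      rw [← hz]
      ring
  obtain ⟨f, hf, h0, h1⟩ := key a b ha hb hab
  obtain ⟨g, hg, h0', h1'⟩ := key c d hc hd hcd
  refine ⟨g * f⁻¹, dyadicPL.mul_mem hg (dyadicPL.inv_mem hf), ?_, ?_⟩
  · rw [RelIso.mul_apply, ← h0, RelIso.inv_apply_self, h0']
  · rw [RelIso.mul_apply, ← h1, RelIso.inv_apply_self, h1']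

/-- The dyadic piecewise linear homeomorphisms with compact support in the interval `(a, b)`. -/
def compactPL (a b : ℝ) : Subgroup (ℝ ≃o ℝ) where
  carrier := {f | f ∈ dyadicPL ∧ ∃ ε > 0, ∀ x, x ≤ a + ε ∨ b - ε ≤ x → f x = x}
  one_mem' := ⟨dyadicPL.one_mem, 1, one_pos, fun _ _ => rfl⟩
  mul_mem' := by
    rintro f g ⟨hf, ε, hε, hfε⟩ ⟨hg, δ, hδ, hgδ⟩
    refine ⟨dyadicPL.mul_mem hf hg, min ε δ, lt_min hε hδ, fun x hx => ?_⟩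
    have h1 := min_le_left ε δ
    have h2 := min_le_right ε δ
    rw [RelIso.mul_apply, hgδ x (hx.imp (fun h => by linarith) fun h => by linarith),
      hfε x (hx.imp (fun h => by linarith) fun h => by linarith)]
  inv_mem' := by
    rintro f ⟨hf, ε, hε, hfε⟩
    refine ⟨dyadicPL.inv_mem hf, ε, hε, fun x hx => ?_⟩
    have := RelIso.inv_apply_self f x
    rwa [hfε x hx] at this

/-- A dyadic piecewise linear map that sends a compact subinterval of `(a, b)` into `(a, b)`
agrees on it with a map with compact support in `(a, b)`. -/
theorem exists_extend {a b c d : ℝ} {φ : ℝ ≃o ℝ} (hφ : φ ∈ dyadicPL) (hc : IsDyadic c)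
    (hd : IsDyadic d) (hac : a < c) (hcd : c < d) (hdb : d < b) (hac' : a < φ c)
    (hdb' : φ d < b) :
    ∃ h ∈ compactPL a b, ∀ x, c ≤ x → x ≤ d → h x = φ x := by
  obtain ⟨a', ha', haa', hlt⟩ := exists_isDyadic_between (lt_min hac hac')
  obtain ⟨b', hb', hlt', hbb'⟩ := exists_isDyadic_between (max_lt hdb hdb')
  rw [lt_min_iff] at hlt
  rw [max_lt_iff] at hlt'
  have hφc : IsDyadic (φ c) := (hφ.2 c).2 hc
  have hφd : IsDyadic (φ d) := (hφ.2 d).2 hd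
  obtain ⟨l, hl, hla, hlc⟩ := exists_map_interval ha' hc hlt.1 ha' hφc hlt.2
  obtain ⟨r, hr, hrd, hrb⟩ := exists_map_interval hd hb' hlt'.1 hφd hb' hlt'.2
  obtain ⟨h₁, hh₁, h₁l, h₁r⟩ := exists_glue dyadicPL.one_mem hl ha' (by rw [hla]; rfl)
  obtain ⟨h₂, hh₂, h₂l, h₂r⟩ := exists_glue hh₁ hφ hc (by rw [h₁r c hlt.1.le, hlc])
  obtain ⟨h₃, hh₃, h₃l, h₃r⟩ := exists_glue hh₂ hr hd (by rw [h₂r d hcd.le, hrd])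
  obtain ⟨h₄, hh₄, h₄l, h₄r⟩ := exists_glue hh₃ dyadicPL.one_mem hb' (by
    rw [h₃r b' hlt'.1.le, hrb]; rfl)
  refine ⟨h₄, ⟨hh₄, min (a' - a) (b - b'), lt_min (by linarith) (by linarith), ?_⟩, ?_⟩
  · have h1 := min_le_left (a' - a) (b - b')
    have h2 := min_le_right (a' - a) (b - b')
    rintro x (hx | hx)
    · rw [h₄l x (by linarith), h₃l x (by linarith), h₂l x (by linarith), h₁l x (by linarith)]
      rfl
    · rw [h₄r x (by linarith)]
      rfl
  · intro x hx hx'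
    rw [h₄l x (by linarith), h₃l x hx', h₂r x hx]

/-- A dyadic piecewise linear map is affine on every interval without breakpoints. -/
theorem exists_affine_of_locally_affine {f : ℝ ≃o ℝ} (hf : f ∈ dyadicPL) {p q : ℝ} (hpq : p < q)
    (hp : IsDyadic p)
    (h : ∀ x ∈ Set.Ioo p q, ∃ k : ℤ, ∀ᶠ t in 𝓝 (0 : ℝ), f (x + t) = f x + (2 : ℝ) ^ k * t) :
    ∃ (k : ℤ) (c : ℝ), IsDyadic c ∧ ∀ x ∈ Set.Icc p q, f x = (2 : ℝ) ^ k * x + c := by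
  have h' : ∀ x ∈ Set.Ioo p q, ∃ k : ℤ, ∀ᶠ y in 𝓝 x, f y = f x + (2 : ℝ) ^ k * (y - x) := by
    intro x hx
    obtain ⟨k, hk⟩ := h x hx
    refine ⟨k, ?_⟩
    have hc : Filter.Tendsto (fun y : ℝ => y - x) (𝓝 x) (𝓝 0) := by
      have : Continuous (fun y : ℝ => y - x) := by fun_prop
      simpa using this.tendsto x
    filter_upwards [hc.eventually hk] with y hy
    rwa [add_sub_cancel] at hy
  have hderiv : ∀ x ∈ Set.Ioo p q, ∀ k : ℤ, (∀ᶠ y in 𝓝 x, f y = f x + (2 : ℝ) ^ k * (y - x)) →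
      HasDerivAt f ((2 : ℝ) ^ k) x := by
    intro x _ k hk
    have : HasDerivAt (fun y => f x + (2 : ℝ) ^ k * (y - x)) ((2 : ℝ) ^ k) x := by
      simpa using (((hasDerivAt_id x).sub_const x).const_mul ((2 : ℝ) ^ k)).const_add (f x)
    exact this.congr_of_eventuallyEq hk
  have hlc : ∀ x ∈ Set.Ioo p q, ∀ᶠ y in 𝓝 x, deriv f y = deriv f x := by
    intro x hx
    obtain ⟨k, hk⟩ := h' x hx
    rw [(hderiv x hx k hk).deriv]
    filter_upwards [hk.eventually_nhds] with y hy
    have : HasDerivAt (fun y => f x + (2 : ℝ) ^ k * (y - x)) ((2 : ℝ) ^ k) y := by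
      simpa using (((hasDerivAt_id y).sub_const x).const_mul ((2 : ℝ) ^ k)).const_add (f x)
    exact (this.congr_of_eventuallyEq hy).deriv
  have hmid : (p + q) / 2 ∈ Set.Ioo p q := ⟨by linarith, by linarith⟩
  obtain ⟨k, hk⟩ := h' _ hmid
  have hconst : ∀ x ∈ Set.Ioo p q, deriv f x = (2 : ℝ) ^ k := by
    intro x hx
    have h0 : ∀ x ∈ Set.Ioo p q, HasDerivAt (deriv f) 0 x := fun x hx =>
      (hasDerivAt_const x (deriv f x)).congr_of_eventuallyEq (hlc x hx)
    have := isOpen_Ioo.is_const_of_deriv_eq_zero (isPreconnected_Ioo)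
      (fun x hx => (h0 x hx).differentiableAt.differentiableWithinAt)
      (fun x hx => (h0 x hx).deriv) hx hmid
    rw [this, (hderiv _ hmid k hk).deriv]
  let c := f ((p + q) / 2) - (2 : ℝ) ^ k * ((p + q) / 2)
  have hIoo : ∀ x ∈ Set.Ioo p q, f x = (2 : ℝ) ^ k * x + c := by
    intro x hx
    have h0 : ∀ x ∈ Set.Ioo p q, HasDerivAt (fun y => f y - (2 : ℝ) ^ k * y) 0 x := by
      intro x hx
      obtain ⟨l, hl⟩ := h' x hx
      have h1 := hderiv x hx l hl
      have h2 := hconst x hx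
      rw [h1.deriv] at h2
      have := h1.sub ((hasDerivAt_id x).const_mul ((2 : ℝ) ^ k))
      rw [h2, mul_one, sub_self] at this
      exact this
    have := isOpen_Ioo.is_const_of_deriv_eq_zero (isPreconnected_Ioo)
      (fun x hx => (h0 x hx).differentiableAt.differentiableWithinAt)
      (fun x hx => (h0 x hx).deriv) hx hmid
    simp only [c]
    linarith
  have hIcc : ∀ x ∈ Set.Icc p q, f x = (2 : ℝ) ^ k * x + c := by
    have : Set.EqOn f (fun x => (2 : ℝ) ^ k * x + c) (closure (Set.Ioo p q)) :=
      Set.EqOn.closure hIoo f.continuous (by fun_prop)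
    rw [closure_Ioo hpq.ne] at this
    exact this
  refine ⟨k, c, ?_, hIcc⟩
  have h1 := hIcc p ⟨le_rfl, hpq.le⟩
  have h2 := ((hf.2 p).2 hp).sub (hp.zpow_mul k)
  rw [h1, add_sub_cancel_left] at h2
  exact h2

/-- A dyadic piecewise linear map of `[0, 1]` sends the cells of a fine uniform dyadic subdivision
to standard dyadic intervals. -/
theorem exists_standard_cells {f : ℝ ≃o ℝ} (hf : f ∈ dyadicPL) (h0 : f 0 = 0) :
    ∃ N : ℕ, ∀ i : ℕ, i < 2 ^ N → ∃ d j : ℕ, ∀ t ∈ Set.Icc (0 : ℝ) 1,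
      f ((i + t) / 2 ^ N) = (j + t) / 2 ^ d := by
  obtain ⟨B, hB, hBd, hBa⟩ := hf.1
  obtain ⟨N₀, hN₀⟩ : ∃ N₀ : ℕ, ∀ b ∈ B, ∃ a : ℤ, b = a / 2 ^ N₀ := by
    have : ∀ᶠ N in Filter.atTop, ∀ b ∈ B, ∃ a : ℤ, b = a / 2 ^ N := by
      rw [Filter.eventually_all_finite hB]
      intro b hb
      obtain ⟨M, hM⟩ := (hBd b hb).exists_eq_div
      exact Filter.eventually_atTop.2 ⟨M, hM⟩
    exact this.exists
  have haff : ∀ i : ℕ, ∃ (k : ℤ) (c : ℝ), IsDyadic c ∧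
      ∀ x ∈ Set.Icc ((i : ℝ) / 2 ^ N₀) ((i + 1) / 2 ^ N₀), f x = (2 : ℝ) ^ k * x + c := by
    intro i
    refine exists_affine_of_locally_affine hf ?_ ⟨i, N₀, by simp⟩ fun x hx => hBa x fun hxB => ?_
    · gcongr
      linarith
    · obtain ⟨a, rfl⟩ := hN₀ x hxB
      have h2 : (0 : ℝ) < 2 ^ N₀ := by positivity
      rw [Set.mem_Ioo, div_lt_div_iff_of_pos_right h2, div_lt_div_iff_of_pos_right h2] at hx
      have h3 : (i : ℤ) < a := by exact_mod_cast hx.1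
      have h4 : a < (i : ℤ) + 1 := by exact_mod_cast hx.2
      omega
  choose k c hc hkc using haff
  -- a subdivision so fine that all translation parts become integers at the image scale
  have hev : ∀ᶠ N : ℕ in Filter.atTop, N₀ ≤ N ∧ ∀ i < 2 ^ N₀, ∃ (d : ℕ) (z : ℤ),
      (d : ℤ) = N - k i ∧ c i = z / 2 ^ d := by
    refine (Filter.eventually_ge_atTop N₀).and ?_
    have : ∀ᶠ N : ℕ in Filter.atTop, ∀ i ∈ Finset.range (2 ^ N₀), ∃ (d : ℕ) (z : ℤ),
        (d : ℤ) = N - k i ∧ c i = z / 2 ^ d := by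
      rw [Filter.eventually_all_finset]
      intro i _
      obtain ⟨M, hM⟩ := (hc i).exists_eq_div
      refine Filter.eventually_atTop.2 ⟨M + (k i).toNat, fun N hN => ?_⟩
      obtain ⟨z, hz⟩ := hM (N - k i).toNat (by omega)
      exact ⟨(N - k i).toNat, z, by omega, hz⟩
    simpa using this
  obtain ⟨N, hN, hcell⟩ := hev.exists
  obtain ⟨M, rfl⟩ := Nat.exists_eq_add_of_le hN
  refine ⟨N₀ + M, fun i hi => ?_⟩
  have hM : 0 < 2 ^ M := by positivity
  obtain ⟨d, z, hd, hz⟩ := hcell (i / 2 ^ M) (by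
    rw [Nat.div_lt_iff_lt_mul hM, ← pow_add]
    exact hi)
  have hval : ∀ t ∈ Set.Icc (0 : ℝ) 1, f ((i + t) / 2 ^ (N₀ + M)) = (i + z + t) / 2 ^ d := by
    intro t ht
    have h2 : (0 : ℝ) < 2 ^ N₀ := by positivity
    have h2M : (0 : ℝ) < 2 ^ M := by positivity
    have hl : (((i / 2 ^ M : ℕ) : ℝ)) * 2 ^ M ≤ i := by exact_mod_cast Nat.div_mul_le_self i (2 ^ M)
    have hr : (i : ℝ) + 1 ≤ ((i / 2 ^ M : ℕ) + 1) * 2 ^ M := by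
      have := Nat.lt_div_mul_add (a := i) hM
      have h5 : i + 1 ≤ (i / 2 ^ M + 1) * 2 ^ M := by rw [add_mul, one_mul]; exact this
      exact_mod_cast h5
    rw [hkc (i / 2 ^ M) _ ⟨?_, ?_⟩, hz]
    · have hk : k (i / 2 ^ M) = ((N₀ + M : ℕ) : ℤ) - d := by omega
      rw [hk, zpow_sub₀ (by norm_num), zpow_natCast, zpow_natCast]
      have h3 : (2 : ℝ) ^ (N₀ + M) ≠ 0 := by positivity
      field_simp
      ring
    · rw [pow_add, div_le_div_iff₀ h2 (by positivity)]
      nlinarith [ht.1]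
    · rw [pow_add, div_le_div_iff₀ (by positivity) h2]
      nlinarith [ht.2]
  have hnonneg : 0 ≤ (i : ℤ) + z := by
    have h1 : (0 : ℝ) ≤ f ((i + 0) / 2 ^ (N₀ + M)) := by
      rw [← h0]
      exact f.monotone (by positivity)
    rw [hval 0 ⟨le_rfl, zero_le_one⟩, add_zero] at h1
    have h2 : (0 : ℝ) ≤ i + z := by
      by_contra hneg
      exact absurd h1 (not_le.2 (div_neg_of_neg_of_pos (not_le.1 hneg) (by positivity)))
    exact_mod_cast h2
  refine ⟨d, ((i : ℤ) + z).toNat, fun t ht => ?_⟩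
  rw [hval t ht]
  have : ((((i : ℤ) + z).toNat : ℕ) : ℝ) = i + z := by
    have := Int.toNat_of_nonneg hnonneg
    exact_mod_cast this
  rw [this]

/-! ### Generation of Thompson's group `F` on the unit interval -/

/-- The piecewise linear map from `[0, m + 1]` to `[0, 1]` that sends the unit cells, in order,
to the intervals of lengths `1/2, 1/4, …, 1/2ᵐ, 1/2ᵐ`. -/
noncomputable def comb : ℕ → ℝ → ℝ
  | 0, x => x
  | m + 1, x => if x ≤ 1 then x / 2 else 1 / 2 + comb m (x - 1) / 2

theorem comb_mem_Icc (m : ℕ) : ∀ x ∈ Set.Icc (0 : ℝ) (m + 1), comb m x ∈ Set.Icc (0 : ℝ) 1 := by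
  induction m with
  | zero => intro x hx; simpa [comb] using hx
  | succ m ih =>
    intro x hx
    rw [comb]
    split_ifs with h
    · exact ⟨by linarith [hx.1], by linarith⟩
    · have hx2 := hx.2
      push_cast at hx2
      have := ih (x - 1) ⟨by linarith, by linarith⟩
      exact ⟨by linarith [this.1], by linarith [this.2]⟩

theorem comb_zero_right (m : ℕ) : comb m 0 = 0 := by
  cases m <;> simp [comb]

/-- The map `x ↦ x / 2`. -/
noncomputable def leftHalf : ℝ ≃o ℝ := affineIso (-1) 0

/-- The map `x ↦ (1 + x) / 2`. -/
noncomputable def rightHalf : ℝ ≃o ℝ := affineIso (-1) (1 / 2)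

theorem leftHalf_apply (x : ℝ) : leftHalf x = x / 2 := by
  rw [leftHalf, affineIso_apply]; norm_num; ring

theorem rightHalf_apply (x : ℝ) : rightHalf x = 1 / 2 + x / 2 := by
  rw [rightHalf, affineIso_apply]; norm_num; ring

theorem leftHalf_inv_apply (x : ℝ) : leftHalf⁻¹ x = 2 * x := by
  apply leftHalf.injective
  rw [RelIso.apply_inv_self, leftHalf_apply]; ring

theorem rightHalf_inv_apply (x : ℝ) : rightHalf⁻¹ x = 2 * x - 1 := by
  apply rightHalf.injective
  rw [RelIso.apply_inv_self, rightHalf_apply]; ring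

theorem leftHalf_mem : leftHalf ∈ dyadicPL := affineIso_mem _ ⟨0, 0, by simp⟩

theorem rightHalf_mem : rightHalf ∈ dyadicPL := affineIso_mem _ ⟨1, 1, by simp⟩

theorem conj_leftHalf_apply (f : ℝ ≃o ℝ) (x : ℝ) :
    (leftHalf * f * leftHalf⁻¹) x = f (2 * x) / 2 := by
  rw [RelIso.mul_apply, RelIso.mul_apply, leftHalf_inv_apply, leftHalf_apply]

theorem conj_rightHalf_apply (f : ℝ ≃o ℝ) (x : ℝ) :
    (rightHalf * f * rightHalf⁻¹) x = 1 / 2 + f (2 * x - 1) / 2 := by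
  rw [RelIso.mul_apply, RelIso.mul_apply, rightHalf_inv_apply, rightHalf_apply]

/-- The standard generator of Thompson's group `F`. -/
theorem exists_generator : ∃ A ∈ dyadicPL, (∀ x ≤ 0, A x = x) ∧
    (∀ x, 0 ≤ x → x ≤ 1 / 2 → A x = x / 2) ∧
    (∀ x, 1 / 2 ≤ x → x ≤ 3 / 4 → A x = x - 1 / 4) ∧
    (∀ x, 3 / 4 ≤ x → x ≤ 1 → A x = 2 * x - 1) ∧ ∀ x, 1 ≤ x → A x = x := by
  have d0 : IsDyadic 0 := ⟨0, 0, by simp⟩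
  have d1 : IsDyadic 1 := ⟨1, 0, by simp⟩
  have d2 : IsDyadic (1 / 2) := ⟨1, 1, by simp⟩
  have d3 : IsDyadic (3 / 4) := ⟨3, 2, by norm_num⟩
  have d4 : IsDyadic (-(1 / 4)) := ⟨-1, 2, by norm_num⟩
  obtain ⟨h₁, hh₁, h₁l, h₁r⟩ := exists_glue dyadicPL.one_mem (affineIso_mem (-1) d0) d0
    (by simp [affineIso_apply])
  obtain ⟨h₂, hh₂, h₂l, h₂r⟩ := exists_glue hh₁ (affineIso_mem 0 d4) d2
    (by rw [h₁r _ (by norm_num)]; norm_num [affineIso_apply])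
  obtain ⟨h₃, hh₃, h₃l, h₃r⟩ := exists_glue hh₂ (affineIso_mem 1 d1.neg) d3
    (by rw [h₂r _ (by norm_num)]; norm_num [affineIso_apply])
  obtain ⟨h₄, hh₄, h₄l, h₄r⟩ := exists_glue hh₃ dyadicPL.one_mem d1
    (by rw [h₃r _ (by norm_num)]; norm_num [affineIso_apply])
  refine ⟨h₄, hh₄, fun x hx => ?_, fun x hx hx' => ?_, fun x hx hx' => ?_, fun x hx hx' => ?_,
    fun x hx => h₄r x hx⟩
  · rw [h₄l x (by linarith), h₃l x (by linarith), h₂l x (by linarith), h₁l x hx]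
    rfl
  · rw [h₄l x (by linarith), h₃l x (by linarith), h₂l x (by linarith), h₁r x hx, affineIso_apply]
    norm_num
    ring
  · rw [h₄l x (by linarith), h₃l x (by linarith), h₂r x hx, affineIso_apply]
    norm_num
    ring
  · rw [h₄l x (by linarith), h₃r x (by linarith), affineIso_apply]
    norm_num
    ring

section generation

variable {K : Subgroup (ℝ ≃o ℝ)} (hK : ∀ f ∈ K, ∀ x, x ≤ 0 ∨ 1 ≤ x → f x = x)
  (hsum : ∀ f ∈ K, ∀ g ∈ K, leftHalf * f * leftHalf⁻¹ * (rightHalf * g * rightHalf⁻¹) ∈ K)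
  {A : ℝ ≃o ℝ} (hA : A ∈ K)
  (hA1 : ∀ x, 0 ≤ x → x ≤ 1 / 2 → A x = x / 2)
  (hA2 : ∀ x, 1 / 2 ≤ x → x ≤ 3 / 4 → A x = x - 1 / 4)
  (hA3 : ∀ x, 3 / 4 ≤ x → x ≤ 1 → A x = 2 * x - 1)

include hK in
theorem sum_apply_left {f g : ℝ ≃o ℝ} (hg : g ∈ K) {x : ℝ} (hx' : x ≤ 1) :
    (leftHalf * f * leftHalf⁻¹ * (rightHalf * g * rightHalf⁻¹)) (x / 2) = f x / 2 := by
  rw [RelIso.mul_apply (leftHalf * f * leftHalf⁻¹), conj_rightHalf_apply, conj_leftHalf_apply,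
    hK g hg _ (Or.inl (by linarith))]
  ring_nf

include hK in
theorem sum_apply_right {f g : ℝ ≃o ℝ} (hf : f ∈ K) (hg : g ∈ K) {x : ℝ} (hx : 0 ≤ x) :
    (leftHalf * f * leftHalf⁻¹ * (rightHalf * g * rightHalf⁻¹)) (1 / 2 + x / 2) =
      1 / 2 + g x / 2 := by
  have h1 : 0 ≤ g x := by
    rw [← hK g hg 0 (Or.inl le_rfl)]
    exact g.monotone hx
  have h2 : 2 * (1 / 2 + x / 2) - 1 = x := by ring
  rw [RelIso.mul_apply (leftHalf * f * leftHalf⁻¹), conj_rightHalf_apply, conj_leftHalf_apply, h2,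
    hK f hf _ (Or.inr (by linarith))]
  ring

include hK hsum hA hA1 hA2 hA3 in
/-- Placing two combs side by side gives a comb up to an element of `K`. This is the rotation of
binary trees, which the generator `A` performs. -/
theorem exists_join_comb (i : ℕ) : ∀ j : ℕ, ∃ k ∈ K, ∀ x ∈ Set.Icc (0 : ℝ) (i + j + 2),
    (x ≤ i + 1 → comb i x / 2 = k (comb (i + j + 1) x)) ∧
    (i + 1 ≤ x → 1 / 2 + comb j (x - (i + 1)) / 2 = k (comb (i + j + 1) x)) := by
  induction i with
  | zero =>
    intro j
    refine ⟨1, K.one_mem, fun x hx => ⟨fun h => ?_, fun h => ?_⟩⟩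
    · have h1 : x ≤ 1 := by simpa using h
      rw [Nat.zero_add, comb, comb, if_pos h1]
      rfl
    · have h1 : 1 ≤ x := by simpa using h
      rw [Nat.zero_add, comb]
      split_ifs with h2
      · have : x = 1 := le_antisymm h2 h1
        subst this
        simp [comb_zero_right]
      · simp
  | succ i ih =>
    intro j
    obtain ⟨k, hk, hkx⟩ := ih j
    have hs := hsum 1 K.one_mem k hk
    refine ⟨A * (leftHalf * 1 * leftHalf⁻¹ * (rightHalf * k * rightHalf⁻¹)), K.mul_mem hA hs,
      fun x hx => ?_⟩
    obtain ⟨hx0, hx2⟩ := hx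
    push_cast at hx2 ⊢
    have hi : (0 : ℝ) ≤ i := Nat.cast_nonneg i
    have hj : (0 : ℝ) ≤ j := Nat.cast_nonneg j
    have hcomb : comb (i + 1 + j + 1) x =
        if x ≤ 1 then x / 2 else 1 / 2 + comb (i + j + 1) (x - 1) / 2 := by
      rw [show i + 1 + j + 1 = (i + j + 1) + 1 by omega, comb]
    rw [RelIso.mul_apply A, hcomb]
    rcases le_or_gt x 1 with h1 | h1
    · rw [if_pos h1, sum_apply_left hK hk h1, RelIso.one_apply,
        hA1 _ (by linarith) (by linarith)]
      refine ⟨fun _ => ?_, fun h => ?_⟩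
      · rw [comb, if_pos h1]
      · have hi0 : (i : ℝ) = 0 := by linarith
        linarith
    · have hc := comb_mem_Icc (i + j + 1) (x - 1)
        ⟨by linarith, by push_cast; linarith⟩
      rw [if_neg (not_le.2 h1), sum_apply_right hK K.one_mem hk hc.1]
      obtain ⟨hl, hr⟩ := hkx (x - 1) ⟨by linarith, by linarith⟩
      refine ⟨fun h => ?_, fun h => ?_⟩
      · have hc' := comb_mem_Icc i (x - 1) ⟨by linarith, by linarith⟩
        rw [← hl (by linarith), hA2 _ (by linarith [hc'.1]) (by linarith [hc'.2]), comb,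
          if_neg (not_le.2 h1)]
        ring
      · have hc' := comb_mem_Icc j (x - 1 - (i + 1)) ⟨by linarith, by linarith⟩
        rw [← hr (by linarith), hA3 _ (by linarith [hc'.1]) (by linarith [hc'.2])]
        have : x - (i + 1 + 1) = x - 1 - (i + 1) := by ring
        rw [this]
        ring

include hK hsum hA hA1 hA2 hA3 in
/-- A map from `[0, m + 1]` to `[0, 1]` that sends the unit cells to standard dyadic intervals is
a comb up to an element of `K`. -/
theorem exists_eq_comb (n : ℕ) : ∀ (m : ℕ) (g : ℝ → ℝ), StrictMono g → g 0 = 0 → g (m + 1) = 1 →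
    (∀ i ≤ m, ∃ d < n, ∃ j : ℕ, ∀ t ∈ Set.Icc (0 : ℝ) 1, g (i + t) = (j + t) / 2 ^ d) →
    ∃ k ∈ K, ∀ x ∈ Set.Icc (0 : ℝ) (m + 1), g x = k (comb m x) := by
  have t0 : (0 : ℝ) ∈ Set.Icc (0 : ℝ) 1 := ⟨le_rfl, zero_le_one⟩
  have t1 : (1 : ℝ) ∈ Set.Icc (0 : ℝ) 1 := ⟨zero_le_one, le_rfl⟩
  induction n with
  | zero =>
    intro m g _ _ _ h
    obtain ⟨d, hd, -⟩ := h 0 (Nat.zero_le m)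
    exact absurd hd (Nat.not_lt_zero d)
  | succ n ih =>
    intro m g hg g0 g1 h
    classical
    -- the last cell that starts at or before the midpoint
    let i := Nat.findGreatest (fun i : ℕ => g i ≤ 1 / 2) m
    have him : i ≤ m := Nat.findGreatest_le m
    have hi : g i ≤ 1 / 2 := Nat.findGreatest_spec (P := fun i : ℕ => g i ≤ 1 / 2)
      (Nat.zero_le m) (by rw [Nat.cast_zero, g0]; norm_num)
    have hi' : 1 / 2 < g (i + 1) := by
      rcases him.lt_or_eq with hlt | heq
      · have := Nat.findGreatest_is_greatest (P := fun i : ℕ => g i ≤ 1 / 2)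
          (Nat.lt_succ_self i) hlt
        push_cast at this
        exact not_le.1 this
      · rw [heq, g1]
        norm_num
    obtain ⟨d, -, j, hj⟩ := h i him
    have hj0 := hj 0 t0
    have hj1 := hj 1 t1
    rw [add_zero, add_zero] at hj0
    rcases d with _ | d
    · -- a cell of depth `0` is the whole interval, so that there is only one cell
      rw [hj0, pow_zero, div_one] at hi
      rw [pow_zero, div_one] at hj0 hj1
      have hj00 : j = 0 := by
        by_contra hne
        have : (1 : ℝ) ≤ j := by exact_mod_cast Nat.one_le_iff_ne_zero.2 hne
        linarith
      rw [hj00, Nat.cast_zero] at hj0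
      have hi0 : i = 0 := by
        have := hg.injective (hj0.trans g0.symm)
        exact_mod_cast this
      rw [hj00, Nat.cast_zero, zero_add] at hj1
      have hm0 : m = 0 := by
        have := hg.injective (hj1.trans g1.symm)
        rw [hi0, Nat.cast_zero] at this
        have : (m : ℝ) = 0 := by linarith
        exact_mod_cast this
      subst hm0
      refine ⟨1, K.one_mem, fun x hx => ?_⟩
      have := hj x (by simpa using hx)
      rw [hi0, hj00] at this
      simpa [comb] using this
    · have h2d : (0 : ℝ) < 2 ^ d := by positivity
      have hmid : g i = 1 / 2 := by
        rw [hj0, pow_succ, div_le_iff₀ (by positivity)] at hi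
        rw [hj1, pow_succ, lt_div_iff₀ (by positivity)] at hi'
        have h3 : (j : ℝ) ≤ (2 ^ d : ℕ) := by push_cast; linarith
        have h4 : ((2 ^ d : ℕ) : ℝ) < (j + 1 : ℕ) := by push_cast; linarith
        have h5 : j ≤ 2 ^ d := by exact_mod_cast h3
        have h6 : 2 ^ d < j + 1 := by exact_mod_cast h4
        have h7 : j = 2 ^ d := by omega
        rw [hj0, h7, pow_succ]
        push_cast
        field_simp
      have hi0 : i ≠ 0 := by
        intro h0
        rw [h0, Nat.cast_zero, g0] at hmid
        norm_num at hmid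
      obtain ⟨a, ha⟩ := Nat.exists_eq_succ_of_ne_zero hi0
      obtain ⟨b, hb⟩ := Nat.exists_eq_add_of_le him
      rw [Nat.succ_eq_add_one] at ha
      rw [ha] at hb hmid
      push_cast at hmid
      subst hb
      push_cast at g1
      have hdepth : ∀ l d j' : ℕ, l ≤ a + 1 + b →
          (∀ t ∈ Set.Icc (0 : ℝ) 1, g (l + t) = (j' + t) / 2 ^ d) → d ≠ 0 := by
        rintro l d j' hl hlt rfl
        have h1 := hlt 0 t0
        have h2 := hlt 1 t1
        simp only [add_zero, pow_zero, div_one] at h1 h2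
        have h3 : g l ≥ 0 := by rw [← g0]; exact hg.monotone (Nat.cast_nonneg l)
        have h4 : g (l + 1) ≤ 1 := by
          rw [← g1]
          apply hg.monotone
          have : ((l : ℕ) : ℝ) ≤ (a + 1 + b : ℕ) := by exact_mod_cast hl
          push_cast at this
          linarith
        have h5 : g l = 0 := by
          have : (0 : ℝ) ≤ j' := Nat.cast_nonneg j'
          linarith
        have h6 : g (l + 1) = 1 := by linarith
        have h7 := hg.injective (h5.trans g0.symm)
        have h8 := hg.injective (h6.trans g1.symm)
        have h9 : (0 : ℝ) ≤ a := Nat.cast_nonneg a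
        have h10 : (0 : ℝ) ≤ b := Nat.cast_nonneg b
        linarith
      obtain ⟨k₁, hk₁, hkx₁⟩ := ih a (fun x => 2 * g x)
        (fun x y hxy => by simpa using hg hxy) (by simp [g0]) (by rw [hmid]; norm_num) (by
          intro l hl
          obtain ⟨d, hd, j, hj⟩ := h l (by omega)
          obtain ⟨d, rfl⟩ := Nat.exists_eq_succ_of_ne_zero (hdepth l d j (by omega) hj)
          refine ⟨d, by omega, j, fun t ht => ?_⟩
          rw [hj t ht, pow_succ]
          field_simp)
      obtain ⟨k₂, hk₂, hkx₂⟩ := ih b (fun x => 2 * g (x + (a + 1)) - 1)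
        (fun x y hxy => by simpa using hg (by linarith : x + ((a : ℝ) + 1) < y + (a + 1)))
        (by rw [zero_add, hmid]; norm_num)
        (by
          have : (b : ℝ) + 1 + (a + 1) = a + 1 + b + 1 := by ring
          rw [this, g1]
          norm_num) (by
          intro l hl
          obtain ⟨d, hd, j, hj⟩ := h (a + 1 + l) (by omega)
          obtain ⟨d, rfl⟩ := Nat.exists_eq_succ_of_ne_zero (hdepth _ d j (by omega) hj)
          have hj2 : 2 ^ d ≤ j := by
            have h1 := hj 0 t0
            have h2 : (1 : ℝ) / 2 ≤ g ((a + 1 + l : ℕ) + 0) := by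
              rw [← hmid]
              apply hg.monotone
              push_cast
              linarith [(Nat.cast_nonneg l : (0 : ℝ) ≤ l)]
            rw [h1, add_zero, pow_succ, le_div_iff₀ (by positivity)] at h2
            have h3 : ((2 ^ d : ℕ) : ℝ) ≤ j := by push_cast; linarith
            exact_mod_cast h3
          obtain ⟨j, rfl⟩ := Nat.exists_eq_add_of_le hj2
          refine ⟨d, by omega, j, fun t ht => ?_⟩
          have h1 := hj t ht
          have h2 : (l : ℝ) + t + (a + 1) = (a + 1 + l : ℕ) + t := by push_cast; ring
          rw [h2, h1, pow_succ]
          push_cast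
          field_simp
          ring)
      obtain ⟨k, hk, hkx⟩ := exists_join_comb hK hsum hA hA1 hA2 hA3 a b
      refine ⟨_, K.mul_mem (hsum k₁ hk₁ k₂ hk₂) hk, fun x hx => ?_⟩
      obtain ⟨hx0, hx1⟩ := hx
      push_cast at hx1
      obtain ⟨hl, hr⟩ := hkx x ⟨hx0, by linarith⟩
      rw [RelIso.mul_apply _ k, show a + 1 + b = a + b + 1 by omega]
      rcases le_total x (a + 1) with hxa | hxa
      · have hc := comb_mem_Icc a x ⟨hx0, hxa⟩
        rw [← hl hxa, sum_apply_left hK hk₂ hc.2, ← hkx₁ x ⟨hx0, hxa⟩]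
        ring
      · have hc := comb_mem_Icc b (x - (a + 1)) ⟨by linarith, by linarith⟩
        rw [← hr hxa, sum_apply_right hK hk₁ hk₂ hc.1,
          ← hkx₂ (x - (a + 1)) ⟨by linarith, by linarith⟩]
        ring_nf

include hK hsum hA hA1 hA2 hA3 in
/-- Thompson's group `F` is contained in every subgroup `K` that contains the generator `A` and is
closed under juxtaposition of two elements on the two halves of the unit interval. -/
theorem mem_of_generator_mem {f : ℝ ≃o ℝ} (hf : f ∈ dyadicPL)
    (hsupp : ∀ x, x ≤ 0 ∨ 1 ≤ x → f x = x) : f ∈ K := by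
  have f0 := hsupp 0 (Or.inl le_rfl)
  have f1 := hsupp 1 (Or.inr le_rfl)
  obtain ⟨N, hN⟩ := exists_standard_cells hf f0
  have h2 : (0 : ℝ) < 2 ^ N := by positivity
  obtain ⟨m, hm⟩ : ∃ m, 2 ^ N = m + 1 := Nat.exists_eq_succ_of_ne_zero (by positivity)
  have hm' : (m : ℝ) + 1 = 2 ^ N := by exact_mod_cast hm.symm
  choose! d hd using hN
  obtain ⟨k, hk, hkx⟩ := exists_eq_comb hK hsum hA hA1 hA2 hA3
    ((Finset.range (2 ^ N)).sup d + 1) m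
    (fun x => f (x / 2 ^ N)) (fun x y hxy => f.strictMono (by gcongr)) (by simp [f0])
    (by rw [hm', div_self h2.ne', f1]) (fun i hi => ⟨d i, Nat.lt_succ_of_le
      (Finset.le_sup (f := d) (Finset.mem_range.2 (by omega))), hd i (by omega)⟩)
  obtain ⟨k', hk', hkx'⟩ := exists_eq_comb hK hsum hA hA1 hA2 hA3 (N + 1) m
    (fun x => x / 2 ^ N) (fun x y hxy => by simp only; gcongr) (by simp)
    (by rw [hm', div_self h2.ne']) (fun i _ => ⟨N, Nat.lt_succ_self N, i, fun t _ => rfl⟩)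
  have : f = k * k'⁻¹ := by
    refine RelIso.ext fun x => ?_
    rw [RelIso.mul_apply]
    by_cases hx : x ≤ 0 ∨ 1 ≤ x
    · rw [hsupp x hx, hK _ (K.inv_mem hk') x hx, hK k hk x hx]
    · push Not at hx
      have hmem : x * 2 ^ N ∈ Set.Icc (0 : ℝ) (m + 1) := by
        rw [hm']
        exact ⟨mul_nonneg hx.1.le h2.le, by nlinarith [hx.2]⟩
      have h3 := hkx _ hmem
      have h4 := hkx' _ hmem
      simp only [mul_div_cancel_right₀ _ h2.ne'] at h3 h4
      rw [h3, h4, RelIso.inv_apply_self, ← h4]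
  rw [this]
  exact K.mul_mem hk (K.inv_mem hk')

end generation

/-! ### Simplicity of the compactly supported group -/

/-- Conjugation by `σ` transports a support in `[a', b']` to one in `[σ a', σ b']`. -/
theorem compactPL_conj_mem {a b a' b' : ℝ} {σ f : ℝ ≃o ℝ} (hσ : σ ∈ dyadicPL) (hf : f ∈ dyadicPL)
    (hsupp : ∀ x, x ≤ a' ∨ b' ≤ x → f x = x) (ha : a < σ a') (hb : σ b' < b) :
    σ * f * σ⁻¹ ∈ compactPL a b := by
  refine ⟨dyadicPL.mul_mem (dyadicPL.mul_mem hσ hf) (dyadicPL.inv_mem hσ),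
    min (σ a' - a) (b - σ b'), lt_min (by linarith) (by linarith), fun x hx => ?_⟩
  have h1 := min_le_left (σ a' - a) (b - σ b')
  have h2 := min_le_right (σ a' - a) (b - σ b')
  rw [RelIso.mul_apply, RelIso.mul_apply, hsupp, RelIso.apply_inv_self]
  rcases hx with hx | hx
  · refine Or.inl (σ.le_iff_le.1 ?_)
    rw [RelIso.apply_inv_self]
    linarith
  · refine Or.inr (σ.le_iff_le.1 ?_)
    rw [RelIso.apply_inv_self]
    linarith

/-- Two copies of the same element of `F` in `(a, b)` are conjugate by an element with compact
support in `(a, b)`. -/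
theorem exists_conj_eq {a b : ℝ} {σ τ f : ℝ ≃o ℝ} (hσ : σ ∈ dyadicPL) (hτ : τ ∈ dyadicPL)
    (hsupp : ∀ x, x ≤ 0 ∨ 1 ≤ x → f x = x) (ha : a < σ 0) (hb : σ 1 < b) (ha' : a < τ 0)
    (hb' : τ 1 < b) :
    ∃ h ∈ compactPL a b, h * (σ * f * σ⁻¹) * h⁻¹ = τ * f * τ⁻¹ := by
  have d0 : IsDyadic 0 := ⟨0, 0, by simp⟩
  have d1 : IsDyadic 1 := ⟨1, 0, by simp⟩
  have hinv : ∀ x, σ⁻¹ (σ x) = x := fun x => RelIso.inv_apply_self σ x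
  obtain ⟨h, hh, hhx⟩ := exists_extend (a := a) (b := b) (c := σ 0) (d := σ 1)
    (dyadicPL.mul_mem hτ (dyadicPL.inv_mem hσ)) ((hσ.2 0).2 d0) ((hσ.2 1).2 d1) ha
    (σ.strictMono one_pos) hb (by rwa [RelIso.mul_apply, hinv]) (by rwa [RelIso.mul_apply, hinv])
  refine ⟨h, hh, ?_⟩
  -- `τ⁻¹ h σ` is the identity on the support of `f`
  have hcomm : f * (τ⁻¹ * h * σ) = τ⁻¹ * h * σ * f := by
    refine commute_of_disjoint_support (Y := ℝ) (A := Set.Icc 0 1) (B := (Set.Icc 0 1)ᶜ)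
      disjoint_compl_right (fun y hy => hsupp y ?_) (fun y hy => ?_)
    · rw [Set.mem_Icc, not_and_or, not_le, not_le] at hy
      exact hy.imp le_of_lt le_of_lt
    · rw [Set.notMem_compl_iff] at hy
      show (τ⁻¹ * h * σ) y = y
      rw [RelIso.mul_apply, RelIso.mul_apply, hhx _ (σ.monotone hy.1) (σ.monotone hy.2),
        RelIso.mul_apply, hinv, RelIso.inv_apply_self]
  calc h * (σ * f * σ⁻¹) * h⁻¹ = τ * (τ⁻¹ * h * σ * f) * σ⁻¹ * h⁻¹ := by group
    _ = τ * f * τ⁻¹ := by rw [← hcomm]; group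

/-- The generator `A` of `F` satisfies `A² = (A ⊕ 1) A (1 ⊕ A)`, and all its copies in `(a, b)` are
conjugate, so that their common class in the abelianization is trivial. -/
theorem compactPL_perfect {a b : ℝ} (hab : a < b) : commutator (compactPL a b) = ⊤ := by
  obtain ⟨A, hAm, hA0, hA1, hA2, hA3, hA4⟩ := exists_generator
  have hAsupp : ∀ x, x ≤ 0 ∨ 1 ≤ x → A x = x := fun x hx => hx.elim (hA0 x) (hA4 x)
  -- the elements of `F` all of whose copies in `(a, b)` are products of commutators
  let K : Subgroup (ℝ ≃o ℝ) :=
    { carrier := {f | f ∈ dyadicPL ∧ (∀ x, x ≤ 0 ∨ 1 ≤ x → f x = x) ∧ ∀ σ ∈ dyadicPL,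
        a < σ 0 → σ 1 < b → σ * f * σ⁻¹ ∈ ⁅compactPL a b, compactPL a b⁆}
      one_mem' := ⟨dyadicPL.one_mem, fun _ _ => rfl, fun σ _ _ _ => by simp⟩
      mul_mem' := by
        rintro f g ⟨hf, hf1, hf2⟩ ⟨hg, hg1, hg2⟩
        refine ⟨dyadicPL.mul_mem hf hg, fun x hx => ?_, fun σ hσ h0 h1 => ?_⟩
        · rw [RelIso.mul_apply, hg1 x hx, hf1 x hx]
        · have := Subgroup.mul_mem _ (hf2 σ hσ h0 h1) (hg2 σ hσ h0 h1)
          simpa [mul_assoc] using this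
      inv_mem' := by
        rintro f ⟨hf, hf1, hf2⟩
        refine ⟨dyadicPL.inv_mem hf, fun x hx => ?_, fun σ hσ h0 h1 => ?_⟩
        · have := RelIso.inv_apply_self f x
          rwa [hf1 x hx] at this
        · have := Subgroup.inv_mem _ (hf2 σ hσ h0 h1)
          simpa [mul_assoc] using this }
  have hKsupp : ∀ f ∈ K, ∀ x, x ≤ 0 ∨ 1 ≤ x → f x = x := fun f hf => hf.2.1
  have hhalf : ∀ σ : ℝ ≃o ℝ, (σ * leftHalf) 0 = σ 0 ∧ (σ * leftHalf) 1 = σ (1 / 2) ∧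
      (σ * rightHalf) 0 = σ (1 / 2) ∧ (σ * rightHalf) 1 = σ 1 := fun σ => by
    simp only [RelIso.mul_apply, leftHalf_apply, rightHalf_apply]
    norm_num
  have hsum : ∀ f ∈ K, ∀ g ∈ K,
      leftHalf * f * leftHalf⁻¹ * (rightHalf * g * rightHalf⁻¹) ∈ K := by
    rintro f hf g hg
    refine ⟨dyadicPL.mul_mem (dyadicPL.mul_mem (dyadicPL.mul_mem leftHalf_mem hf.1)
      (dyadicPL.inv_mem leftHalf_mem)) (dyadicPL.mul_mem (dyadicPL.mul_mem rightHalf_mem hg.1)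
      (dyadicPL.inv_mem rightHalf_mem)), fun x hx => ?_, fun σ hσ h0 h1 => ?_⟩
    · rw [RelIso.mul_apply (leftHalf * f * leftHalf⁻¹), conj_rightHalf_apply,
        hg.2.1 (2 * x - 1) (hx.imp (fun h => by linarith) fun h => by linarith),
        conj_leftHalf_apply,
        hf.2.1 _ (hx.imp (fun h => by linarith) fun h => by linarith)]
      ring
    · have hlt : σ 0 < σ (1 / 2) := σ.strictMono (by norm_num)
      have hlt' : σ (1 / 2) < σ 1 := σ.strictMono (by norm_num)
      obtain ⟨e1, e2, e3, e4⟩ := hhalf σ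
      have h1 := Subgroup.mul_mem _
        (hf.2.2 (σ * leftHalf) (dyadicPL.mul_mem hσ leftHalf_mem) (by rw [e1]; exact h0)
          (by rw [e2]; linarith))
        (hg.2.2 (σ * rightHalf) (dyadicPL.mul_mem hσ rightHalf_mem) (by rw [e3]; linarith)
          (by rw [e4]; exact h1))
      simpa [mul_assoc] using h1
  -- the relation between the generator and its copies in the two halves
  have hrel : A * A = leftHalf * A * leftHalf⁻¹ * A * (rightHalf * A * rightHalf⁻¹) := by
    refine RelIso.ext fun x => ?_
    rw [RelIso.mul_apply, RelIso.mul_apply (leftHalf * A * leftHalf⁻¹ * A),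
      RelIso.mul_apply (leftHalf * A * leftHalf⁻¹), conj_rightHalf_apply, conj_leftHalf_apply]
    rcases le_total x 0 with h | h
    · rw [hA0 x h, hA0 x h, hA0 (2 * x - 1) (by linarith)]
      have : 1 / 2 + (2 * x - 1) / 2 = x := by ring
      rw [this, hA0 x h, hA0 _ (by linarith)]
      ring
    rcases le_total x (1 / 2) with h' | h'
    · rw [hA1 x h h', hA1 (x / 2) (by linarith) (by linarith), hA0 (2 * x - 1) (by linarith)]
      have : 1 / 2 + (2 * x - 1) / 2 = x := by ring
      rw [this, hA1 x h h', hA1 _ (by linarith) (by linarith)]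
      ring
    rcases le_total x (3 / 4) with h'' | h''
    · rw [hA2 x h' h'', hA1 (x - 1 / 4) (by linarith) (by linarith),
        hA1 (2 * x - 1) (by linarith) (by linarith), hA2 (1 / 2 + (2 * x - 1) / 2 / 2)
          (by linarith) (by linarith), hA2 _ (by linarith) (by linarith)]
      ring
    rcases le_total x (7 / 8) with h3 | h3
    · rw [hA3 x h'' (by linarith), hA2 (2 * x - 1) (by linarith) (by linarith),
        hA2 (1 / 2 + (2 * x - 1 - 1 / 4) / 2) (by linarith) (by linarith),
        hA3 _ (by linarith) (by linarith)]
      ring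
    rcases le_total x 1 with h4 | h4
    · rw [hA3 x h'' h4, hA3 (2 * x - 1) (by linarith) (by linarith),
        hA3 (1 / 2 + (2 * (2 * x - 1) - 1) / 2) (by linarith) (by linarith),
        hA4 _ (by linarith)]
      ring
    · rw [hA4 x h4, hA4 x h4, hA4 (2 * x - 1) (by linarith),
        hA4 (1 / 2 + (2 * x - 1) / 2) (by linarith), hA4 _ (by linarith)]
      ring
  have hA : A ∈ K := by
    refine ⟨hAm, hAsupp, fun σ hσ h0 h1 => ?_⟩
    obtain ⟨e1, e2, e3, e4⟩ := hhalf σ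
    have hlt : σ 0 < σ (1 / 2) := σ.strictMono (by norm_num)
    have hlt' : σ (1 / 2) < σ 1 := σ.strictMono (by norm_num)
    have hσl := dyadicPL.mul_mem hσ leftHalf_mem
    have hσr := dyadicPL.mul_mem hσ rightHalf_mem
    obtain ⟨u, hu, hu'⟩ := exists_conj_eq (a := a) (b := b) hσ hσl hAsupp h0 h1
      (by rw [e1]; exact h0) (by rw [e2]; linarith)
    obtain ⟨v, hv, hv'⟩ := exists_conj_eq (a := a) (b := b) hσ hσr hAsupp h0 h1
      (by rw [e3]; linarith) (by rw [e4]; exact h1)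
    have hα : σ * A * σ⁻¹ ∈ compactPL a b := compactPL_conj_mem hσ hAm hAsupp h0 h1
    -- in the abelianization, the double of the class of the copy of `A` equals its triple
    let α : compactPL a b := ⟨σ * A * σ⁻¹, hα⟩
    let u' : compactPL a b := ⟨u, hu⟩
    let v' : compactPL a b := ⟨v, hv⟩
    have hrel' : α * α = u' * α * u'⁻¹ * α * (v' * α * v'⁻¹) := by
      refine Subtype.ext ?_
      show σ * A * σ⁻¹ * (σ * A * σ⁻¹) = u * (σ * A * σ⁻¹) * u⁻¹ * (σ * A * σ⁻¹) *
        (v * (σ * A * σ⁻¹) * v⁻¹)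
      rw [hu', hv']
      calc σ * A * σ⁻¹ * (σ * A * σ⁻¹) = σ * (A * A) * σ⁻¹ := by group
        _ = _ := by rw [hrel]; group
    have hab' := congrArg Abelianization.of hrel'
    simp only [map_mul, map_inv] at hab'
    have h1' : Abelianization.of α = 1 := by
      have h3 : Abelianization.of u' * Abelianization.of α * (Abelianization.of u')⁻¹ =
          Abelianization.of α := by rw [mul_comm (Abelianization.of u'), mul_inv_cancel_right]
      have h4 : Abelianization.of v' * Abelianization.of α * (Abelianization.of v')⁻¹ =
          Abelianization.of α := by rw [mul_comm (Abelianization.of v'), mul_inv_cancel_right]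
      rw [h3, h4] at hab'
      exact (left_eq_mul.1 hab')
    have h2' : α ∈ commutator (compactPL a b) := by
      rw [← Abelianization.ker_of]
      exact h1'
    have := Subgroup.mem_map_of_mem (compactPL a b).subtype h2'
    rwa [Subgroup.map_subtype_commutator] at this
  have hle : compactPL a b ≤ ⁅compactPL a b, compactPL a b⁆ := by
    rintro f ⟨hf, ε, hε, hfε⟩
    obtain ⟨c, hc, hac, hc'⟩ := exists_isDyadic_between
      (lt_min (by linarith : a < a + ε) (by linarith : a < (a + b) / 2))
    obtain ⟨d, hd, hd', hdb⟩ := exists_isDyadic_between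
      (max_lt (by linarith : b - ε < b) (by linarith : (a + b) / 2 < b))
    rw [lt_min_iff] at hc'
    rw [max_lt_iff] at hd'
    obtain ⟨σ, hσ, h0, h1⟩ := exists_map_interval (a := 0) (b := 1) ⟨0, 0, by simp⟩
      ⟨1, 0, by simp⟩ one_pos hc hd (by linarith)
    have hf₁ : σ⁻¹ * f * σ ∈ K := by
      refine mem_of_generator_mem hKsupp hsum hA hA1 hA2 hA3
        (dyadicPL.mul_mem (dyadicPL.mul_mem (dyadicPL.inv_mem hσ) hf) hσ) fun x hx => ?_
      rw [RelIso.mul_apply, RelIso.mul_apply, hfε, RelIso.inv_apply_self]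
      rcases hx with hx | hx
      · have := σ.monotone hx
        exact Or.inl (by linarith)
      · have := σ.monotone hx
        exact Or.inr (by linarith)
    have := hf₁.2.2 σ hσ (by rw [h0]; exact hac) (by rw [h1]; exact hdb)
    simpa [mul_assoc] using this
  refine Subgroup.map_injective (compactPL a b).subtype_injective ?_
  rw [Subgroup.map_subtype_commutator, ← MonoidHom.range_eq_map, Subgroup.range_subtype]
  exact le_antisymm (Subgroup.commutator_le_self _) hle

/-- Every point of `(a, b)` is moved to the right by some element with support in `(a, b)`. -/
theorem exists_mem_compactPL_lt {a b x : ℝ} (hax : a < x) (hxb : x < b) :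
    ∃ f ∈ compactPL a b, x < f x := by
  obtain ⟨c, hc, hac, hcx⟩ := exists_isDyadic_between hax
  obtain ⟨d, hd, hxd, hdb⟩ := exists_isDyadic_between hxb
  obtain ⟨n, hn⟩ : ∃ n : ℕ, 1 / (2 : ℝ) ^ n < b - d := by
    obtain ⟨n, hn⟩ := exists_pow_lt_of_lt_one (sub_pos.2 hdb) (by norm_num : (1 / 2 : ℝ) < 1)
    exact ⟨n, by simpa using hn⟩
  have hpos : (0 : ℝ) < 1 / 2 ^ n := by positivity
  obtain ⟨f, hf, hfx⟩ := exists_extend (a := a) (b := b)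
    (affineIso_mem 0 (c := 1 / 2 ^ n) ⟨1, n, by simp⟩) hc hd hac (hcx.trans hxd) hdb
    (by rw [affineIso_apply]; simp only [zpow_zero, one_mul]; linarith)
    (by rw [affineIso_apply]; simp only [zpow_zero, one_mul]; linarith)
  refine ⟨f, hf, ?_⟩
  rw [hfx x hcx.le hxd.le, affineIso_apply, zpow_zero, one_mul]
  linarith

theorem compactPL_infinite {a b : ℝ} (hab : a < b) : Infinite (compactPL a b) := by
  obtain ⟨f, hf, hlt⟩ := exists_mem_compactPL_lt (x := (a + b) / 2) (a := a) (b := b)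
    (by linarith) (by linarith)
  have hmono : StrictMono fun n : ℕ => (f ^ n) ((a + b) / 2) := by
    refine strictMono_nat_of_lt_succ fun n => ?_
    rw [pow_succ, RelIso.mul_apply]
    exact (f ^ n).strictMono hlt
  refine Infinite.of_injective (fun n : ℕ => (⟨f ^ n, Subgroup.pow_mem _ hf n⟩ : compactPL a b))
    fun m n hmn => hmono.injective ?_
  exact congrArg (fun g : ℝ ≃o ℝ => g ((a + b) / 2)) (congrArg Subtype.val hmn)

/-- Compactly supported elements can be squeezed into an interval displaced by a given `n ≠ 1`. -/
theorem compactPL_isSimpleGroup {a b : ℝ} (hab : a < b) : IsSimpleGroup (compactPL a b) := by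
  have := compactPL_infinite hab
  refine isSimpleGroup_of_perfect (compactPL_perfect hab) fun n hn f g => ?_
  obtain ⟨y, hy⟩ : ∃ y : ℝ, n.1 y ≠ y := by
    by_contra! h
    exact hn (Subtype.ext (RelIso.ext h))
  obtain ⟨-, ε, hε, hnε⟩ := n.2
  have hyab : a + ε < y ∧ y < b - ε := by
    by_contra hcon
    rw [not_and_or, not_lt, not_lt] at hcon
    exact hy (hnε y hcon)
  -- a dyadic interval `[c, d]` in `(a, b)` displaced by `n`
  obtain ⟨U, V, hU, hV, hyU, hyV, hUV⟩ := t2_separation hy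
  obtain ⟨δ, hδ, hball⟩ := Metric.mem_nhds_iff.1
    (((hU.preimage n.1.continuous).inter hV).mem_nhds ⟨hyU, hyV⟩)
  obtain ⟨c, hc, hcl, hcr⟩ := exists_isDyadic_between
    (lt_min (by linarith : y < y + δ) (by linarith [hyab.2] : y < b))
  rw [lt_min_iff] at hcr
  obtain ⟨d, hd, hdl, hdr⟩ := exists_isDyadic_between (lt_min hcr.1 hcr.2)
  rw [lt_min_iff] at hdr
  have hdisp : ∀ x, c ≤ x → x ≤ d → n.1 x < c ∨ d < n.1 x := by
    intro x hx hx'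
    by_contra hcon
    rw [not_or, not_lt, not_lt] at hcon
    have h1 := (hball (by rw [Metric.mem_ball, Real.dist_eq, abs_lt]; constructor <;> linarith :
      x ∈ Metric.ball y δ)).1
    have h2 := (hball (by rw [Metric.mem_ball, Real.dist_eq, abs_lt]; constructor <;>
      linarith [hcon.1, hcon.2] : n.1 x ∈ Metric.ball y δ)).2
    exact Set.disjoint_left.1 hUV h1 h2
  -- squeeze the supports of `f` and `g` into `[c, d]`
  obtain ⟨-, ε₁, hε₁, hf⟩ := f.2
  obtain ⟨-, ε₂, hε₂, hg⟩ := g.2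
  obtain ⟨p, hp, hap, hp'⟩ := exists_isDyadic_between
    (lt_min (by linarith [lt_min hε₁ hε₂] : a < a + min ε₁ ε₂)
      (by linarith [hyab.1, hyab.2] : a < (a + b) / 2))
  obtain ⟨q, hq, hq', hqb⟩ := exists_isDyadic_between
    (max_lt (by linarith [lt_min hε₁ hε₂] : b - min ε₁ ε₂ < b)
      (by linarith [hyab.1, hyab.2] : (a + b) / 2 < b))
  rw [lt_min_iff] at hp'
  rw [max_lt_iff] at hq'
  have hm₁ := min_le_left ε₁ ε₂
  have hm₂ := min_le_right ε₁ ε₂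
  obtain ⟨φ, hφ, hφp, hφq⟩ := exists_map_interval hp hq (by linarith) hc hd hdl
  obtain ⟨k, hk, hkx⟩ := exists_extend (a := a) (b := b) hφ hp hq hap (by linarith) hqb
    (by rw [hφp]; linarith [hyab.1]) (by rw [hφq]; linarith)
  have hkp : k p = c := by rw [hkx p le_rfl (by linarith), hφp]
  have hkq : k q = d := by rw [hkx q (by linarith) le_rfl, hφq]
  have hsupp : ∀ (e : ℝ ≃o ℝ), (∀ x, x ≤ p ∨ q ≤ x → e x = x) →
      ∀ x ∉ Set.Icc c d, (k * e * k⁻¹) x = x := by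
    intro e he x hx
    rw [RelIso.mul_apply, RelIso.mul_apply, he, RelIso.apply_inv_self]
    rw [Set.mem_Icc, not_and_or, not_le, not_le] at hx
    refine hx.imp (fun h => k.le_iff_le.1 ?_) fun h => k.le_iff_le.1 ?_
    · rw [RelIso.apply_inv_self, hkp]
      exact h.le
    · rw [RelIso.apply_inv_self, hkq]
      exact h.le
  have hf' := hsupp f.1 fun x hx => hf x (hx.imp (fun h => by linarith) fun h => by linarith)
  have hg' := hsupp g.1 fun x hx => hg x (hx.imp (fun h => by linarith) fun h => by linarith)
  refine ⟨⟨k, hk⟩, Subtype.ext ?_⟩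
  refine commute_of_disjoint_support (Y := ℝ) (A := Set.Icc c d)
    (B := (fun x => (n.1⁻¹ : ℝ ≃o ℝ) x) ⁻¹' Set.Icc c d) ?_ hf' ?_
  · rw [Set.disjoint_left]
    intro x hx hx'
    have h1 := hdisp _ hx'.1 hx'.2
    rw [RelIso.apply_inv_self] at h1
    rcases h1 with h1 | h1
    · exact absurd hx.1 (not_le.2 h1)
    · exact absurd hx.2 (not_le.2 h1)
  · intro x hx
    show n.1 ((k * g.1 * k⁻¹) ((n.1⁻¹ : ℝ ≃o ℝ) x)) = x
    rw [hg' _ hx, RelIso.apply_inv_self]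

/-! ### Circle homeomorphisms that are trivial near a point -/

theorem coe_mem_dyadicPoints {x : ℝ} : (x : UnitAddCircle) ∈ dyadicPoints ↔ IsDyadic x := by
  constructor
  · rintro ⟨a, n, h⟩
    have h0 : ((x - a / 2 ^ n : ℝ) : UnitAddCircle) = 0 := by rw [AddCircle.coe_sub, h, sub_self]
    obtain ⟨m, hm⟩ := (AddCircle.coe_eq_zero_iff 1).1 h0
    have : x = a / 2 ^ n + m := by
      simp only [zsmul_eq_mul, mul_one] at hm
      linarith
    rw [this]
    exact IsDyadic.add ⟨a, n, rfl⟩ (isDyadic_intCast m)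
  · rintro ⟨a, n, rfl⟩
    exact ⟨a, n, rfl⟩

theorem eventually_nhds_coe {x : ℝ} {p : UnitAddCircle → Prop} :
    (∀ᶠ y in 𝓝 (x : UnitAddCircle), p y) ↔ ∀ᶠ t : ℝ in 𝓝 0, p ((x + t : ℝ) : UnitAddCircle) := by
  have h1 : 𝓝 (x : UnitAddCircle) = Filter.map (fun y : ℝ => (y : UnitAddCircle)) (𝓝 x) :=
    (QuotientAddGroup.isOpenQuotientMap_mk.map_nhds_eq x).symm
  have h2 : 𝓝 x = Filter.map (fun t => x + t) (𝓝 0) := by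
    rw [map_add_left_nhds, add_zero]
  rw [h1, h2, Filter.map_map, Filter.eventually_map]
  rfl

theorem coe_add_one (x : ℝ) : ((x + 1 : ℝ) : UnitAddCircle) = x := by
  rw [AddCircle.coe_add, AddCircle.coe_period, add_zero]

theorem coe_injOn (a : ℝ) : Set.InjOn (fun x : ℝ => (x : UnitAddCircle)) (Set.Ico a (a + 1)) :=
  fun _ hx _ hy h => (AddCircle.coe_eq_coe_iff_of_mem_Ico hx hy).1 h

theorem exists_coe_eq (a : ℝ) (y : UnitAddCircle) :
    ∃ x ∈ Set.Ico a (a + 1), (x : UnitAddCircle) = y :=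
  ⟨_, (AddCircle.equivIco 1 a y).2, AddCircle.coe_equivIco⟩

theorem exists_coe_eq_of_ne (a : ℝ) {y : UnitAddCircle} (hy : y ≠ a) :
    ∃ x ∈ Set.Ioo a (a + 1), (x : UnitAddCircle) = y := by
  obtain ⟨x, hx, rfl⟩ := exists_coe_eq a y
  exact ⟨x, ⟨lt_of_le_of_ne hx.1 fun h => hy (h ▸ rfl), hx.2⟩, rfl⟩

theorem coe_ne_coe {a x : ℝ} (hx : x ∈ Set.Ioo a (a + 1)) : (x : UnitAddCircle) ≠ a :=
  fun h => hx.1.ne' (coe_injOn a ⟨hx.1.le, hx.2⟩ ⟨le_rfl, by linarith⟩ h)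

theorem compactPL_apply_mem_Icc {a b : ℝ} {f : ℝ ≃o ℝ} (hf : f ∈ compactPL a b) {x : ℝ}
    (hx : x ∈ Set.Icc a b) : f x ∈ Set.Icc a b := by
  obtain ⟨-, ε, hε, hfε⟩ := hf
  constructor
  · rw [← hfε a (Or.inl (by linarith))]
    exact f.monotone hx.1
  · rw [← hfε b (Or.inr (by linarith))]
    exact f.monotone hx.2

theorem compactPL_apply_mem_Ioo {a b : ℝ} {f : ℝ ≃o ℝ} (hf : f ∈ compactPL a b) {x : ℝ}
    (hx : x ∈ Set.Ioo a b) : f x ∈ Set.Ioo a b := by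
  obtain ⟨-, ε, hε, hfε⟩ := hf
  constructor
  · rw [← hfε a (Or.inl (by linarith))]
    exact f.strictMono hx.1
  · rw [← hfε b (Or.inr (by linarith))]
    exact f.strictMono hx.2

/-- The map of the circle induced by a map `f` of the interval `[a, a + 1]`. It only depends on the
values of `f` on `[a, a + 1)` and is meaningful when `f` fixes the end points. -/
noncomputable def circleMap (a : ℝ) (f : ℝ ≃o ℝ) : UnitAddCircle → UnitAddCircle :=
  AddCircle.liftIco 1 a fun x => ((f x : ℝ) : UnitAddCircle)

theorem circleMap_coe {a : ℝ} {f : ℝ ≃o ℝ} (hf : f ∈ compactPL a (a + 1)) {x : ℝ}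
    (hx : x ∈ Set.Icc a (a + 1)) : circleMap a f x = f x := by
  rcases hx.2.lt_or_eq with h | rfl
  · exact AddCircle.liftIco_coe_apply ⟨hx.1, h⟩
  · obtain ⟨-, ε, hε, hfε⟩ := hf
    rw [hfε _ (Or.inr (by linarith)), coe_add_one, circleMap,
      AddCircle.liftIco_coe_apply ⟨le_rfl, by linarith⟩, hfε _ (Or.inl (by linarith))]

theorem circleMap_mul {a : ℝ} {f g : ℝ ≃o ℝ} (hf : f ∈ compactPL a (a + 1))
    (hg : g ∈ compactPL a (a + 1)) (y : UnitAddCircle) :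
    circleMap a (f * g) y = circleMap a f (circleMap a g y) := by
  obtain ⟨x, hx, rfl⟩ := exists_coe_eq a y
  have hx := Set.Ico_subset_Icc_self hx
  rw [circleMap_coe hg hx, circleMap_coe hf (compactPL_apply_mem_Icc hg hx),
    circleMap_coe ((compactPL a (a + 1)).mul_mem hf hg) hx, RelIso.mul_apply]

theorem circleMap_one (a : ℝ) (y : UnitAddCircle) : circleMap a 1 y = y := by
  obtain ⟨x, hx, rfl⟩ := exists_coe_eq a y
  exact circleMap_coe (compactPL a (a + 1)).one_mem (Set.Ico_subset_Icc_self hx)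

theorem continuous_circleMap {a : ℝ} {f : ℝ ≃o ℝ} (hf : f ∈ compactPL a (a + 1)) :
    Continuous (circleMap a f) := by
  refine AddCircle.liftIco_continuous ?_
    ((AddCircle.continuous_mk' 1).comp f.continuous).continuousOn
  obtain ⟨-, ε, hε, hfε⟩ := hf
  rw [hfε (a + 1) (Or.inr (by linarith)), hfε a (Or.inl (by linarith)), coe_add_one]

/-- The homeomorphism of the circle induced by a dyadic piecewise linear map with compact support
in the interval `(a, a + 1)`. The number `a` need not be dyadic. -/
noncomputable def circleHom (a : ℝ) :
    compactPL a (a + 1) →* (UnitAddCircle ≃ₜ UnitAddCircle) where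
  toFun f :=
    { toFun := circleMap a f.1
      invFun := circleMap a f⁻¹.1
      left_inv := fun y => by
        rw [← circleMap_mul f⁻¹.2 f.2, ← Subgroup.coe_mul, inv_mul_cancel]
        exact circleMap_one a y
      right_inv := fun y => by
        rw [← circleMap_mul f.2 f⁻¹.2, ← Subgroup.coe_mul, mul_inv_cancel]
        exact circleMap_one a y
      continuous_toFun := continuous_circleMap f.2
      continuous_invFun := continuous_circleMap f⁻¹.2 }
  map_one' := Homeomorph.ext (circleMap_one a)
  map_mul' f g := Homeomorph.ext (circleMap_mul f.2 g.2)

theorem circleHom_coe {a : ℝ} (f : compactPL a (a + 1)) {x : ℝ} (hx : x ∈ Set.Icc a (a + 1)) :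
    circleHom a f x = ((f.1 x : ℝ) : UnitAddCircle) :=
  circleMap_coe f.2 hx

theorem eventually_circleHom_coe {a : ℝ} (f : compactPL a (a + 1)) :
    ∀ᶠ t : ℝ in 𝓝 0,
      circleHom a f ((a + t : ℝ) : UnitAddCircle) = ((a + t : ℝ) : UnitAddCircle) := by
  obtain ⟨-, ε, hε, hfε⟩ := f.2
  filter_upwards [Ioo_mem_nhds (neg_lt_zero.2 (lt_min hε one_pos)) (lt_min hε one_pos)] with t ht
  have h1 := min_le_left ε 1
  have h2 := min_le_right ε 1
  rcases le_total 0 t with h | h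
  · rw [circleHom_coe f ⟨by linarith, by linarith [ht.2]⟩, hfε _ (Or.inl (by linarith [ht.2]))]
  · rw [← coe_add_one, circleHom_coe f ⟨by linarith [ht.1], by linarith⟩,
      hfε _ (Or.inr (by linarith [ht.1]))]

theorem circleHom_mem_thompsonT {a : ℝ} (f : compactPL a (a + 1)) :
    circleHom a f ∈ thompsonT := by
  obtain ⟨⟨⟨B, hB, hBd, hBa⟩, hd⟩, -⟩ := f.2
  refine ⟨⟨(fun x : ℝ => (x : UnitAddCircle)) '' B, hB.image _, ?_, fun y hy => ?_⟩, fun y => ?_⟩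
  · rintro _ ⟨x, hx, rfl⟩
    exact coe_mem_dyadicPoints.2 (hBd x hx)
  · by_cases hya : y = a
    · subst hya
      refine ⟨0, ?_⟩
      have h0 := (eventually_circleHom_coe f).self_of_nhds
      rw [add_zero] at h0
      filter_upwards [eventually_circleHom_coe f] with t ht
      rw [h0, ← AddCircle.coe_add, ht, zpow_zero, one_mul, AddCircle.coe_add]
    · obtain ⟨x, hx, rfl⟩ := exists_coe_eq_of_ne a hya
      obtain ⟨k, hk⟩ := hBa x fun h => hy ⟨x, h, rfl⟩
      have hev : ∀ᶠ t : ℝ in 𝓝 0, x + t ∈ Set.Ioo a (a + 1) := by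
        have hc : Filter.Tendsto (fun t => x + t) (𝓝 0) (𝓝 x) := by
          simpa using (Filter.tendsto_id (x := 𝓝 (0 : ℝ))).const_add x
        exact hc.eventually (Ioo_mem_nhds hx.1 hx.2)
      refine ⟨k, ?_⟩
      filter_upwards [hk, hev] with t h1 h2
      rw [← AddCircle.coe_add, circleHom_coe f (Set.Ioo_subset_Icc_self h2), h1,
        circleHom_coe f (Set.Ioo_subset_Icc_self hx), AddCircle.coe_add]
  · obtain ⟨x, hx, rfl⟩ := exists_coe_eq a y
    rw [circleHom_coe f (Set.Ico_subset_Icc_self hx), coe_mem_dyadicPoints,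
      coe_mem_dyadicPoints, hd]

/-- An element of `T` that is trivial near the image of `a` is induced by a dyadic piecewise
linear map with compact support in `(a, a + 1)`. -/
theorem exists_circleHom_eq {a : ℝ} {g : UnitAddCircle ≃ₜ UnitAddCircle} (hg : g ∈ thompsonT)
    (ha : ∀ᶠ y in 𝓝 (a : UnitAddCircle), g y = y) : ∃ f, circleHom a f = g := by
  obtain ⟨⟨B, hB, hBd, hBa⟩, hd⟩ := hg
  have hga : g a = a := ha.self_of_nhds
  rw [eventually_nhds_coe, Metric.eventually_nhds_iff] at ha
  obtain ⟨ε, hε, ha⟩ := ha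
  simp only [Real.dist_eq, sub_zero] at ha
  classical
  -- the lift of `g` on `(a, a + 1)`, extended by the identity
  let F : ℝ → ℝ := fun x =>
    if x ∈ Set.Ioo a (a + 1) then (AddCircle.equivIco 1 a (g x) : ℝ) else x
  have hFout : ∀ x ∉ Set.Ioo a (a + 1), F x = x := fun x hx => if_neg hx
  have hFcoe : ∀ x ∈ Set.Ioo a (a + 1), (F x : UnitAddCircle) = g x := fun x hx => by
    simp only [F, if_pos hx]
    exact AddCircle.coe_equivIco
  have hFmem : ∀ x ∈ Set.Ioo a (a + 1), F x ∈ Set.Ioo a (a + 1) := fun x hx => by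
    have h1 : F x ∈ Set.Ico a (a + 1) := by
      simp only [F, if_pos hx]
      exact (AddCircle.equivIco 1 a (g x)).2
    refine ⟨lt_of_le_of_ne h1.1 fun h => coe_ne_coe hx (g.injective ?_), h1.2⟩
    rw [← hFcoe x hx, ← h, hga]
  have hFeq : ∀ x ∈ Set.Ioo a (a + 1), ∀ y ∈ Set.Ioo a (a + 1), g x = y → F x = y :=
    fun x hx y hy h => coe_injOn a (Set.Ioo_subset_Ico_self (hFmem x hx))
      (Set.Ioo_subset_Ico_self hy) ((hFcoe x hx).trans h)
  have hFid : ∀ x, x < a + ε ∨ a + 1 - ε < x → F x = x := by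
    intro x hx
    by_cases hxa : x ∈ Set.Ioo a (a + 1)
    · refine hFeq x hxa x hxa ?_
      rcases hx with hx | hx
      · have := ha (y := x - a) (by rw [abs_lt]; constructor <;> linarith [hxa.1])
        rwa [add_sub_cancel] at this
      · have := ha (y := x - (a + 1)) (by rw [abs_lt]; constructor <;> linarith [hxa.2])
        rwa [← coe_add_one, show a + (x - (a + 1)) + 1 = x by ring] at this
    · exact hFout x hxa
  have hinj : Function.Injective F := by
    intro x y hxy
    by_cases hx : x ∈ Set.Ioo a (a + 1) <;> by_cases hy : y ∈ Set.Ioo a (a + 1)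
    · refine coe_injOn a (Set.Ioo_subset_Ico_self hx) (Set.Ioo_subset_Ico_self hy)
        (g.injective ?_)
      rw [← hFcoe x hx, ← hFcoe y hy, hxy]
    · exact absurd (hFout y hy ▸ hxy ▸ hFmem x hx) hy
    · exact absurd (hFout x hx ▸ hxy.symm ▸ hFmem y hy) hx
    · rwa [hFout x hx, hFout y hy] at hxy
  have hsurj : Function.Surjective F := by
    intro y
    by_cases hy : y ∈ Set.Ioo a (a + 1)
    · have hne : g.symm y ≠ a := fun h => coe_ne_coe hy (by
        rw [← g.apply_symm_apply y, h, hga])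
      obtain ⟨x, hx, hxy⟩ := exists_coe_eq_of_ne a hne
      exact ⟨x, hFeq x hx y hy (by rw [hxy, g.apply_symm_apply])⟩
    · exact ⟨y, hFout y hy⟩
  have hcont : Continuous F := by
    rw [continuous_iff_continuousAt]
    intro x
    by_cases hx : x < a + ε ∨ a + 1 - ε < x
    · have hev : F =ᶠ[𝓝 x] id := by
        have hO : IsOpen {x : ℝ | x < a + ε ∨ a + 1 - ε < x} :=
          isOpen_Iio.union isOpen_Ioi
        filter_upwards [hO.mem_nhds hx] with y hy using hFid y hy
      exact continuousAt_id.congr hev.symm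
    · rw [not_or, not_lt, not_lt] at hx
      have hxa : x ∈ Set.Ioo a (a + 1) := ⟨by linarith, by linarith⟩
      have hev : F =ᶠ[𝓝 x] fun x => (AddCircle.equivIco 1 a (g x) : ℝ) := by
        filter_upwards [Ioo_mem_nhds hxa.1 hxa.2] with y hy
        exact if_pos hy
      have hne : g x ≠ a := fun h => coe_ne_coe hxa (g.injective (h.trans hga.symm))
      refine ContinuousAt.congr ?_ hev.symm
      refine continuousAt_subtype_val.comp ?_
      exact (AddCircle.continuousAt_equivIco 1 a hne).comp
        (f := fun x : ℝ => g x) (g.continuous.comp (AddCircle.continuous_mk' 1)).continuousAt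
  have hmono : StrictMono F := by
    refine (hcont.strictMono_of_inj hinj).resolve_right fun h => ?_
    have := h (show a - 1 < a by linarith)
    rw [hFout a (by simp), hFout (a - 1) (by simp)] at this
    linarith
  -- the lift is dyadic piecewise linear because it is a local lift of `g`
  have hmem : hmono.orderIsoOfSurjective F hsurj ∈ compactPL a (a + 1) := by
    refine ⟨⟨⟨Set.Ico a (a + 1) ∩ (fun x : ℝ => (x : UnitAddCircle)) ⁻¹' B, ?_, ?_, ?_⟩, ?_⟩,
      ε / 2, by linarith, fun x hx => hFid x (hx.imp (fun h => by linarith) fun h => by linarith)⟩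
    · exact Set.Finite.of_finite_image (hB.subset (by rintro _ ⟨x, hx, rfl⟩; exact hx.2))
        ((coe_injOn a).mono Set.inter_subset_left)
    · exact fun x hx => coe_mem_dyadicPoints.1 (hBd hx.2)
    · intro x hx
      have hc : ∀ k : ℤ, ∀ y : ℝ, Filter.Tendsto (fun t : ℝ => y + (2 : ℝ) ^ k * t) (𝓝 0) (𝓝 y) :=
        fun k y => by simpa using (tendsto_zpow_mul_zero k).const_add y
      by_cases hx' : x < a + ε ∨ a + 1 - ε < x
      · refine ⟨0, ?_⟩
        have hO : IsOpen {x : ℝ | x < a + ε ∨ a + 1 - ε < x} := isOpen_Iio.union isOpen_Ioi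
        filter_upwards [(hc 0 x).eventually (hO.mem_nhds hx')] with t ht
        rw [zpow_zero, one_mul] at ht ⊢
        exact (hFid _ ht).trans (by rw [StrictMono.coe_orderIsoOfSurjective, hFid x hx'])
      · rw [not_or, not_lt, not_lt] at hx'
        have hxa : x ∈ Set.Ioo a (a + 1) := ⟨by linarith, by linarith⟩
        obtain ⟨k, hk⟩ := hBa x fun h => hx ⟨Set.Ioo_subset_Ico_self hxa, h⟩
        refine ⟨k, ?_⟩
        filter_upwards [hk, (hc 0 x).eventually (Ioo_mem_nhds hxa.1 hxa.2),
          (hc k (F x)).eventually (Ioo_mem_nhds (hFmem x hxa).1 (hFmem x hxa).2)] with t h1 h2 h3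
        rw [zpow_zero, one_mul] at h2
        refine hFeq _ h2 _ h3 ?_
        rw [AddCircle.coe_add, h1, StrictMono.coe_orderIsoOfSurjective, AddCircle.coe_add,
          hFcoe x hxa]
    · intro x
      rw [StrictMono.coe_orderIsoOfSurjective]
      by_cases hxa : x ∈ Set.Ioo a (a + 1)
      · rw [← coe_mem_dyadicPoints, hFcoe x hxa, hd, coe_mem_dyadicPoints]
      · rw [hFout x hxa]
  refine ⟨⟨_, hmem⟩, Homeomorph.ext fun y => ?_⟩
  by_cases hy : y = a
  · subst hy
    have := (eventually_circleHom_coe ⟨_, hmem⟩).self_of_nhds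
    rw [add_zero] at this
    rw [this, hga]
  · obtain ⟨x, hx, rfl⟩ := exists_coe_eq_of_ne a hy
    rw [circleHom_coe _ (Set.Ioo_subset_Icc_self hx)]
    exact hFcoe x hx

/-! ### Germs at a point of the circle -/

section GermHom

variable {G : Subgroup (UnitAddCircle ≃ₜ UnitAddCircle)}

theorem circleHom_mem_thompsonF (f : compactPL 0 (0 + 1)) : circleHom 0 f ∈ thompsonF :=
  ⟨circleHom_mem_thompsonT f, by
    have := (eventually_circleHom_coe f).self_of_nhds
    rwa [add_zero] at this⟩

theorem circleHom_injective (a : ℝ) : Function.Injective (circleHom a) := by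
  rw [injective_iff_map_eq_one]
  intro f hf
  refine Subtype.ext (RelIso.ext fun x => ?_)
  by_cases hx : x ∈ Set.Ioo a (a + 1)
  · refine coe_injOn a (Set.Ioo_subset_Ico_self (compactPL_apply_mem_Ioo f.2 hx))
      (Set.Ioo_subset_Ico_self hx) ?_
    have := circleHom_coe f (Set.Ioo_subset_Icc_self hx)
    rw [hf] at this
    exact this.symm
  · obtain ⟨-, ε, hε, hfε⟩ := f.2
    rw [Set.mem_Ioo, not_and_or, not_lt, not_lt] at hx
    exact hfε x (hx.imp (fun h => by linarith) fun h => by linarith)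

/-- The homomorphism `circleHom a`, with values in a group that contains its image. -/
noncomputable def germHom {a : ℝ} (h : ∀ f, circleHom a f ∈ G) : compactPL a (a + 1) →* G :=
  (circleHom a).codRestrict G h

theorem germHom_smul {a : ℝ} (h : ∀ f, circleHom a f ∈ G) (f : compactPL a (a + 1)) {x : ℝ}
    (hx : x ∈ Set.Icc a (a + 1)) :
    germHom h f • (x : UnitAddCircle) = ((f.1 x : ℝ) : UnitAddCircle) :=
  circleHom_coe f hx

theorem germHom_injective {a : ℝ} (h : ∀ f, circleHom a f ∈ G) :
    Function.Injective (germHom h) := fun _ _ hfg =>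
  circleHom_injective a (congrArg Subtype.val hfg)

theorem range_germHom {a : ℝ} (h : ∀ f, circleHom a f ∈ G) (hG : G ≤ thompsonT) :
    (germHom h).range = nbhdStabilizer G (a : UnitAddCircle) := by
  ext g
  constructor
  · rintro ⟨f, rfl⟩
    exact eventually_nhds_coe.2 (eventually_circleHom_coe f)
  · intro hg
    obtain ⟨f, hf⟩ := exists_circleHom_eq (hG g.2) hg
    exact ⟨f, Subtype.ext hf⟩

end GermHom

/-! ### Points fixed by a germ stabilizer -/

theorem compactPL_mono {a b a' b' : ℝ} (ha : a' ≤ a) (hb : b ≤ b') :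
    compactPL a b ≤ compactPL a' b' := by
  rintro f ⟨hf, ε, hε, hfε⟩
  exact ⟨hf, ε, hε, fun x hx => hfε x (hx.imp (fun h => by linarith) fun h => by linarith)⟩

/-- If a group between `F` and `T` acts on a compact space with all stabilizers meeting a given
finite set of non-trivial elements, then some stabilizer contains the whole germ stabilizer of the
point `0` of the circle. -/
theorem exists_nbhdStabilizer_zero_le_stabilizer {G : Subgroup (UnitAddCircle ≃ₜ UnitAddCircle)}
    (hF : thompsonF ≤ G) (hT : G ≤ thompsonT) {X : Type*} [TopologicalSpace X] [CompactSpace X]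
    [T2Space X] [Nonempty X] [MulAction G X] [ContinuousConstSMul G X]
    (hP : ∃ P : Finset G, 1 ∉ P ∧ ∀ x : X, ∃ p ∈ P, p • x = x) :
    ∃ x : X, nbhdStabilizer G (0 : UnitAddCircle) ≤ MulAction.stabilizer G x := by
  have hmem : ∀ f, circleHom 0 f ∈ G := fun f => hF (circleHom_mem_thompsonF f)
  let ι := {i : ℝ × ℝ // 0 ≤ i.1 ∧ i.1 < i.2 ∧ i.2 ≤ 0 + 1}
  let J : ∀ i : ι, compactPL i.1.1 i.1.2 →* G := fun i =>
    (germHom hmem).comp (Subgroup.inclusion (compactPL_mono i.2.1 i.2.2.2))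
  have hJ : ∀ i, Function.Injective (J i) := fun i =>
    (germHom_injective hmem).comp (Subgroup.inclusion_injective _)
  have e := fun i => MonoidHom.ofInjective (hJ i)
  have hsimple : ∀ i : ι, IsSimpleGroup (compactPL i.1.1 i.1.2) := fun i =>
    compactPL_isSimpleGroup i.2.2.1
  obtain ⟨x₀, ⟨⟨p, q⟩, hp, hpq, hq⟩, hx₀⟩ := exists_le_stabilizer_of_confined (X := X)
    (Y := UnitAddCircle)
    (fun i : ι => (fun x : ℝ => (x : UnitAddCircle)) '' Set.Ioo i.1.1 i.1.2)
    (fun i => (J i).range)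
    (fun O hO ⟨y, hy⟩ => by
      obtain ⟨x, hx, rfl⟩ := exists_coe_eq 0 y
      have hO' := hO.preimage (AddCircle.continuous_mk' (1 : ℝ))
      have hx' : x ∈ closure (Set.Ioo (0 : ℝ) (0 + 1)) := by
        rw [closure_Ioo (by norm_num)]
        exact Set.Ico_subset_Icc_self hx
      obtain ⟨p, q, hpq, hsub⟩ := (hO'.inter isOpen_Ioo).exists_Ioo_subset
        (mem_closure_iff.1 hx' _ hO' hy)
      have h01 := (Set.Ioo_subset_Ioo_iff hpq).1 (hsub.trans Set.inter_subset_right)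
      refine ⟨⟨(p, q), h01.1, hpq, h01.2⟩, ?_⟩
      rintro _ ⟨t, ht, rfl⟩
      exact (hsub ht).1)
    (by
      rintro ⟨⟨p, q⟩, hp, hpq, hq⟩ _ ⟨f, rfl⟩ y hy
      obtain ⟨x, hx, rfl⟩ := exists_coe_eq 0 y
      have hx' : x ∉ Set.Ioo p q := fun h => hy ⟨x, h, rfl⟩
      refine (germHom_smul hmem _ (Set.Ico_subset_Icc_self hx)).trans ?_
      obtain ⟨-, ε, hε, hfε⟩ := f.2
      rw [Set.mem_Ioo, not_and_or, not_lt, not_lt] at hx'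
      exact congrArg _ (hfε x (hx'.imp (fun h => by linarith) fun h => by linarith)))
    (fun i => (e i).symm.isSimpleGroup)
    (fun i => by
      have := compactPL_infinite i.2.2.1
      exact Infinite.of_injective (e i) (e i).injective)
    (fun i => by
      have := compactPL_infinite i.2.2.1
      obtain ⟨a, b, hab⟩ := exists_mul_ne_of_perfect (compactPL_perfect i.2.2.1)
      exact ⟨e i a, e i b, fun h => hab ((e i).injective (by simpa using h))⟩) hP
  let ε : ℕ → ℝ := fun k => 1 / (k + 3)
  have hε : ∀ k, 0 < ε k ∧ ε k ≤ 1 / 3 := fun k => by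
    have hk : (0 : ℝ) ≤ k := k.cast_nonneg
    exact ⟨by positivity, one_div_le_one_div_of_le (by norm_num) (by linarith)⟩
  let Z : ℕ → Set X := fun k => {x | ∀ f : compactPL 0 (0 + 1),
    (∀ t, t ≤ ε k ∨ 1 - ε k ≤ t → f.1 t = t) → germHom hmem f • x = x}
  have hZ : (⋂ k, Z k).Nonempty := by
    have hclosed : ∀ k, IsClosed (Z k) := fun k => by
      simp only [Z, Set.ofPred_forall]
      exact isClosed_iInter fun g => isClosed_iInter fun _ =>
        isClosed_eq (continuous_const_smul (germHom hmem g)) continuous_id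
    refine IsCompact.nonempty_iInter_of_sequence_nonempty_isCompact_isClosed Z
      (fun k x hx f hf => hx f fun t ht => hf t ?_) (fun k => ?_) (hclosed 0).isCompact hclosed
    · have : ε (k + 1) ≤ ε k := by
        refine one_div_le_one_div_of_le (by positivity) ?_
        push_cast
        linarith
      exact ht.imp (fun h => by linarith) fun h => by linarith
    · -- move `x₀` by an element expanding the interval `(p, q)`
      obtain ⟨c, hc, hc0, hck⟩ := exists_isDyadic_between (hε k).1
      obtain ⟨d, hd, hdk, hd1⟩ := exists_isDyadic_between
        (show 1 - ε k < 1 by linarith [(hε k).1])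
      obtain ⟨p', hp', hpp', hp'q⟩ := exists_isDyadic_between hpq
      obtain ⟨q', hq', hpq', hq'q⟩ := exists_isDyadic_between hp'q
      dsimp only at hp hpq hq hpp' hp'q hpq' hq'q
      obtain ⟨φ, hφ, hφc, hφd⟩ :=
        exists_map_interval hc hd (by linarith [(hε k).2]) hp' hq' hpq'
      obtain ⟨h, hh, hhφ⟩ := exists_extend (a := 0) (b := 0 + 1) hφ hc hd hc0
        (by linarith [(hε k).2]) (by linarith) (by rw [hφc]; linarith) (by rw [hφd]; linarith)
      have hcd : c ≤ d := by linarith [(hε k).2]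
      refine ⟨(germHom hmem ⟨h, hh⟩)⁻¹ • x₀, fun f hf => ?_⟩
      have hconj : h * f.1 * h⁻¹ ∈ compactPL p q := by
        refine compactPL_conj_mem (a' := c) (b' := d) hh.1 f.2.1
          (fun x hx => hf x (hx.imp (fun h => by linarith) fun h => by linarith)) ?_ ?_
        · rw [hhφ c le_rfl hcd, hφc]
          exact hpp'
        · rw [hhφ d hcd le_rfl, hφd]
          exact hq'q
      have hst : germHom hmem (⟨h, hh⟩ * f * ⟨h, hh⟩⁻¹) ∈ MulAction.stabilizer G x₀ :=
        hx₀ ⟨⟨_, hconj⟩, rfl⟩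
      rw [MulAction.mem_stabilizer_iff, map_mul, map_mul, map_inv, mul_smul, mul_smul] at hst
      rw [eq_inv_smul_iff]
      exact hst
  obtain ⟨x, hx⟩ := hZ
  refine ⟨x, ?_⟩
  have h0 := range_germHom hmem hT
  rw [AddCircle.coe_zero] at h0
  rw [← h0]
  rintro _ ⟨f, rfl⟩
  obtain ⟨-, δ, hδ, hfδ⟩ := f.2
  obtain ⟨k, hk⟩ := exists_nat_gt (1 / δ)
  have hεδ : ε k ≤ δ := by
    rw [div_lt_iff₀ hδ] at hk
    simp only [ε]
    rw [div_le_iff₀ (by positivity)]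
    nlinarith
  exact Set.mem_iInter.1 hx k f fun t ht =>
    hfδ t (ht.imp (fun h => by linarith) fun h => by linarith)

/-! ### Actions of `F` -/

theorem thompsonF_smul_zero (g : thompsonF) : g • (0 : UnitAddCircle) = 0 := g.2.2

open scoped Pointwise in
/-- Faithful minimal actions of `F` are topologically free: the germ stabilizer of `0` is normal
in `F`, so that it would act trivially as soon as it fixes a point. -/
theorem isTopologicallyFree_thompsonF (X : Type*) [TopologicalSpace X] [CompactSpace X] [T2Space X]
    [MulAction thompsonF X] [ContinuousConstSMul thompsonF X] [FaithfulSMul thompsonF X]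
    [MulAction.IsMinimal thompsonF X] : IsTopologicallyFree thompsonF X := by
  by_contra hfree
  obtain ⟨hX, hP⟩ := exists_finset_confining hfree
  obtain ⟨x, hx⟩ := exists_nbhdStabilizer_zero_le_stabilizer le_rfl inf_le_left hP
  let N := nbhdStabilizer thompsonF (0 : UnitAddCircle)
  have hcl : IsClosed {x : X | N ≤ MulAction.stabilizer thompsonF x} := by
    simp only [SetLike.le_def, MulAction.mem_stabilizer_iff, Set.ofPred_forall]
    exact isClosed_iInter fun g => isClosed_iInter fun _ =>
      isClosed_eq (continuous_const_smul g) continuous_id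
  have hinv : ∀ g : thompsonF, g • {x : X | N ≤ MulAction.stabilizer thompsonF x} ⊆
      {x : X | N ≤ MulAction.stabilizer thompsonF x} := by
    rintro g _ ⟨y, hy, rfl⟩
    have := nbhdStabilizer_le_smul g hy
    rwa [thompsonF_smul_zero] at this
  obtain ⟨f, hf, hfx⟩ := exists_mem_compactPL_lt (a := 0) (b := 0 + 1) (x := 1 / 2)
    (by norm_num) (by norm_num)
  have hfN : germHom circleHom_mem_thompsonF ⟨f, hf⟩ ∈ N := by
    have h0 := range_germHom circleHom_mem_thompsonF inf_le_left
    rw [AddCircle.coe_zero] at h0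
    simp only [N]
    rw [← h0]
    exact ⟨_, rfl⟩
  rcases eq_empty_or_univ_of_smul_invariant_closed thompsonF hcl hinv with h | h
  · exact (h ▸ hx : x ∈ (∅ : Set X))
  · have h1 : germHom circleHom_mem_thompsonF ⟨f, hf⟩ = 1 := by
      refine eq_of_smul_eq_smul (α := X) fun y => ?_
      have hy : y ∈ {x : X | N ≤ MulAction.stabilizer thompsonF x} := h ▸ Set.mem_univ y
      rw [one_smul]
      exact hy hfN
    have h2 := germHom_injective circleHom_mem_thompsonF (h1.trans (map_one _).symm)
    have h3 : f = 1 := congrArg Subtype.val h2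
    rw [h3] at hfx
    exact lt_irrefl _ hfx

/-! ### Actions of `T` -/

/-- The rotation by a dyadic angle, as an element of `T`. -/
noncomputable def rotation (r : ℝ) (hr : IsDyadic r) : thompsonT :=
  ⟨Homeomorph.addRight (r : UnitAddCircle),
    ⟨∅, Set.finite_empty, Set.empty_subset _, fun x _ =>
      ⟨0, Filter.Eventually.of_forall fun t => by simp [add_right_comm]⟩⟩, fun x => by
    obtain ⟨x, -, rfl⟩ := exists_coe_eq 0 x
    show (x : UnitAddCircle) + (r : UnitAddCircle) ∈ dyadicPoints ↔ _
    rw [← AddCircle.coe_add, coe_mem_dyadicPoints, coe_mem_dyadicPoints]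
    exact ⟨fun h => by simpa using h.sub hr, fun h => h.add hr⟩⟩

instance isMinimal_thompsonT : MulAction.IsMinimal thompsonT UnitAddCircle := by
  refine ⟨fun x => dense_iff_inter_open.2 fun O hO ⟨y, hy⟩ => ?_⟩
  obtain ⟨x, -, rfl⟩ := exists_coe_eq 0 x
  obtain ⟨y, -, rfl⟩ := exists_coe_eq 0 y
  have hO' : IsOpen ((fun r : ℝ => ((x + r : ℝ) : UnitAddCircle)) ⁻¹' O) :=
    hO.preimage ((AddCircle.continuous_mk' (1 : ℝ)).comp (continuous_const.add continuous_id))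
  obtain ⟨p, q, hpq, hsub⟩ := hO'.exists_Ioo_subset ⟨y - x, by
    rw [Set.mem_preimage, add_sub_cancel]
    exact hy⟩
  obtain ⟨r, hr, hpr, hrq⟩ := exists_isDyadic_between hpq
  exact ⟨rotation r hr • (x : UnitAddCircle), hsub ⟨hpr, hrq⟩, MulAction.mem_orbit _ _⟩

theorem exists_mem_nbhdStabilizer_smul_ne_circle (z y : UnitAddCircle) (h : y ≠ z) :
    ∃ g ∈ nbhdStabilizer thompsonT z, g • y ≠ y := by
  obtain ⟨a, -, rfl⟩ := exists_coe_eq 0 z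
  obtain ⟨t, ht, rfl⟩ := exists_coe_eq_of_ne a h
  obtain ⟨f, hf, hft⟩ := exists_mem_compactPL_lt ht.1 ht.2
  refine ⟨germHom circleHom_mem_thompsonT ⟨f, hf⟩, ?_, fun heq => hft.ne' ?_⟩
  · rw [← range_germHom circleHom_mem_thompsonT le_rfl]
    exact ⟨_, rfl⟩
  · rw [germHom_smul _ _ (Set.Ioo_subset_Icc_self ht)] at heq
    exact coe_injOn a (Set.Ioo_subset_Ico_self (compactPL_apply_mem_Ioo hf ht))
      (Set.Ioo_subset_Ico_self ht) heq

/-- The germ stabilizer of a point has infinite orbits on the other points. -/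
theorem infinite_orbit_nbhdStabilizer (z y : UnitAddCircle) (h : y ≠ z) :
    {y' | ∃ g ∈ nbhdStabilizer thompsonT z, g • y = y'}.Infinite := by
  obtain ⟨a, -, rfl⟩ := exists_coe_eq 0 z
  obtain ⟨t, ht, rfl⟩ := exists_coe_eq_of_ne a h
  obtain ⟨f, hf, hft⟩ := exists_mem_compactPL_lt ht.1 ht.2
  have hmem : ∀ n : ℕ, f ^ n ∈ compactPL a (a + 1) := fun n => Subgroup.pow_mem _ hf n
  have hmono : StrictMono fun n : ℕ => (f ^ n) t := by
    refine strictMono_nat_of_lt_succ fun n => ?_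
    rw [pow_succ, RelIso.mul_apply]
    exact (f ^ n).strictMono hft
  have hinj : Function.Injective fun n : ℕ => (((f ^ n) t : ℝ) : UnitAddCircle) := by
    intro m n hmn
    exact hmono.injective (coe_injOn a
      (Set.Ioo_subset_Ico_self (compactPL_apply_mem_Ioo (hmem m) ht))
      (Set.Ioo_subset_Ico_self (compactPL_apply_mem_Ioo (hmem n) ht)) hmn)
  refine (Set.infinite_range_of_injective hinj).mono ?_
  rintro _ ⟨n, rfl⟩
  refine ⟨germHom circleHom_mem_thompsonT ⟨_, hmem n⟩, ?_,
    germHom_smul _ _ (Set.Ioo_subset_Icc_self ht)⟩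
  rw [← range_germHom circleHom_mem_thompsonT le_rfl]
  exact ⟨_, rfl⟩

/-- If `g ∈ T` is affine near `y` and `z ∉ {y, g y}`, then some element of `T` that is trivial
near `z` coincides with `g` near `y`. -/
theorem exists_mem_nbhdStabilizer_eventuallyEq {g : thompsonT} {y z : UnitAddCircle}
    (hg : IsAffineDyadicAt g.1 y) (hyz : y ≠ z) (hgyz : g • y ≠ z) :
    ∃ u ∈ nbhdStabilizer thompsonT z, ∀ᶠ w in 𝓝 y, g • w = u • w := by
  obtain ⟨a, -, rfl⟩ := exists_coe_eq 0 z
  obtain ⟨t, ht, rfl⟩ := exists_coe_eq_of_ne a hyz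
  obtain ⟨s, hs, hst⟩ := exists_coe_eq_of_ne a hgyz
  obtain ⟨k, hk⟩ := hg
  have hk' : ∀ᶠ r in 𝓝 (0 : ℝ),
      g • ((t + r : ℝ) : UnitAddCircle) = ((s + (2 : ℝ) ^ k * r : ℝ) : UnitAddCircle) := by
    filter_upwards [hk] with r hr
    rw [AddCircle.coe_add, AddCircle.coe_add, hst]
    exact hr
  have hin : ∀ᶠ r in 𝓝 (0 : ℝ), t + r ∈ Set.Ioo a (a + 1) ∧
      s + (2 : ℝ) ^ k * r ∈ Set.Ioo a (a + 1) := by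
    have h1 : Filter.Tendsto (fun r : ℝ => t + r) (𝓝 0) (𝓝 t) := by
      simpa using (Filter.tendsto_id (x := 𝓝 (0 : ℝ))).const_add t
    have h2 : Filter.Tendsto (fun r : ℝ => s + (2 : ℝ) ^ k * r) (𝓝 0) (𝓝 s) := by
      simpa using (tendsto_zpow_mul_zero k).const_add s
    exact (h1.eventually (Ioo_mem_nhds ht.1 ht.2)).and (h2.eventually (Ioo_mem_nhds hs.1 hs.2))
  obtain ⟨δ, hδ, hball⟩ := Metric.eventually_nhds_iff.1 (hk'.and hin)
  simp only [Real.dist_eq, sub_zero] at hball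
  obtain ⟨c, hc, hcl, hcr⟩ := exists_isDyadic_between (show t - δ < t by linarith)
  obtain ⟨d, hd, hdl, hdr⟩ := exists_isDyadic_between (show t < t + δ by linarith)
  obtain ⟨hc1, hc2, hc3⟩ := hball (y := c - t) (by rw [abs_lt]; constructor <;> linarith)
  obtain ⟨-, hd2, hd3⟩ := hball (y := d - t) (by rw [abs_lt]; constructor <;> linarith)
  rw [add_sub_cancel] at hc1 hc2 hd2
  -- the germ of `g` is dyadic because `g` sends the dyadic point `c` to a dyadic point
  have hdy : IsDyadic (s - (2 : ℝ) ^ k * t) := by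
    have h1 : IsDyadic (s + (2 : ℝ) ^ k * (c - t)) := by
      rw [← coe_mem_dyadicPoints, ← hc1]
      exact (g.2.dyadic c).2 (coe_mem_dyadicPoints.2 hc)
    have h2 := h1.sub (hc.zpow_mul k)
    rwa [show s + (2 : ℝ) ^ k * (c - t) - 2 ^ k * c = s - 2 ^ k * t by ring] at h2
  have haff : ∀ x, affineIso k (s - (2 : ℝ) ^ k * t) x = s + (2 : ℝ) ^ k * (x - t) := fun x => by
    rw [affineIso_apply]
    ring
  obtain ⟨h, hh, hhx⟩ := exists_extend (affineIso_mem k hdy) hc hd hc2.1 (hcr.trans hdl) hd2.2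
    (by rw [haff]; exact hc3.1) (by rw [haff]; exact hd3.2)
  refine ⟨germHom circleHom_mem_thompsonT ⟨h, hh⟩, ?_, ?_⟩
  · rw [← range_germHom circleHom_mem_thompsonT le_rfl]
    exact ⟨_, rfl⟩
  · rw [eventually_nhds_coe]
    filter_upwards [hk', hin, Ioo_mem_nhds (sub_neg.2 hcr) (sub_pos.2 hdl)] with r h1 h2 h3
    rw [h1, germHom_smul _ _ (Set.Ioo_subset_Icc_self h2.1),
      hhx _ (by linarith [h3.1]) (by linarith [h3.2]), haff, add_sub_cancel_left]

/-- The group `T` is generated by any two of its germ stabilizers. Since an element of `T` need not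
be affine near `z`, its germ is taken at a translate of `z` by `T⁰_z'` that is not a breakpoint. -/
theorem nbhdStabilizer_sup_circle (z z' : UnitAddCircle) (hne : z ≠ z') :
    nbhdStabilizer thompsonT z ⊔ nbhdStabilizer thompsonT z' = ⊤ := by
  rw [eq_top_iff]
  intro g _
  obtain ⟨⟨B, hB, -, hBa⟩, -⟩ := g.2
  -- a translate `y` of `z` at which `g` is affine and that `g` does not send to `z'`
  obtain ⟨_, ⟨v, hv, rfl⟩, hy⟩ := (infinite_orbit_nbhdStabilizer z' z hne).exists_notMem_finite
    (hB.insert (g⁻¹ • z'))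
  rw [Set.mem_insert_iff, not_or, eq_inv_smul_iff] at hy
  have hyz' : v • z ≠ z' := by
    have hvz' : v • z' = z' := (show ∀ᶠ w in 𝓝 z', v • w = w from hv).self_of_nhds
    intro h
    exact hne (MulAction.injective v (h.trans hvz'.symm))
  obtain ⟨u, hu, hgu⟩ := exists_mem_nbhdStabilizer_eventuallyEq (hBa _ hy.2) hyz' hy.1
  have h1 : u⁻¹ * g ∈ nbhdStabilizer thompsonT (v • z) := by
    show ∀ᶠ w in 𝓝 (v • z), (u⁻¹ * g) • w = w
    filter_upwards [hgu] with w hw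
    rw [mul_smul, hw, inv_smul_smul]
  have h2 := conj_mem_nbhdStabilizer h1 v⁻¹
  rw [inv_smul_smul, inv_inv] at h2
  have h3 := Subgroup.mem_sup_left (T := nbhdStabilizer thompsonT z') h2
  have h4 := Subgroup.mem_sup_right (S := nbhdStabilizer thompsonT z) hu
  have h5 := Subgroup.mem_sup_right (S := nbhdStabilizer thompsonT z) hv
  have h6 := Subgroup.mul_mem _ (Subgroup.mul_mem _ h4 (Subgroup.mul_mem _ h5 h3))
    (Subgroup.inv_mem _ h5)
  rwa [show u * (v * (v⁻¹ * (u⁻¹ * g) * v)) * v⁻¹ = g by group] at h6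

/-- A non-trivial minimal action of `T` on a compact space that is not topologically free has a
unique factor map to the circle, which is determined by germ stabilizers. -/
theorem exists_factorMap_circle (X : Type*) [TopologicalSpace X] [CompactSpace X] [T2Space X]
    [MulAction thompsonT X] [ContinuousConstSMul thompsonT X] [MulAction.IsMinimal thompsonT X]
    (hnt : IsNontrivialAction thompsonT X) (hfree : ¬ IsTopologicallyFree thompsonT X) :
    ∃ φ : X → UnitAddCircle, IsFactorMap thompsonT φ ∧
      (∀ ψ : X → UnitAddCircle, IsFactorMap thompsonT ψ → ψ = φ) ∧
      ∀ (x : X) (z : UnitAddCircle),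
        nbhdStabilizer thompsonT z ≤ MulAction.stabilizer thompsonT x ↔ z = φ x := by
  obtain ⟨hX, hP⟩ := exists_finset_confining hfree
  obtain ⟨x, hx⟩ := exists_nbhdStabilizer_zero_le_stabilizer inf_le_left le_rfl hP
  exact existsUnique_factorMap hnt nbhdStabilizer_sup_circle
    exists_mem_nbhdStabilizer_smul_ne_circle ⟨x, 0, hx⟩

end Thompson

theorem corollary4p16 :
    (∀ (X : Type*) [TopologicalSpace X] [CompactSpace X] [T2Space X]
      [MulAction Thompson.thompsonF X] [ContinuousConstSMul Thompson.thompsonF X]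
      [FaithfulSMul Thompson.thompsonF X] [MulAction.IsMinimal Thompson.thompsonF X],
      Thompson.IsTopologicallyFree Thompson.thompsonF X) ∧
    (∀ (X : Type*) [TopologicalSpace X] [CompactSpace X] [T2Space X]
      [MulAction Thompson.thompsonT X] [ContinuousConstSMul Thompson.thompsonT X]
      [MulAction.IsMinimal Thompson.thompsonT X],
      Thompson.IsNontrivialAction Thompson.thompsonT X →
      ¬ Thompson.IsTopologicallyFree Thompson.thompsonT X →
      ∃ φ : X → UnitAddCircle, Thompson.IsFactorMap Thompson.thompsonT φ ∧
        (∀ ψ : X → UnitAddCircle, Thompson.IsFactorMap Thompson.thompsonT ψ → ψ = φ) ∧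
        ∀ (x : X) (z : UnitAddCircle),
          Thompson.nbhdStabilizer Thompson.thompsonT z ≤
            MulAction.stabilizer Thompson.thompsonT x ↔ z = φ x) ∧
    (∀ (X : Type*) [TopologicalSpace X] [CompactSpace X] [T2Space X]
      [MulAction Thompson.thompsonV X] [ContinuousConstSMul Thompson.thompsonV X]
      [MulAction.IsMinimal Thompson.thompsonV X],
      Thompson.IsNontrivialAction Thompson.thompsonV X →
      ¬ Thompson.IsTopologicallyFree Thompson.thompsonV X →
      ∃ φ : X → Thompson.Cantor, Thompson.IsFactorMap Thompson.thompsonV φ ∧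
        (∀ ψ : X → Thompson.Cantor, Thompson.IsFactorMap Thompson.thompsonV ψ → ψ = φ) ∧
        ∀ (x : X) (z : Thompson.Cantor),
          Thompson.nbhdStabilizer Thompson.thompsonV z ≤
            MulAction.stabilizer Thompson.thompsonV x ↔ z = φ x) :=
  ⟨fun X => Thompson.isTopologicallyFree_thompsonF X,
    fun X => Thompson.exists_factorMap_circle X, fun X => Thompson.exists_factorMap_cantor X⟩
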